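/- Theorem 1.3. Multigraphs are finite and may have loops and parallel edges; a loop adds 2 to the degree of its vertex. For a multigraph $G=(V,E)$ and $X\subseteq V$ let $i(X)$ be the number of edges (including loops) induced by $X$. A multigraph $G=(V,E)$ with $V\neq\emptyset$ is a $(2,1)$-circuit if $|E|=2|V|$ and $i(X)\le 2|X|-1$ for every non-empty $X\subsetneq V$. Let $\mathcal{M}$ be the class of all $(2,1)$-circuits $G$ such that either $G$ is simple, or all of the following hold: * $G$ is 3-connected or has fewer than four vertices; * every edge multiplicity is at most three; * every vertex incident with a multiple edge (at least two parallel non-loop edges) has degree greater than three; * every vertex incident with a loop has degree greater than three and is not incident with a multiple edge; * if a vertex $v$ is incident with two loops, then $V=\{v\}$. Here a multigraph is 3-connected if it has at least four vertices and deleting any set of at most two vertices leaves it connected. A $k$-edge-cutset is a set of $k$ edges whose removal disconnects the graph; it is non-trivial if no component of the resulting graph is a single vertex. $G$ is essentially $k$-edge-connected if it has no non-trivial $(k-1)$-edge-cutset. A set $X\subsetneq V$ is critical if $i(X)=2|X|-1$, and a critical set $X$ is proper if $|X|<|V|-1$. A node of $G$ is a vertex of degree 3. A 1-extension of a multigraph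 deletes an edge $xy$ and adds a new vertex $v$ and edges $xv,yv,zv$, where $x,y,z$ are distinct vertices of that multigraph; the inverse operation is a 1-reduction. A node $v$ of $G$ is admissible if some 1-reduction of $G$ removes $v$, adds an edge between two vertices that are non-adjacent in $G$, and yields a $(2,1)$-circuit (which is simple whenever $G$ is simple). The set $\mathcal{G}^*$ of base graphs consists of the following multigraphs, up to isomorphism (writing $ij$ for an edge joining $i$ and $j$). * $K_5$; $K_6$ minus the edges of a triangle; $K_6$ minus the edges of a path with three edges. * On $\{0,\dots,6\}$, the three graphs with edge sets $\{01,03,04,12,13,14,23,24,34,35,36,46,45,56\}$; $\{01,02,03,04,13,14,23,25,26,34,35,36,56,05\}$; and $\{52,21,04,42,23,46,31,62,20,65,54,01,36,03\}$. * On $\{0,\dots,7\}$: $S_1$, two disjoint copies of $K_4$ on $\{0,1,2,3\}$ and $\{4,5,6,7\}$ together with the edges $14,36,05,27$; and the three graphs $S_2,S_3,S_4$ that consist of the edges $01,12,23,45,56,67,04,15,26,37,05,14,27,36$ together with $13,57$ (for $S_2$), $25,16$ (for $S_3$), $16,57$ (for $S_4$). * $S_5$: on $\{0,\dots,8\}$,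 the graph with edges $01,02,03,12,13,14,23,24,34,45,46,47,48,56,57,58,67,68$. * On at most three vertices: one vertex with two loops; a triangle with every edge doubled; a triangle with one edge tripled and a loop at the opposite vertex; a triangle with a loop at each vertex. * $K_4$ with one of the following additions: a loop at each of two distinct vertices; one edge doubled and a loop at a vertex not on that edge; one edge tripled; two disjoint edges doubled; two edges sharing exactly one vertex doubled. * $K_5$ minus an edge $ab$, with one of the following additions: a loop at a vertex other than $a,b$; a loop at $a$; an edge not incident with $a$ or $b$ doubled; an edge incident with $a$ doubled. Let $G=(V,E)\in\mathcal{M}$ be 3-connected with minimum degree 3 and $G\notin\mathcal{G}^*$. Suppose that either (i) $G$ is essentially 5-edge-connected and has no proper critical set, or (ii) $G$ is essentially 4-edge-connected and has a proper critical set. Then $G$ has an admissible node. -/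

import Mathlib

namespace Graph

variable {α β : Type*}

/-- The number `i_G(X)` of edges of `G` induced by the vertex set `X` (loops included). -/
noncomputable def inducedCount (G : Graph α β) (X : Set α) : ℕ := E(G.induce X).ncard

/-- The number of parallel edges of `G` with ends `x` and `y`; for `x = y`, the number of loops
at `x`. -/
noncomputable def linkCount (G : Graph α β) (x y : α) : ℕ := {e | G.IsLink e x y}.ncard

/-- The degree of a vertex: the number of incident edges, where each loop counts twice. -/
noncomputable def valency (G : Graph α β) (v : α) : ℕ :=
  {e | G.Inc e v}.ncard + G.linkCount v v

/-- `k` is the minimum degree of `G`. -/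
def IsMinDegree (G : Graph α β) (k : ℕ) : Prop := IsLeast (G.valency '' V(G)) k

/-- Connectedness of a multigraph: parallel edges and loops play no role. -/
def IsConn (G : Graph α β) : Prop := G.toSimpleGraph.Connected

/-- `3`-connectedness: at least four vertices, and removing at most two vertices leaves a
connected graph. -/
def IsThreeConn (G : Graph α β) : Prop :=
  4 ≤ V(G).ncard ∧ ∀ S ⊆ V(G), S.ncard ≤ 2 → (G.deleteVerts S).IsConn

/-- `F` is a `k`-edge-cutset: a set of `k` edges whose removal disconnects `G`. -/
def IsEdgeCutset (G : Graph α β) (k : ℕ) (F : Set β) : Prop :=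
  F ⊆ E(G) ∧ F.Finite ∧ F.ncard = k ∧ ¬ (G.deleteEdges F).IsConn

/-- An edge-cutset is trivial if some component of the graph that remains after its removal
consists of a single vertex. -/
def IsTrivialCutset (G : Graph α β) (F : Set β) : Prop :=
  ∃ c : (G.deleteEdges F).toSimpleGraph.ConnectedComponent, c.supp.ncard = 1

/-- `G` has no non-trivial `(k-1)`-edge-cutset (used for `k = 4` and `k = 5`). -/
def IsEssentiallyEdgeConn (G : Graph α β) (k : ℕ) : Prop :=
  ∀ F : Set β, G.IsEdgeCutset (k - 1) F → G.IsTrivialCutset F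

/-- `G` is a (multigraph) `(2,1)`-circuit: a finite non-empty multigraph with `|E| = 2|V|` in which
every non-empty proper subset `X` of the vertex set induces at most `2|X| - 1` edges. -/
structure IsCircuit (G : Graph α β) : Prop where
  finite_vertexSet : V(G).Finite
  finite_edgeSet : E(G).Finite
  nonempty : V(G).Nonempty
  edge_count : E(G).ncard = 2 * V(G).ncard
  sparse : ∀ X : Set α, X ⊂ V(G) → X.Nonempty → G.inducedCount X + 1 ≤ 2 * X.ncard

/-- `X` is critical: a proper subset of the vertex set with `i(X) = 2|X| - 1`. -/
def IsCritical (G : Graph α β) (X : Set α) : Prop :=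
  X ⊂ V(G) ∧ G.inducedCount X + 1 = 2 * X.ncard

/-- `X` is a proper critical set: a critical set with `|X| < |V| - 1`. -/
def IsProperCritical (G : Graph α β) (X : Set α) : Prop :=
  G.IsCritical X ∧ X.ncard + 1 < V(G).ncard

/-- `v` is incident with a multiple edge, i.e. joined to another vertex by at least two edges. -/
def IncMultiple (G : Graph α β) (v : α) : Prop := ∃ w, w ≠ v ∧ 2 ≤ G.linkCount v w

/-- The class `𝓜'` of multigraph circuits. -/
structure InClassM' (G : Graph α β) : Prop where
  isCircuit : G.IsCircuit
  conn : G.IsThreeConn ∨ V(G).ncard < 4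
  linkCount_le : ∀ x y, G.linkCount x y ≤ 3
  multiple : ∀ v ∈ V(G), G.IncMultiple v → 3 < G.valency v
  loop : ∀ v ∈ V(G), 1 ≤ G.linkCount v v → 3 < G.valency v ∧ ¬ G.IncMultiple v
  two_loops : ∀ v ∈ V(G), 2 ≤ G.linkCount v v → V(G) = {v}

/-- The class `𝓜`: the simple `(2,1)`-circuits together with `𝓜'`. -/
def InClassM (G : Graph α β) : Prop := (G.IsCircuit ∧ G.Simple) ∨ G.InClassM'

/-- `G` arises from `H` by the 1-extension that deletes an edge `xy` of `H` and adds a new vertex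
`v` together with the edges `vx`, `vy`, `vz`, where `x`, `y`, `z` are distinct vertices of `H`.
In other words, `H` arises from `G` by the 1-reduction that removes `v` and adds the edge `xy`. -/
def IsOneExtension (H G : Graph α β) (v x y z : α) : Prop :=
  v ∈ V(G) ∧ x ≠ y ∧ x ≠ z ∧ y ≠ z ∧ z ∈ V(H) ∧
  (∃ e₁ e₂ e₃, G.IsLink e₁ v x ∧ G.IsLink e₂ v y ∧ G.IsLink e₃ v z ∧
    ∀ e, G.Inc e v → e = e₁ ∨ e = e₂ ∨ e = e₃) ∧
  ∃ e, H.IsLink e x y ∧ H.deleteEdges {e} = G.deleteVerts {v}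

/-- A node is a vertex of degree three. -/
def IsNode (G : Graph α β) (v : α) : Prop := v ∈ V(G) ∧ G.valency v = 3

/-- The node `v` of `G` is admissible: some 1-reduction removes `v`, adds an edge between two
vertices that are not adjacent in `G`, and results in a `(2,1)`-circuit (a simple one if `G` is
simple). -/
def IsAdmissibleNode (G : Graph α β) (v : α) : Prop :=
  G.IsNode v ∧ ∃ (H : Graph α β) (x y z : α),
    IsOneExtension H G v x y z ∧ ¬ G.Adj x y ∧ H.IsCircuit ∧ (G.Simple → H.Simple)

/-- The multigraph on `Fin n` whose edges are the entries of the list `l`. -/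
def ofEdgeList {n : ℕ} (l : List (Sym2 (Fin n))) : Graph (Fin n) (Fin l.length) where
  vertexSet := Set.univ
  IsLink i a b := s(a, b) = l.get i
  isLink_symm := fun _ _ => ⟨fun _ _ h => Sym2.eq_swap.trans h⟩
  eq_or_eq_of_isLink_of_isLink := by
    intro e x y v w h h'
    have h2 := h.trans h'.symm
    rw [Sym2.eq_iff] at h2
    tauto
  left_mem_of_isLink := fun _ _ _ _ => Set.mem_univ _

/-- Isomorphism of multigraphs. -/
def IsIsomorphic {α' β' : Type*} (G : Graph α β) (H : Graph α' β') : Prop :=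
  ∃ (φ : V(G) ≃ V(H)) (ψ : E(G) ≃ E(H)), ∀ (e : E(G)) (x y : V(G)),
    G.IsLink e x y ↔ H.IsLink (ψ e) (φ x) (φ y)

/-- A finite multigraph presented by its number of vertices and its list of edges. -/
abbrev EdgeList : Type := Σ n : ℕ, List (Sym2 (Fin n))

/-- The simple base graphs `K₅`, `K₆` minus a triangle (`G57` complement), `K₆` minus a path with
three edges (`G59` complement), the complements of `G293`, `G308`, `G312`, and `S₁, …, S₅`. -/
def simpleBaseGraphs : List EdgeList :=
  [⟨5, [s(0, 1), s(0, 2), s(0, 3), s(0, 4), s(1, 2), s(1, 3), s(1, 4), s(2, 3), s(2, 4), s(3, 4)]⟩,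
   ⟨6, [s(0, 1), s(0, 4), s(0, 3), s(1, 2), s(1, 3), s(1, 4), s(2, 4), s(3, 4), s(3, 5), s(4, 5),
     s(1, 5), s(2, 3)]⟩,
   ⟨6, [s(0, 2), s(2, 4), s(1, 3), s(3, 5), s(0, 1), s(2, 3), s(4, 5), s(4, 3), s(2, 1), s(0, 3),
     s(2, 5), s(0, 4)]⟩,
   ⟨7, [s(0, 1), s(0, 3), s(0, 4), s(1, 2), s(1, 3), s(1, 4), s(2, 3), s(2, 4), s(3, 4), s(3, 5),
     s(3, 6), s(4, 6), s(4, 5), s(5, 6)]⟩,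
   ⟨7, [s(0, 1), s(0, 2), s(0, 3), s(0, 4), s(1, 3), s(1, 4), s(2, 3), s(2, 5), s(2, 6), s(3, 4),
     s(3, 5), s(3, 6), s(5, 6), s(0, 5)]⟩,
   ⟨7, [s(5, 2), s(2, 1), s(0, 4), s(4, 2), s(2, 3), s(4, 6), s(3, 1), s(6, 2), s(2, 0), s(6, 5),
     s(5, 4), s(0, 1), s(3, 6), s(0, 3)]⟩,
   ⟨8, [s(0, 1), s(0, 2), s(0, 3), s(1, 2), s(1, 3), s(2, 3), s(4, 5), s(4, 6), s(4, 7), s(5, 6),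
     s(5, 7), s(6, 7), s(1, 4), s(3, 6), s(0, 5), s(2, 7)]⟩,
   ⟨8, [s(0, 1), s(1, 2), s(2, 3), s(4, 5), s(5, 6), s(6, 7), s(0, 4), s(1, 5), s(2, 6), s(3, 7),
     s(0, 5), s(1, 4), s(2, 7), s(3, 6), s(1, 3), s(5, 7)]⟩,
   ⟨8, [s(0, 1), s(1, 2), s(2, 3), s(4, 5), s(5, 6), s(6, 7), s(0, 4), s(1, 5), s(2, 6), s(3, 7),
     s(0, 5), s(1, 4), s(2, 7), s(3, 6), s(2, 5), s(1, 6)]⟩,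
   ⟨8, [s(0, 1), s(1, 2), s(2, 3), s(4, 5), s(5, 6), s(6, 7), s(0, 4), s(1, 5), s(2, 6), s(3, 7),
     s(0, 5), s(1, 4), s(2, 7), s(3, 6), s(1, 6), s(5, 7)]⟩,
   ⟨9, [s(0, 1), s(0, 2), s(0, 3), s(1, 2), s(1, 3), s(1, 4), s(2, 3), s(2, 4), s(3, 4), s(4, 5),
     s(4, 6), s(4, 7), s(4, 8), s(5, 6), s(5, 7), s(5, 8), s(6, 7), s(6, 8)]⟩]

/-- The base graphs `R₀, …, R₁₂` with loops or multiple edges. -/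
def multiBaseGraphs : List EdgeList :=
  [⟨1, [s(0, 0), s(0, 0)]⟩,
   ⟨3, [s(0, 1), s(0, 1), s(1, 2), s(1, 2), s(0, 2), s(0, 2)]⟩,
   ⟨3, [s(0, 1), s(1, 2), s(0, 2), s(0, 2), s(0, 2), s(1, 1)]⟩,
   ⟨3, [s(0, 1), s(1, 2), s(0, 2), s(0, 0), s(1, 1), s(2, 2)]⟩,
   ⟨4, [s(0, 1), s(0, 2), s(0, 3), s(1, 2), s(1, 3), s(2, 3), s(2, 2), s(3, 3)]⟩,
   ⟨4, [s(0, 1), s(0, 2), s(0, 2), s(0, 3), s(1, 2), s(1, 3), s(2, 3), s(3, 3)]⟩,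
   ⟨4, [s(0, 1), s(0, 2), s(0, 2), s(0, 2), s(0, 3), s(1, 2), s(1, 3), s(2, 3)]⟩,
   ⟨4, [s(0, 1), s(0, 2), s(0, 2), s(0, 3), s(1, 2), s(1, 3), s(1, 3), s(2, 3)]⟩,
   ⟨4, [s(0, 1), s(0, 2), s(0, 2), s(0, 3), s(1, 2), s(1, 3), s(2, 3), s(2, 3)]⟩,
   ⟨5, [s(0, 1), s(0, 2), s(0, 3), s(1, 2), s(1, 3), s(1, 4), s(2, 3), s(2, 4), s(3, 4), s(2, 2)]⟩,
   ⟨5, [s(0, 1), s(0, 2), s(0, 3), s(1, 2), s(1, 3), s(1, 4), s(2, 3), s(2, 4), s(3, 4), s(0, 0)]⟩,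
   ⟨5, [s(0, 1), s(0, 2), s(0, 3), s(1, 2), s(1, 3), s(1, 4), s(2, 3), s(2, 4), s(3, 4), s(2, 3)]⟩,
   ⟨5, [s(0, 1), s(0, 2), s(0, 3), s(1, 2), s(1, 3), s(1, 4), s(2, 3), s(2, 4), s(3, 4), s(3, 4)]⟩]

/-- `G` is (isomorphic to) one of the base graphs, i.e. `G ∈ 𝓖*`. -/
def IsBaseGraph (G : Graph α β) : Prop :=
  ∃ B ∈ simpleBaseGraphs ++ multiBaseGraphs, G.IsIsomorphic (ofEdgeList B.2)

end Graph

set_option linter.unusedSectionVars false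

/-! Put `slack X = 2|X| - i(X)`. In a circuit the slack is 0 on `V` and positive on non-empty proper
subsets. It is submodular with an exact error term, the number of edges between `X \ Y` and `Y \ X`,
and the sum of `4 - deg` over `X` is `2 * slack X` minus the size of the edge cut around `X`. The
argument runs on these identities for a multiplicity function; its core is
`IsThreeConnCircuit.isBase`: under the connectivity assumptions, a circuit with a node but no
admissible node is a base graph.

If the 1-reduction at a node that adds `xy` fails, some critical set contains `x` and `y` but
neither the node nor its third neighbour. Uncrossing such blocking sets shows that the neighbours of
a node are pairwise adjacent (clique node) or pairwise non-adjacent (claw node), see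
`clique_or_claw`. Clique nodes are pairwise non-adjacent, and the nodes induce a forest
(`exists_leaf`).

Suppose that `|V| ≥ 6` and there is a proper critical set. Then there is one with a vertex outside
that is not a claw node (`exists_anchor`); let `X` be a largest such set. By maximality and a leaf
argument, no claw node lies outside `X` (`not_claw`) and no node outside `X` has a neighbour in `X`
(`nbrs_disjoint`). The closed neighbourhoods of the nodes outside `X` merge into disjoint sets of
slack at most 2 whose cuts have at least four edges, so each has non-positive total `4 - deg`
(`exists_component`). Hence the total over `V \ X` is non-positive. But it equals the cut around `X`
minus `2 * slack X`, which is at least `3 - 2` (`false_of_max_anchor`).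

Suppose that `|V| ≥ 6` and there is no proper critical set. Then every node lies in a simple `K₄`
formed by its closed neighbourhood. If two of these share at least two vertices, they almost cover
the graph, which is `K₆` minus a triangle or a path (`isBase_of_two_le_inter`). Otherwise a
discharging argument is tight everywhere (`discharge`) and leaves only two copies of `K₄` that share
a vertex of degree six and are joined by two disjoint edges. Circuits on four or five vertices are
identified directly. -/

namespace MultCircuit

variable {α : Type*} [DecidableEq α]

/-! ### Edge counts, slack and degrees of a multiplicity function -/

/-- The total multiplicity between the vertices of `X` and those of `Y`. -/
def between (m : α → α → ℕ) (X Y : Finset α) : ℤ := ∑ x ∈ X, ∑ y ∈ Y, (m x y : ℤ)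

/-- Twice the number of vertices of `X` minus the number of edges induced by `X`. -/
def slack (m : α → α → ℕ) (X : Finset α) : ℤ :=
  2 * X.card - (between m X X + ∑ x ∈ X, (m x x : ℤ)) / 2

/-- The degree of `v` in the multigraph on `V` with multiplicities `m`. -/
def deg (V : Finset α) (m : α → α → ℕ) (v : α) : ℤ := between m {v} V + m v v

/-- The neighbours of `v`. -/
def nbrs (V : Finset α) (m : α → α → ℕ) (v : α) : Finset α := V.filter (fun w => m v w ≠ 0)

section basic
variable {m : α → α → ℕ} {X Y Z : Finset α} {v : α}

theorem between_nonneg (X Y : Finset α) : 0 ≤ between m X Y :=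
  Finset.sum_nonneg fun _ _ => Finset.sum_nonneg fun _ _ => by positivity

theorem between_comm (hm : ∀ x y, m x y = m y x) (X Y : Finset α) :
    between m X Y = between m Y X := by
  unfold between
  rw [Finset.sum_comm]
  simp only [hm]

theorem between_union_left (h : Disjoint X Y) (Z : Finset α) :
    between m (X ∪ Y) Z = between m X Z + between m Y Z := Finset.sum_union h

theorem between_union_right (h : Disjoint Y Z) (X : Finset α) :
    between m X (Y ∪ Z) = between m X Y + between m X Z := by
  unfold between
  rw [← Finset.sum_add_distrib]
  exact Finset.sum_congr rfl fun x _ => Finset.sum_union h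

@[simp] theorem between_empty_right : between m X ∅ = 0 := by simp [between]

theorem between_singleton_left : between m {v} X = ∑ y ∈ X, (m v y : ℤ) := by simp [between]

theorem between_singleton (v w : α) : between m {v} {w} = m v w := by simp [between]

theorem between_insert_left (h : v ∉ X) :
    between m (insert v X) Y = between m {v} Y + between m X Y := by
  rw [Finset.insert_eq, between_union_left (by simpa using h)]

theorem between_insert_right (h : v ∉ Y) :
    between m X (insert v Y) = between m X {v} + between m X Y := by
  rw [Finset.insert_eq, between_union_right (by simpa using h)]

theorem between_mono {X' Y' : Finset α} (hX : X ⊆ X') (hY : Y ⊆ Y') :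
    between m X Y ≤ between m X' Y' := by
  unfold between
  refine (Finset.sum_le_sum fun x _ => Finset.sum_le_sum_of_subset_of_nonneg hY
    fun _ _ _ => by positivity).trans (Finset.sum_le_sum_of_subset_of_nonneg hX fun _ _ _ => ?_)
  exact Finset.sum_nonneg fun _ _ => by positivity

theorem le_between {x y : α} (hx : x ∈ X) (hy : y ∈ Y) : (m x y : ℤ) ≤ between m X Y := by
  rw [← between_singleton]
  exact between_mono (by simpa) (by simpa)

theorem between_eq_zero (h : ∀ x ∈ X, ∀ y ∈ Y, m x y = 0) : between m X Y = 0 :=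
  Finset.sum_eq_zero fun x hx => Finset.sum_eq_zero fun y hy => by simp [h x hx y hy]

theorem eq_zero_of_between {x y : α} (h : between m X Y ≤ 0) (hx : x ∈ X) (hy : y ∈ Y) :
    m x y = 0 := by
  have := le_between (m := m) hx hy
  omega

/-- In `between m X X` a non-loop edge counts twice and a loop once; the extra sum counts each loop
a second time. So the division by two in `slack` is exact. -/
theorem even_total (hm : ∀ x y, m x y = m y x) (X : Finset α) :
    Even (between m X X + ∑ x ∈ X, (m x x : ℤ)) := by
  induction X using Finset.induction_on with
  | empty => simp
  | insert v X hv ih =>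
    rw [between_insert_left hv, between_insert_right hv, between_insert_right hv,
      Finset.sum_insert hv, between_comm hm X {v}, between_singleton]
    obtain ⟨k, hk⟩ := ih
    exact ⟨k + between m {v} X + m v v, by linarith⟩

theorem two_slack (hm : ∀ x y, m x y = m y x) (X : Finset α) :
    2 * slack m X = 4 * X.card - between m X X - ∑ x ∈ X, (m x x : ℤ) := by
  obtain ⟨k, hk⟩ := even_total hm X
  rw [slack, hk, ← two_mul, Int.mul_ediv_cancel_left _ two_ne_zero]
  linarith

theorem slack_union_of_disjoint (hm : ∀ x y, m x y = m y x) (h : Disjoint X Y) :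
    slack m (X ∪ Y) = slack m X + slack m Y - between m X Y := by
  have h1 := two_slack hm (X ∪ Y)
  have h2 := two_slack hm X
  have h3 := two_slack hm Y
  rw [between_union_left h, between_union_right h, between_union_right h, Finset.sum_union h,
    Finset.card_union_of_disjoint h, between_comm hm Y X] at h1
  push_cast at h1
  linarith

theorem slack_empty : slack m (∅ : Finset α) = 0 := by simp [slack]

theorem slack_singleton (hm : ∀ x y, m x y = m y x) (v : α) :
    slack m {v} = 2 - m v v := by
  have := two_slack hm {v}
  simp [between_singleton] at this
  linarith

theorem slack_insert (hm : ∀ x y, m x y = m y x) (h : v ∉ X) :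
    slack m (insert v X) = slack m X + 2 - m v v - between m {v} X := by
  rw [Finset.insert_eq, slack_union_of_disjoint hm (by simpa using h), slack_singleton hm]
  ring

/-- Only the edges between the two differences are induced by the union without being induced by `X`
or `Y`. Keeping this term exact later yields non-adjacency, not just criticality. -/
theorem slack_union_add_inter (hm : ∀ x y, m x y = m y x) (X Y : Finset α) :
    slack m (X ∪ Y) + slack m (X ∩ Y) =
      slack m X + slack m Y - between m (X \ Y) (Y \ X) := by
  have e1 : slack m X = slack m (X \ Y) + slack m (X ∩ Y) - between m (X \ Y) (X ∩ Y) := by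
    rw [← slack_union_of_disjoint hm (Finset.disjoint_sdiff_inter X Y), Finset.sdiff_union_inter]
  have e2 : slack m (X ∪ Y) = slack m (X \ Y) + slack m Y - between m (X \ Y) Y := by
    rw [← slack_union_of_disjoint hm Finset.sdiff_disjoint, Finset.sdiff_union_self_eq_union]
  have e3 : between m (X \ Y) Y = between m (X \ Y) (Y \ X) + between m (X \ Y) (X ∩ Y) := by
    rw [← between_union_right (Finset.inter_comm X Y ▸ Finset.disjoint_sdiff_inter Y X),
      Finset.inter_comm X Y, Finset.sdiff_union_inter]
  linarith

theorem sum_four_sub_deg (hm : ∀ x y, m x y = m y x) {V : Finset α} (h : X ⊆ V) :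
    ∑ v ∈ X, (4 - deg V m v) = 2 * slack m X - between m X (V \ X) := by
  have h1 := two_slack hm X
  have h2 : between m X V = between m X X + between m X (V \ X) := by
    rw [← between_union_right Finset.disjoint_sdiff, Finset.union_sdiff_of_subset h]
  have h3 : ∑ v ∈ X, deg V m v = between m X V + ∑ x ∈ X, (m x x : ℤ) := by
    simp only [deg, between_singleton_left, Finset.sum_add_distrib]
    rfl
  rw [Finset.sum_sub_distrib, h3]
  simp
  linarith

theorem mem_nbrs {V : Finset α} {v w : α} : w ∈ nbrs V m v ↔ w ∈ V ∧ m v w ≠ 0 := by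
  simp [nbrs]

theorem nbrs_subset {V : Finset α} {v : α} : nbrs V m v ⊆ V := Finset.filter_subset _ _

end basic

/-! ### Edge cuts, uncrossing and blocking sets in 3-connected circuits -/

/-- The properties of a `3`-connected `(2,1)`-circuit in `𝓜`, expressed by multiplicities. -/
structure IsThreeConnCircuit (V : Finset α) (m : α → α → ℕ) : Prop where
  symm : ∀ x y, m x y = m y x
  slack_eq_zero : slack m V = 0
  slack_pos : ∀ X ⊂ V, X.Nonempty → 1 ≤ slack m X
  four_le_card : 4 ≤ V.card
  conn : ∀ S ⊆ V, S.card ≤ 2 → ∀ A B : Finset α, A.Nonempty → B.Nonempty → Disjoint A B →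
    A ∪ B = V \ S → ∃ a ∈ A, ∃ b ∈ B, m a b ≠ 0
  node_loop : ∀ v ∈ V, deg V m v = 3 → m v v = 0
  node_multiple : ∀ v ∈ V, deg V m v = 3 → ∀ w, m v w ≤ 1
  loop_multiple : ∀ v ∈ V, m v v ≠ 0 → ∀ w, m v w ≤ 1

/-- `v` is a vertex of degree three. -/
def IsNode (V : Finset α) (m : α → α → ℕ) (v : α) : Prop := v ∈ V ∧ deg V m v = 3

/-- Every pair of non-adjacent neighbours of a node lies in a blocking set. -/
def NoAdmissible (V : Finset α) (m : α → α → ℕ) : Prop :=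
  ∀ v, IsNode V m v → ∀ x ∈ nbrs V m v, ∀ y ∈ nbrs V m v, x ≠ y → m x y = 0 →
    ∃ X ⊂ V.erase v, x ∈ X ∧ y ∈ X ∧ slack m X ≤ 1

/-- A node whose neighbours are pairwise adjacent. -/
def IsCliqueNode (V : Finset α) (m : α → α → ℕ) (v : α) : Prop :=
  IsNode V m v ∧ ∀ x ∈ nbrs V m v, ∀ y ∈ nbrs V m v, x ≠ y → m x y ≠ 0

/-- A node whose neighbours are pairwise non-adjacent. -/
def IsClawNode (V : Finset α) (m : α → α → ℕ) (v : α) : Prop :=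
  IsNode V m v ∧ ∀ x ∈ nbrs V m v, ∀ y ∈ nbrs V m v, x ≠ y → m x y = 0

namespace IsThreeConnCircuit
variable {V : Finset α} {m : α → α → ℕ} {X Y S : Finset α} {v w : α}

theorem between_sdiff (h : IsThreeConnCircuit V m) (hX : X ⊆ V) :
    between m X (V \ X) = slack m X + slack m (V \ X) := by
  have := slack_union_of_disjoint h.symm (Finset.disjoint_sdiff (s := X) (t := V))
  rw [Finset.union_sdiff_of_subset hX, h.slack_eq_zero] at this
  linarith

theorem eq_univ_of_slack (h : IsThreeConnCircuit V m) (hX : X ⊆ V) (hne : X.Nonempty)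
    (h0 : slack m X ≤ 0) : X = V := by
  by_contra hn
  linarith [h.slack_pos X (hX.ssubset_of_ne hn) hne]

theorem three_le_card_nbrs (h : IsThreeConnCircuit V m) (hv : v ∈ V) :
    3 ≤ ((nbrs V m v).erase v).card := by
  by_contra! hc
  have hsub : (nbrs V m v).erase v ⊆ V := (Finset.erase_subset _ _).trans nbrs_subset
  have hc' := Finset.card_sdiff_add_card_eq_card hsub
  have h4 := h.four_le_card
  have hvm : v ∈ V \ (nbrs V m v).erase v := by simp [hv]
  have hce := Finset.card_erase_of_mem hvm
  obtain ⟨a, ha, b, hb, hab⟩ := h.conn _ hsub (by omega) {v} ((V \ (nbrs V m v).erase v).erase v)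
    (by simp) (by rw [← Finset.card_pos]; omega) (by simp)
    (by rw [← Finset.insert_eq, Finset.insert_erase hvm])
  simp only [Finset.mem_singleton] at ha
  subst ha
  simp only [Finset.mem_erase, Finset.mem_sdiff, mem_nbrs] at hb
  tauto

theorem card_nbrs_le_between :
    (((nbrs V m v).erase v).card : ℤ) ≤ between m {v} (V \ {v}) := by
  rw [between_singleton_left, Finset.card_eq_sum_ones, Nat.cast_sum]
  refine (Finset.sum_le_sum fun x hx => ?_).trans (Finset.sum_le_sum_of_subset_of_nonneg
    (s := (nbrs V m v).erase v) ?_ fun _ _ _ => by positivity)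
  · have := (mem_nbrs.1 (Finset.mem_erase.1 hx).2).2
    norm_cast
    omega
  · intro x hx
    simp only [Finset.mem_erase, mem_nbrs] at hx
    simp [hx.1, hx.2.1]

/-- A single vertex has three neighbours. If both sides have at least two vertices, pick a cut edge
`ab`; deleting `a` leaves a cut edge `cd`, and deleting `a` and `d` leaves a third one. -/
theorem three_le_between (h : IsThreeConnCircuit V m) (hS : S ⊂ V) (hne : S.Nonempty) :
    3 ≤ between m S (V \ S) := by
  have single : ∀ v ∈ V, 3 ≤ between m {v} (V \ {v}) := fun v hv => by
    have h1 := h.three_le_card_nbrs hv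
    have h2 := card_nbrs_le_between (V := V) (m := m) (v := v)
    omega
  have hTne : (V \ S).Nonempty := Finset.sdiff_nonempty.2 hS.not_subset
  by_contra! hd
  by_cases hS1 : S.card = 1
  · obtain ⟨s, rfl⟩ := Finset.card_eq_one.1 hS1
    linarith [single s (hS.subset (by simp))]
  by_cases hT1 : (V \ S).card = 1
  · obtain ⟨t, ht⟩ := Finset.card_eq_one.1 hT1
    have htV : t ∈ V := Finset.sdiff_subset (ht ▸ Finset.mem_singleton_self t : t ∈ V \ S)
    have hSt : V \ {t} = S := by rw [← ht, Finset.sdiff_sdiff_eq_self hS.subset]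
    have := single t htV
    rw [hSt, between_comm h.symm, ← ht] at this
    linarith
  have hSp := hne.card_pos
  have hTp := hTne.card_pos
  obtain ⟨a, ha, b, hb, hab⟩ := h.conn ∅ (by simp) (by simp) S (V \ S) hne hTne
    Finset.disjoint_sdiff (by rw [Finset.union_sdiff_of_subset hS.subset, Finset.sdiff_empty])
  have e1 : between m S (V \ S) = between m {a} (V \ S) + between m (S.erase a) (V \ S) := by
    rw [← between_insert_left (by simp), Finset.insert_erase ha]
  have l1 := le_between (m := m) (Finset.mem_singleton_self a) hb
  have hSa : (S.erase a).Nonempty := by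
    rw [← Finset.card_pos, Finset.card_erase_of_mem ha]; omega
  obtain ⟨c, hc, d, hd', hcd⟩ := h.conn {a} (by simpa using hS.subset ha) (by simp) (S.erase a)
    (V \ S) hSa hTne (Finset.disjoint_sdiff.mono_left (Finset.erase_subset _ _)) (by
      have := hS.subset
      grind)
  have e2 : between m (S.erase a) (V \ S) =
      between m (S.erase a) {d} + between m (S.erase a) ((V \ S).erase d) := by
    rw [← between_insert_right (by simp), Finset.insert_erase hd']
  have l2 := le_between (m := m) hc (Finset.mem_singleton_self d)
  have hTd : ((V \ S).erase d).Nonempty := by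
    rw [← Finset.card_pos, Finset.card_erase_of_mem hd']; omega
  obtain ⟨p, hp, q, hq, hpq⟩ := h.conn {a, d} (by have := hS.subset; grind)
    (Finset.card_le_two) (S.erase a) ((V \ S).erase d) hSa hTd
    (Finset.disjoint_sdiff.mono (Finset.erase_subset _ _) (Finset.erase_subset _ _)) (by
      have := hS.subset
      grind)
  have l3 := le_between (m := m) hp hq
  omega

/-- Uncrossing of critical sets with non-empty intersection and proper union. -/
theorem uncross (h : IsThreeConnCircuit V m) (hX : X ⊆ V) (hY : Y ⊆ V) (hi : (X ∩ Y).Nonempty)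
    (hu : X ∪ Y ≠ V) (h1 : slack m X ≤ 1) (h2 : slack m Y ≤ 1) :
    slack m (X ∪ Y) = 1 ∧ slack m (X ∩ Y) = 1 ∧ ∀ x ∈ X \ Y, ∀ y ∈ Y \ X, m x y = 0 := by
  have hs := slack_union_add_inter h.symm X Y
  have hb := between_nonneg (m := m) (X \ Y) (Y \ X)
  have hu' : X ∪ Y ⊂ V := (Finset.union_subset hX hY).ssubset_of_ne hu
  have p1 := h.slack_pos _ hu' (hi.mono (Finset.inter_subset_left.trans Finset.subset_union_left))
  have p2 := h.slack_pos _
    ((Finset.inter_subset_left.trans Finset.subset_union_left).trans_ssubset hu') hi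
  exact ⟨by linarith, by linarith, fun x hx y hy => eq_zero_of_between (by linarith) hx hy⟩

theorem node_nbrs (h : IsThreeConnCircuit V m) (hv : IsNode V m v) :
    (nbrs V m v).card = 3 ∧ v ∉ nbrs V m v ∧
      ∀ S ⊆ V, between m {v} S = (S ∩ nbrs V m v).card := by
  have h1 : ∀ S ⊆ V, between m {v} S = (S ∩ nbrs V m v).card := by
    intro S hS
    rw [between_singleton_left, Finset.card_eq_sum_ones, Nat.cast_sum, ← Finset.sum_subset
      (Finset.inter_subset_left : S ∩ nbrs V m v ⊆ S)]
    · refine Finset.sum_congr rfl fun x hx => ?_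
      have := h.node_multiple v hv.1 hv.2 x
      have := (mem_nbrs.1 (Finset.mem_inter.1 hx).2).2
      norm_cast
      omega
    · intro x hx hn
      simp only [Finset.mem_inter, mem_nbrs, not_and, not_not] at hn
      exact_mod_cast hn hx (hS hx)
  refine ⟨?_, fun hn => (mem_nbrs.1 hn).2 (h.node_loop v hv.1 hv.2), h1⟩
  have h2 := h1 V subset_rfl
  have h3 := hv.2
  rw [deg, h.node_loop v hv.1 hv.2, h2, Finset.inter_eq_right.2 (nbrs_subset)] at h3
  have h4 : ((nbrs V m v).card : ℤ) = 3 := by simpa using h3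
  exact_mod_cast h4

theorem slack_insert_node (h : IsThreeConnCircuit V m) (hv : IsNode V m v) (hX : X ⊆ V)
    (hvX : v ∉ X) : slack m (insert v X) = slack m X + 2 - (X ∩ nbrs V m v).card := by
  rw [slack_insert h.symm hvX, h.node_loop v hv.1 hv.2, (h.node_nbrs hv).2.2 X hX]
  simp

/-- Adding a node together with its three edges lowers the slack by one, so from a critical set it
reaches slack 0, which only `V` has. -/
theorem insert_eq_univ (h : IsThreeConnCircuit V m) (hv : IsNode V m v) (hX : X ⊆ V)
    (hvX : v ∉ X) (hN : nbrs V m v ⊆ X) (h1 : slack m X ≤ 1) : insert v X = V := by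
  have := h.slack_insert_node hv hX hvX
  rw [Finset.inter_eq_right.2 hN, (h.node_nbrs hv).1] at this
  exact h.eq_univ_of_slack (Finset.insert_subset hv.1 hX) (by simp) (by push_cast at this; linarith)

theorem mem_nbrs_comm (h : IsThreeConnCircuit V m) (hv : v ∈ V) (hw : w ∈ nbrs V m v) :
    v ∈ nbrs V m w := by
  rw [mem_nbrs] at *
  exact ⟨hv, h.symm v w ▸ hw.2⟩

/-- The blocking set of a non-adjacent pair of neighbours of a node. -/
theorem exists_blocker (h : IsThreeConnCircuit V m) (hna : NoAdmissible V m) (hv : IsNode V m v)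
    {x y z : α} (hN : nbrs V m v = {x, y, z}) (hxy : x ≠ y) (h0 : m x y = 0) :
    ∃ X ⊆ V, v ∉ X ∧ x ∈ X ∧ y ∈ X ∧ z ∉ X ∧ slack m X = 1 := by
  obtain ⟨X, hX, hx, hy, hs⟩ := hna v hv x (by simp [hN]) y (by simp [hN]) hxy h0
  have hXV : X ⊆ V := hX.subset.trans (Finset.erase_subset _ _)
  have hvX : v ∉ X := fun hh => by simpa using hX.subset hh
  refine ⟨X, hXV, hvX, hx, hy, fun hz => ?_, ?_⟩
  · have := h.insert_eq_univ hv hXV hvX (by rw [hN]; grind) hs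
    exact hX.ne (by rw [← this, Finset.erase_insert hvX])
  · have := h.slack_pos X (hX.trans_subset (Finset.erase_subset _ _)) ⟨x, hx⟩
    linarith

end IsThreeConnCircuit

/-! ### Clique nodes and claw nodes -/

theorem deg_eq {V : Finset α} {m : α → α → ℕ} {v : α} (hv : v ∈ V) :
    deg V m v = 2 * m v v + between m {v} (V \ {v}) := by
  have : between m {v} V = between m {v} {v} + between m {v} (V \ {v}) := by
    rw [← between_union_right Finset.disjoint_sdiff, Finset.union_sdiff_of_subset (by simpa)]
  rw [deg, this, between_singleton]
  ring

theorem slack_quad {m : α → α → ℕ} (hm : ∀ x y, m x y = m y x) {a b c d : α} (hab : a ≠ b)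
    (hac : a ≠ c) (had : a ≠ d) (hbc : b ≠ c) (hbd : b ≠ d) (hcd : c ≠ d) :
    slack m {a, b, c, d} = 8 - (m a a + m b b + m c c + m d d + m a b + m a c + m a d + m b c
      + m b d + m c d) := by
  rw [slack_insert hm (by simp [*]), slack_insert hm (by simp [*]), slack_insert hm (by simp [*]),
    slack_singleton hm]
  simp [between, *]
  ring

namespace IsThreeConnCircuit
variable {V : Finset α} {m : α → α → ℕ} {X Y S : Finset α} {v w : α}

theorem three_le_deg (h : IsThreeConnCircuit V m) (hv : v ∈ V) : 3 ≤ deg V m v := by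
  have h4 := h.four_le_card
  have := h.three_le_between (S := {v}) ⟨by simpa, fun hh => by
    have := Finset.card_le_card hh; simp at this; omega⟩ (by simp)
  rw [deg_eq hv]
  omega

/-- The cut around `v` has `slack {v} + slack (V \ {v})` edges, at most `3 - m v v`, and at least
three; so `v` has no loop and degree three. -/
theorem isNode_of_slack_sdiff (h : IsThreeConnCircuit V m) (hv : v ∈ V)
    (h1 : slack m (V \ {v}) ≤ 1) : IsNode V m v := by
  refine ⟨hv, ?_⟩
  have h4 := h.four_le_card
  have h3 := h.three_le_between (S := {v}) ⟨by simpa, fun hh => by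
    have := Finset.card_le_card hh; simp at this; omega⟩ (by simp)
  have h2 := h.between_sdiff (X := {v}) (by simpa)
  rw [slack_singleton h.symm] at h2
  rw [deg_eq hv]
  omega

/-- The pair has slack at least 3, so `4 - deg` sums to at least 2 over it, which only two nodes
achieve. The sum is then exactly 2, so the pair has slack at most 3 rather than 4, and the nodes are
adjacent. -/
theorem isNode_pair (h : IsThreeConnCircuit V m) (hv : v ∈ V) (hw : w ∈ V) (hvw : v ≠ w)
    (h1 : slack m (V \ {v, w}) ≤ 1) (h4 : 4 ≤ between m {v, w} (V \ {v, w})) :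
    IsNode V m v ∧ IsNode V m w ∧ m v w ≠ 0 := by
  have hsub : ({v, w} : Finset α) ⊆ V := by grind
  have h2 := h.between_sdiff hsub
  have h3 := sum_four_sub_deg h.symm hsub
  have h5 : slack m {v, w} = 4 - m v v - m w w - m v w := by
    rw [slack_insert h.symm (by simpa), slack_singleton h.symm, between_singleton]
    ring
  rw [Finset.sum_pair hvw] at h3
  have h6 := h.three_le_deg hv
  have h7 := h.three_le_deg hw
  have nv : IsNode V m v := ⟨hv, by omega⟩
  have nw : IsNode V m w := ⟨hw, by omega⟩
  have := h.node_loop v hv nv.2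
  have := h.node_loop w hw nw.2
  exact ⟨nv, nw, by omega⟩

/-- Otherwise `{x, y}` separates `v` and `w` from the remaining vertices, which exist because `|V| ≥
5`. -/
theorem not_twins (h : IsThreeConnCircuit V m) (h5 : 5 ≤ V.card) {x y : α} (hv : v ∈ V)
    (hw : w ∈ V) (hx : x ∈ V) (hy : y ∈ V) (hvx : v ≠ x) (hvy : v ≠ y) (hwx : w ≠ x) (hwy : w ≠ y)
    (hNv : nbrs V m v ⊆ {v, w, x, y}) (hNw : nbrs V m w ⊆ {v, w, x, y}) : False := by
  have hne : (V \ {v, w, x, y}).Nonempty := by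
    rw [← Finset.card_pos]
    have := Finset.le_card_sdiff {v, w, x, y} V
    have := Finset.card_le_four (a := v) (b := w) (c := x) (d := y)
    omega
  obtain ⟨a, ha, b, hb, hab⟩ := h.conn {x, y} (by grind) Finset.card_le_two {v, w}
    (V \ {v, w, x, y}) (by simp) hne (by
      rw [Finset.disjoint_left]; grind) (by grind)
  have hbN : b ∈ nbrs V m a := mem_nbrs.2 ⟨(Finset.mem_sdiff.1 hb).1, hab⟩
  grind

theorem exists_nbrs_eq (h : IsThreeConnCircuit V m) (hv : IsNode V m v) :
    ∃ x y z, x ≠ y ∧ x ≠ z ∧ y ≠ z ∧ v ≠ x ∧ v ≠ y ∧ v ≠ z ∧ nbrs V m v = {x, y, z} := by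
  obtain ⟨hc, hn, -⟩ := h.node_nbrs hv
  obtain ⟨x, y, z, hxy, hxz, hyz, hN⟩ := Finset.card_eq_three.1 hc
  rw [hN] at hn
  simp only [Finset.mem_insert, Finset.mem_singleton, not_or] at hn
  exact ⟨x, y, z, hxy, hxz, hyz, hn.1, hn.2.1, hn.2.2, hN⟩

/-- If `qr` is a non-edge too, the blocking sets of `pq` and `qr` meet in `q` and their union misses
`v`, so uncrossing forbids the edge `pr`. If `qr` is an edge, adding `r` to the blocking set of `pq`
keeps it critical, and `v` and `r` become twins over `{p, q}`. -/
theorem not_mixed (h : IsThreeConnCircuit V m) (hna : NoAdmissible V m) (h5 : 5 ≤ V.card)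
    (hv : IsNode V m v) {p q r : α} (hN : nbrs V m v = {p, q, r}) (hpq : p ≠ q) (hpr : p ≠ r)
    (hqr : q ≠ r) (h0 : m p q = 0) (h1 : m p r ≠ 0) : False := by
  have hp : p ∈ nbrs V m v := by simp [hN]
  have hq : q ∈ nbrs V m v := by simp [hN]
  have hr : r ∈ nbrs V m v := by simp [hN]
  have hvN := (h.node_nbrs hv).2.1
  obtain ⟨X, hX, hvX, hpX, hqX, hrX, hs⟩ := h.exists_blocker hna hv hN hpq h0
  by_cases h2 : m q r = 0
  · obtain ⟨Y, hY, hvY, hqY, hrY, hpY, hs'⟩ := h.exists_blocker hna hv (x := q) (y := r) (z := p)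
      (by rw [hN]; grind) hqr h2
    have hvu : v ∉ X ∪ Y := by simp [*]
    have := (h.uncross hX hY ⟨q, by simp [*]⟩ (fun hu => hvu (hu ▸ hv.1)) hs.le hs'.le).2.2 p (by simp [*]) r (by simp [*])
    exact h1 this
  · have hrV := nbrs_subset hr
    have h3 : ∀ w ∈ X, w ≠ p → w ≠ q →
        (m r p : ℤ) + m r q + m r w ≤ between m {r} X := fun w hw hwp hwq => by
      have := between_mono (m := m) (subset_refl {r}) (show {p, q, w} ⊆ X by grind)
      rw [between_insert_right (by grind), between_insert_right (by grind)] at this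
      simp only [between_singleton] at this
      linarith
    have h3' : (m r p : ℤ) + m r q ≤ between m {r} X := by
      have := between_mono (m := m) (subset_refl {r}) (show {p, q} ⊆ X by grind)
      rw [between_insert_right (by grind)] at this
      simpa only [between_singleton] using this
    have h4 := slack_insert h.symm hrX
    rw [h.symm p r] at h1
    rw [h.symm q r] at h2
    have hsub : insert r X ⊆ V := Finset.insert_subset hrV hX
    have hvr : v ∉ insert r X := by
      rw [Finset.mem_insert]
      rintro (rfl | hh)
      exacts [hvN hr, hvX hh]
    have h6 := h.insert_eq_univ hv hsub hvr (by rw [hN]; grind) (by omega)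
    have h7 := h.slack_pos (insert r X) ⟨hsub, fun hh => hvr (hh hv.1)⟩ (by simp)
    -- A third neighbour of `r` in `X` would bring the slack of `insert r X` down to 0, although
    -- this set misses `v`.
    refine h.not_twins h5 hv.1 hrV (nbrs_subset hp) (nbrs_subset hq) (x := p) (y := q)
      (by grind) (by grind) hpr.symm hqr.symm (by rw [hN]; grind) fun w hw => ?_
    rw [mem_nbrs, ← h6] at hw
    by_contra hw'
    simp only [Finset.mem_insert, Finset.mem_singleton, not_or] at hw hw'
    have := h3 w (by tauto) (by tauto) (by tauto)
    omega

theorem clique_or_claw (h : IsThreeConnCircuit V m) (hna : NoAdmissible V m) (h5 : 5 ≤ V.card)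
    (hv : IsNode V m v) : IsCliqueNode V m v ∨ IsClawNode V m v := by
  by_contra! hcon
  obtain ⟨x, y, z, hxy, hxz, hyz, -, -, -, hN⟩ := h.exists_nbrs_eq hv
  have key : ∀ p q r, p ≠ q → p ≠ r → q ≠ r → ({p, q, r} : Finset α) = {x, y, z} →
      m p q = 0 → m p r = 0 := fun p q r hpq hpr hqr he h0 => by
    by_contra h1
    exact h.not_mixed hna h5 hv (hN.trans he.symm) hpq hpr hqr h0 h1
  have k1 := key x y z hxy hxz hyz rfl
  have k2 := key x z y hxz hxy hyz.symm (by grind)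
  have k3 := key y x z hxy.symm hyz hxz (by grind)
  have k4 := key y z x hyz hxy.symm hxz.symm (by grind)
  have s1 := h.symm x y
  have s2 := h.symm x z
  have s3 := h.symm y z
  apply hcon.2
  refine ⟨hv, ?_⟩
  have hnc : m x y = 0 ∨ m x z = 0 ∨ m y z = 0 := by
    by_contra! hh
    exact hcon.1 ⟨hv, by rw [hN]; grind⟩
  rw [hN]
  grind

/-- Clique nodes are pairwise non-adjacent. -/
theorem clique_not_adj (h : IsThreeConnCircuit V m) (h5 : 5 ≤ V.card) (hv : IsCliqueNode V m v)
    (hw : IsCliqueNode V m w) : m v w = 0 := by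
  by_contra h0
  obtain ⟨x, y, z, hxy, hxz, hyz, hvx, hvy, hvz, hN⟩ := h.exists_nbrs_eq hv.1
  have key : ∀ p q r, p ≠ q → p ≠ r → q ≠ r → ({p, q, r} : Finset α) = {x, y, z} → w = p →
      False := by
    rintro p q r hpq hpr hqr he rfl
    have hN' := hN.trans he.symm
    have hq : q ∈ nbrs V m v := by simp [hN']
    have hr : r ∈ nbrs V m v := by simp [hN']
    have hw' : w ∈ nbrs V m v := by simp [hN']
    have hvN := (h.node_nbrs hv.1).2.1
    refine h.not_twins h5 hv.1.1 (nbrs_subset hw') (nbrs_subset hq) (nbrs_subset hr) (by grind)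
      (by grind) hpq hpr (by rw [hN']; grind) ?_
    have hsub : {v, q, r} ⊆ nbrs V m w := by
      simp only [Finset.insert_subset_iff, Finset.singleton_subset_iff]
      exact ⟨h.mem_nbrs_comm hv.1.1 hw', mem_nbrs.2 ⟨nbrs_subset hq, hv.2 w hw' q hq hpq⟩,
        mem_nbrs.2 ⟨nbrs_subset hr, hv.2 w hw' r hr hpr⟩⟩
    rw [← Finset.eq_of_subset_of_card_le hsub (by
      rw [(h.node_nbrs hw.1).1, Finset.card_eq_three.2 ⟨v, q, r, by grind, by grind, hqr, rfl⟩])]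
    grind
  have hwN : w ∈ nbrs V m v := mem_nbrs.2 ⟨hw.1.1, h0⟩
  rw [hN] at hwN
  simp only [Finset.mem_insert, Finset.mem_singleton] at hwN
  rcases hwN with hh | hh | hh
  · exact key x y z hxy hxz hyz rfl hh
  · exact key y x z hxy.symm hyz hxz (by grind) hh
  · exact key z x y hxz.symm hyz.symm hxy (by grind) hh

/-- A node adjacent to a claw node is a claw node. -/
theorem claw_of_adj (h : IsThreeConnCircuit V m) (hna : NoAdmissible V m) (h5 : 5 ≤ V.card)
    (hv : IsClawNode V m v) (hw : IsNode V m w) (hwN : w ∈ nbrs V m v) : IsClawNode V m w := by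
  refine (h.clique_or_claw hna h5 hw).resolve_left fun hc => ?_
  have hvw := h.mem_nbrs_comm hv.1.1 hwN
  obtain ⟨u, hu, huv⟩ := Finset.exists_mem_ne (s := nbrs V m w) (by
    rw [(h.node_nbrs hw).1]; norm_num) v
  have h1 := hc.2 v hvw u hu huv.symm
  have hwu : w ≠ u := fun he => (h.node_nbrs hw).2.1 (he ▸ hu)
  exact (mem_nbrs.1 hu).2 (hv.2 w hwN u (mem_nbrs.2 ⟨nbrs_subset hu, h1⟩) hwu)

theorem exists_claw_blocker (h : IsThreeConnCircuit V m) (hna : NoAdmissible V m)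
    (hv : IsClawNode V m v) {x : α} (hx : x ∈ nbrs V m v) :
    ∃ P ⊆ V, v ∉ P ∧ x ∉ P ∧ (nbrs V m v).erase x ⊆ P ∧ slack m P = 1 := by
  have hc : ((nbrs V m v).erase x).card = 2 := by
    rw [Finset.card_erase_of_mem hx, (h.node_nbrs hv.1).1]
  obtain ⟨y, z, hyz, he⟩ := Finset.card_eq_two.1 hc
  have hy : y ∈ (nbrs V m v).erase x := by simp [he]
  have hz : z ∈ (nbrs V m v).erase x := by simp [he]
  obtain ⟨P, hP, h1, h2, h3, h4, h5⟩ := h.exists_blocker hna hv.1 (x := y) (y := z) (z := x)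
    (by rw [← Finset.insert_erase hx, he]; grind) hyz
    (hv.2 y (Finset.mem_of_mem_erase hy) z (Finset.mem_of_mem_erase hz) hyz)
  exact ⟨P, hP, h1, h4, by rw [he]; grind, h5⟩

/-- Both sets contain the third neighbour and neither contains `v`, so their union is critical. It
contains all neighbours of `v`, hence misses nothing else. -/
theorem claw_blocker_union (h : IsThreeConnCircuit V m) (hv : IsNode V m v) {x y : α}
    {P Q : Finset α} (hx : x ∈ nbrs V m v) (hy : y ∈ nbrs V m v) (hxy : x ≠ y) (hP : P ⊆ V)
    (hQ : Q ⊆ V) (hvP : v ∉ P) (hvQ : v ∉ Q) (hNP : (nbrs V m v).erase x ⊆ P)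
    (hNQ : (nbrs V m v).erase y ⊆ Q) (hsP : slack m P ≤ 1) (hsQ : slack m Q ≤ 1) :
    insert v (P ∪ Q) = V := by
  have hvu : v ∉ P ∪ Q := by simp [*]
  obtain ⟨z, hz⟩ : (((nbrs V m v).erase x).erase y).Nonempty := by
    rw [← Finset.card_pos, Finset.card_erase_of_mem (by simp [hy, hxy.symm]),
      Finset.card_erase_of_mem hx, (h.node_nbrs hv).1]
    norm_num
  have hu := (h.uncross hP hQ ⟨z, by grind⟩ (fun he => hvu (he ▸ hv.1)) hsP hsQ).1
  exact h.insert_eq_univ hv (Finset.union_subset hP hQ) hvu (fun w hw => by grind) hu.le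

theorem slack_insert_claw_blocker (h : IsThreeConnCircuit V m) (hv : IsNode V m v) {x : α}
    {P : Finset α} (hx : x ∈ nbrs V m v) (hP : P ⊆ V) (hvP : v ∉ P) (hxP : x ∉ P)
    (hNP : (nbrs V m v).erase x ⊆ P) (hsP : slack m P = 1) : slack m (insert v P) = 1 := by
  have h1 : P ∩ nbrs V m v = (nbrs V m v).erase x := by grind
  rw [h.slack_insert_node hv hP hvP, h1, Finset.card_erase_of_mem hx, (h.node_nbrs hv).1, hsP]
  norm_num

/-- The nodes induce a forest. For a set `S` of nodes, summing `4 - deg` gives `|S| = slack S -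
slack (V \ S)`. If every vertex had two neighbours in `S`, then `slack S ≤ |S|`, so `V \ S` would
have slack at most 0 and be empty; but then `|S| = 0`. -/
theorem exists_leaf (h : IsThreeConnCircuit V m) (hS : ∀ v ∈ S, IsNode V m v)
    (hne : S.Nonempty) : ∃ v ∈ S, (S ∩ nbrs V m v).card ≤ 1 := by
  by_contra! hcon
  have hSV : S ⊆ V := fun v hv => (hS v hv).1
  have h1 : between m S S = ∑ v ∈ S, ((S ∩ nbrs V m v).card : ℤ) :=
    Finset.sum_congr rfl fun v hv => by
      rw [← between_singleton_left, (h.node_nbrs (hS v hv)).2.2 S hSV]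
  have h2 : 2 * (S.card : ℤ) ≤ between m S S := by
    rw [h1]
    have := Finset.card_nsmul_le_sum S (fun v => ((S ∩ nbrs V m v).card : ℤ)) 2
      (fun v hv => by exact_mod_cast hcon v hv)
    simp at this
    linarith
  have h3 := two_slack h.symm S
  rw [Finset.sum_eq_zero fun v hv => by
    rw [h.node_loop v (hSV hv) (hS v hv).2, Nat.cast_zero]] at h3
  have h4 := sum_four_sub_deg h.symm hSV
  rw [Finset.sum_congr rfl fun v hv => by rw [(hS v hv).2]] at h4
  have h5 := h.between_sdiff hSV
  simp at h4
  have h6 := hne.card_pos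
  rcases (V \ S).eq_empty_or_nonempty with he | hT
  · have h0 : slack m S = 0 := by
      rw [hSV.antisymm (Finset.sdiff_eq_empty_iff_subset.1 he), h.slack_eq_zero]
    rw [he, h0, between_empty_right] at h4
    omega
  · have := h.slack_pos (V \ S) (by
      refine ⟨Finset.sdiff_subset, fun hh => ?_⟩
      obtain ⟨s, hs⟩ := hne
      have := hh (hSV hs)
      simp [hs] at this) hT
    omega

end IsThreeConnCircuit

/-! ### Slack of closed neighbourhoods of clique nodes -/

/-- The closed neighbourhood of `v`. -/
def closedNbrs (V : Finset α) (m : α → α → ℕ) (v : α) : Finset α := insert v (nbrs V m v)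

/-- For complete graphs on 1, 2, 3, 4 vertices this gives slack 2, 3, 3, 2; these four values are
used throughout. -/
theorem two_slack_of_simple {m : α → α → ℕ} (hm : ∀ x y, m x y = m y x) {S : Finset α}
    (hS : ∀ a ∈ S, ∀ b ∈ S, m a b = if a = b then 0 else 1) :
    2 * slack m S = 5 * S.card - S.card * S.card := by
  rw [two_slack hm]
  have h1 : between m S S = ∑ a ∈ S, ((S.card : ℤ) - 1) := by
    refine Finset.sum_congr rfl fun a ha => ?_
    rw [Finset.sum_congr rfl fun b hb => by rw [hS a ha b hb], ← Finset.add_sum_erase _ _ ha,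
      Finset.sum_congr rfl (g := fun _ => (1 : ℤ)) (s₂ := S.erase a) fun b hb => by
        simp [(Finset.ne_of_mem_erase hb).symm]]
    simp [Finset.card_erase_of_mem ha, Nat.cast_sub (Finset.card_pos.2 ⟨a, ha⟩ : 1 ≤ S.card)]
  rw [h1, Finset.sum_eq_zero (s := S) (f := fun x => (m x x : ℤ)) fun a ha => by simp [hS a ha a ha]]
  simp
  ring

namespace IsThreeConnCircuit
variable {V : Finset α} {m : α → α → ℕ} {X Y S : Finset α} {v w : α}

theorem closedNbrs_subset (hv : v ∈ V) : closedNbrs V m v ⊆ V :=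
  Finset.insert_subset hv nbrs_subset

theorem card_closedNbrs (h : IsThreeConnCircuit V m) (hv : IsNode V m v) :
    (closedNbrs V m v).card = 4 := by
  obtain ⟨h1, h2, -⟩ := h.node_nbrs hv
  rw [closedNbrs, Finset.card_insert_of_notMem h2, h1]

theorem card_nbrs_le_deg (hv : v ∈ V) : (((nbrs V m v).erase v).card : ℤ) ≤ deg V m v := by
  rw [deg_eq hv]
  have := card_nbrs_le_between (V := V) (m := m) (v := v)
  omega

theorem closedNbrs_adj (h : IsThreeConnCircuit V m) (hv : IsCliqueNode V m v) {a b : α}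
    (ha : a ∈ closedNbrs V m v) (hb : b ∈ closedNbrs V m v) (hab : a ≠ b) : m a b ≠ 0 := by
  rw [closedNbrs, Finset.mem_insert] at ha hb
  rcases ha with rfl | ha <;> rcases hb with rfl | hb
  · exact absurd rfl hab
  · exact (mem_nbrs.1 hb).2
  · rw [h.symm]; exact (mem_nbrs.1 ha).2
  · exact hv.2 a ha b hb hab

/-- Four vertices and at least the six edges of `K₄`; slack 2 leaves no room for a loop or a
parallel edge. -/
theorem slack_closedNbrs (h : IsThreeConnCircuit V m) (hv : IsCliqueNode V m v) :
    slack m (closedNbrs V m v) ≤ 2 ∧ (2 ≤ slack m (closedNbrs V m v) →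
      ∀ a ∈ closedNbrs V m v, ∀ b ∈ closedNbrs V m v, m a b = if a = b then 0 else 1) := by
  have hadj := fun a ha b hb => h.closedNbrs_adj hv (a := a) (b := b) ha hb
  obtain ⟨x, y, z, hxy, hxz, hyz, hvx, hvy, hvz, hN⟩ := h.exists_nbrs_eq hv.1
  rw [closedNbrs, hN] at hadj ⊢
  have hs := slack_quad h.symm hvx hvy hvz hxy hxz hyz
  have h1 := hadj v (by simp) x (by simp) hvx
  have h2 := hadj v (by simp) y (by simp) hvy
  have h3 := hadj v (by simp) z (by simp) hvz
  have h4 := hadj x (by simp) y (by simp) hxy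
  have h5 := hadj x (by simp) z (by simp) hxz
  have h6 := hadj y (by simp) z (by simp) hyz
  refine ⟨by omega, fun hge => ?_⟩
  have s1 := h.symm v x
  have s2 := h.symm v y
  have s3 := h.symm v z
  have s4 := h.symm x y
  have s5 := h.symm x z
  have s6 := h.symm y z
  simp only [Finset.mem_insert, Finset.mem_singleton, forall_eq_or_imp, forall_eq, if_true, hvx,
    hvy, hvz, hxy, hxz, hyz, hvx.symm, hvy.symm, hvz.symm, hxy.symm, hxz.symm, hyz.symm, if_false]
  omega

/-- A subset of the closed neighbourhood of a clique node has at least the same slack. -/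
theorem slack_closedNbrs_le (h : IsThreeConnCircuit V m) (h5 : 5 ≤ V.card)
    (hv : IsCliqueNode V m v) (hS : S ⊆ closedNbrs V m v) (hne : S.Nonempty) :
    slack m (closedNbrs V m v) ≤ slack m S ∧ (slack m S = 2 → 2 ≤ slack m (closedNbrs V m v) →
      S.card = 1 ∨ S = closedNbrs V m v) := by
  have hc := h.card_closedNbrs hv.1
  have hcs := Finset.card_le_card hS
  obtain ⟨h1, h2⟩ := h.slack_closedNbrs hv
  by_cases hge : 2 ≤ slack m (closedNbrs V m v)
  · have h3 := two_slack_of_simple h.symm fun a ha b hb => h2 hge a (hS ha) b (hS hb)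
    have hp := hne.card_pos
    have h4 : S.card = 4 → S = closedNbrs V m v := fun h4 =>
      Finset.eq_of_subset_of_card_le hS (by omega)
    generalize S.card = n at *
    have : n ≤ 4 := by omega
    interval_cases n <;> simp at h3 ⊢ <;> first | omega | exact ⟨by omega, fun _ _ => h4 rfl⟩
  -- Here the closed neighbourhood has slack at most 1, and positivity of the slack on proper
  -- subsets suffices.
  · have := h.slack_pos S (hS.trans_ssubset ⟨closedNbrs_subset hv.1.1, fun hh => by
      have := Finset.card_le_card hh; omega⟩) hne
    exact ⟨by omega, fun _ hh => absurd hh hge⟩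

theorem sum_four_sub_deg_sdiff (h : IsThreeConnCircuit V m) (hX : X ⊆ V) :
    ∑ u ∈ V \ X, (4 - deg V m u) = slack m (V \ X) - slack m X := by
  have h1 := h.between_sdiff hX
  have h2 := sum_four_sub_deg h.symm (Finset.sdiff_subset (s := V) (t := X))
  rw [Finset.sdiff_sdiff_eq_self hX, between_comm h.symm, h1] at h2
  linarith

theorem deg_of_sum_pos (h : IsThreeConnCircuit V m) (hS : S ⊆ V)
    (hs : 0 < ∑ u ∈ S, (4 - deg V m u)) : ∃ u ∈ S, IsNode V m u := by
  obtain ⟨u, hu, hlt⟩ := Finset.exists_lt_of_sum_lt (s := S) (f := fun _ => (0 : ℤ))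
    (g := fun u => 4 - deg V m u) (by rwa [Finset.sum_const_zero])
  have := h.three_le_deg (hS hu)
  exact ⟨u, hu, hS hu, by omega⟩

end IsThreeConnCircuit

/-! ### Anchors, and why no claw node lies outside a largest one -/

/-- A critical set `X` that misses at least two vertices, not all of them claw nodes. -/
def IsAnchor (V : Finset α) (m : α → α → ℕ) (X : Finset α) : Prop :=
  X ⊆ V ∧ X.Nonempty ∧ slack m X ≤ 1 ∧ X.card + 2 ≤ V.card ∧
    ∃ u ∈ V, u ∉ X ∧ ¬ IsClawNode V m u

namespace IsThreeConnCircuit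
variable {V : Finset α} {m : α → α → ℕ} {X Y S : Finset α} {v w : α}

/-- Without claw nodes the given set works. Otherwise a leaf `v` of the forest of claw nodes has a
neighbour `x` that is not a claw node, and the blocking set avoiding `x`, enlarged by `v`, is
critical. It misses more than `x`: otherwise `x` would be a node adjacent to a claw node, hence a
claw node. -/
theorem exists_anchor (h : IsThreeConnCircuit V m) (hna : NoAdmissible V m) (h5 : 5 ≤ V.card)
    (hX : X ⊆ V) (hXne : X.Nonempty) (hs : slack m X ≤ 1) (hc : X.card + 2 ≤ V.card) :
    ∃ Z, IsAnchor V m Z := by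
  classical
  by_cases hT : ∃ v, IsClawNode V m v
  · obtain ⟨v₀, hv₀⟩ := hT
    obtain ⟨v, hv, hleaf⟩ := h.exists_leaf (S := V.filter (IsClawNode V m))
      (fun v hv => (Finset.mem_filter.1 hv).2.1) ⟨v₀, by simp [hv₀, hv₀.1.1]⟩
    have hv := (Finset.mem_filter.1 hv).2
    obtain ⟨x, hx, hxT⟩ : ∃ x ∈ nbrs V m v, ¬ IsClawNode V m x := by
      by_contra! hh
      rw [Finset.inter_eq_right.2 fun x hx => by simp [hh x hx, nbrs_subset hx],
        (h.node_nbrs hv.1).1] at hleaf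
      omega
    obtain ⟨P, hP, hvP, hxP, hNP, hsP⟩ := h.exists_claw_blocker hna hv hx
    have hs' := h.slack_insert_claw_blocker hv.1 hx hP hvP hxP hNP hsP
    have hxv : x ≠ v := fun he => (h.node_nbrs hv.1).2.1 (he ▸ hx)
    have hsub : insert v P ⊆ V.erase x := by
      have := hv.1.1
      have := nbrs_subset hx
      grind
    have hcx := Finset.card_erase_of_mem (nbrs_subset hx)
    refine ⟨insert v P, hsub.trans (Finset.erase_subset _ _), by simp, hs'.le, ?_, x,
      nbrs_subset hx, by simp [hxv, hxP], hxT⟩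
    by_contra hlt
    have he := Finset.eq_of_subset_of_card_le hsub (by omega)
    refine hxT (h.claw_of_adj hna h5 hv (h.isNode_of_slack_sdiff (nbrs_subset hx) ?_) hx)
    rw [Finset.sdiff_singleton_eq_erase, ← he, hs']
  · obtain ⟨u, hu, huX⟩ : ∃ u ∈ V, u ∉ X := by
      by_contra! hh
      have := Finset.card_le_card hh
      omega
    exact ⟨X, hX, hXne, hs, hc, u, hu, huX, fun hh => hT ⟨u, hh⟩⟩

theorem exists_max_anchor (hX : IsAnchor V m X) :
    ∃ Z, IsAnchor V m Z ∧ ∀ Z', IsAnchor V m Z' → Z'.card ≤ Z.card := by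
  classical
  obtain ⟨Z, hZ, hmax⟩ := Finset.exists_max_image (V.powerset.filter (IsAnchor V m)) Finset.card
    ⟨X, by simp [hX, hX.1]⟩
  exact ⟨Z, (Finset.mem_filter.1 hZ).2, fun Z' hZ' => hmax Z' (by simp [hZ', hZ'.1])⟩

section anchor
variable (h : IsThreeConnCircuit V m) (hna : NoAdmissible V m) (h6 : 6 ≤ V.card)
  (hess : ∀ S ⊆ V, 2 ≤ S.card → 2 ≤ (V \ S).card → 4 ≤ between m S (V \ S))
  (hX : IsAnchor V m X) (hmax : ∀ Z, IsAnchor V m Z → Z.card ≤ X.card)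
include h hna h6 hess hX hmax

/-- With two neighbours in `X`, the set `insert v X` would be critical too, so it must fail to be an
anchor: either it misses just one vertex or it misses only claw nodes. In both cases `v` turns out
to be a claw node as well, and so is everything outside `X`. -/
theorem card_inter_nbrs_le_one (hv : IsNode V m v) (hvX : v ∉ X) :
    (X ∩ nbrs V m v).card ≤ 1 := by
  have h5 : 5 ≤ V.card := by omega
  by_contra! hgt
  obtain ⟨hXV, hXne, hs, hc, u, hu, huX, huT⟩ := hX
  have hs' := h.slack_insert_node hv hXV hvX
  have hsub := Finset.insert_subset hv.1 hXV
  have hci := Finset.card_insert_of_notMem hvX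
  by_cases hc2 : X.card + 2 = V.card
  · have hcd : (V \ X).card = 2 := by
      rw [Finset.card_sdiff_of_subset hXV]; omega
    obtain ⟨w, hw⟩ : ∃ w, V \ X = {v, w} ∧ v ≠ w := by
      obtain ⟨p, q, hpq, he⟩ := Finset.card_eq_two.1 hcd
      have : v ∈ V \ X := by simp [hv.1, hvX]
      rw [he] at this
      simp only [Finset.mem_insert, Finset.mem_singleton] at this
      rcases this with rfl | rfl
      · exact ⟨q, he, hpq⟩
      · exact ⟨p, by rw [he, Finset.pair_comm], hpq.symm⟩
    obtain ⟨hw, hvw⟩ := hw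
    have hXe : X = V \ {v, w} := by rw [← hw, Finset.sdiff_sdiff_eq_self hXV]
    have hwV : w ∈ V := by
      have : w ∈ V \ X := by simp [hw]
      exact Finset.sdiff_subset this
    obtain ⟨-, nw, hadj⟩ := h.isNode_pair hv.1 hwV hvw (by rwa [← hXe])
      -- The two missing vertices are adjacent nodes; adjacent nodes are both claw nodes.
      (hess _ (by grind) (by rw [Finset.card_pair hvw]) (by rw [← hXe]; omega))
    have hall : IsClawNode V m v ∧ IsClawNode V m w := by
      have e1 : w ∈ nbrs V m v := mem_nbrs.2 ⟨hwV, hadj⟩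
      have e2 := h.mem_nbrs_comm hv.1 e1
      rcases h.clique_or_claw hna h5 hv with cv | cv
      · rcases h.clique_or_claw hna h5 nw with cw | cw
        · exact absurd (h.clique_not_adj h5 cv cw) hadj
        · exact ⟨h.claw_of_adj hna h5 cw hv e2, cw⟩
      · exact ⟨cv, h.claw_of_adj hna h5 cv nw e1⟩
    have : u ∈ V \ X := by simp [hu, huX]
    rw [hw] at this
    simp only [Finset.mem_insert, Finset.mem_singleton] at this
    rcases this with rfl | rfl
    exacts [huT hall.1, huT hall.2]
  · have hclaw : ∀ y ∈ V, y ∉ insert v X → IsClawNode V m y := by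
      by_contra! hh
      have := hmax (insert v X) ⟨hsub, by simp, by omega, by omega, hh⟩
      omega
    obtain ⟨y, hy, hyX⟩ : ∃ y ∈ nbrs V m v, y ∉ X := by
      by_contra! hh
      have := h.insert_eq_univ hv hXV hvX hh hs
      rw [this] at hci
      omega
    have hyv : y ≠ v := fun he => (h.node_nbrs hv).2.1 (he ▸ hy)
    have hyT := hclaw y (nbrs_subset hy) (by simp [hyv, hyX])
    have hvT := h.claw_of_adj hna h5 hyT hv (h.mem_nbrs_comm hv.1 hy)
    rcases eq_or_ne u v with rfl | hne
    · exact huT hvT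
    · exact huT (hclaw u hu (by simp [hne, huX]))

/-- If `x` were not a claw node, `X ∪ P` would be critical, miss `v` and `x`, and so be an anchor.
Maximality puts `P`, and with it two neighbours of `v`, inside `X`. -/
theorem claw_of_blocker_inter (hv : IsClawNode V m v) (hvX : v ∉ X) {x : α}
    (hx : x ∈ nbrs V m v) (hxX : x ∉ X) {P : Finset α} (hP : P ⊆ V) (hvP : v ∉ P) (hxP : x ∉ P)
    (hNP : (nbrs V m v).erase x ⊆ P) (hsP : slack m P = 1) (hi : (X ∩ P).Nonempty) :
    IsClawNode V m x := by
  by_contra hxT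
  have hvu : v ∉ X ∪ P := by simp [*]
  have hs := (h.uncross hX.1 hP hi (fun he => hvu (he ▸ hv.1.1)) hX.2.2.1 hsP.le).1
  have hxv : x ≠ v := fun he => (h.node_nbrs hv.1).2.1 (he ▸ hx)
  have hsub : X ∪ P ⊆ (V.erase x).erase v := by
    have := hX.1
    grind
  have hc := Finset.card_le_card hsub
  rw [Finset.card_erase_of_mem (by simp [hxv.symm, hv.1.1]),
    Finset.card_erase_of_mem (nbrs_subset hx)] at hc
  have hle := hmax (X ∪ P) ⟨Finset.union_subset hX.1 hP, hX.2.1.mono Finset.subset_union_left,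
    hs.le, by omega, x, nbrs_subset hx, by simp [*], hxT⟩
  have he := Finset.eq_of_subset_of_card_le Finset.subset_union_left hle
  have h1 := h.card_inter_nbrs_le_one hna h6 hess hX hmax hv.1 hvX
  have h2 : (nbrs V m v).erase x ⊆ X ∩ nbrs V m v := by
    have : P ⊆ X := he ▸ Finset.subset_union_right
    grind
  have h3 := Finset.card_le_card h2
  rw [Finset.card_erase_of_mem hx, (h.node_nbrs hv.1).1] at h3
  omega

/-- Take a leaf `v` of the forest of claw nodes outside `X`. It has at most one neighbour in `X` and
at most one in the forest, so some neighbour `x` outside `X` is not a claw node, and the blocking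
set avoiding `x` is disjoint from `X`. The other two neighbours then lie outside `X`, and their
blocking sets must meet `X`; so both are claw nodes, against the choice of the leaf. -/
theorem not_claw (hvX : v ∉ X) : ¬ IsClawNode V m v := by
  classical
  intro hv
  set S := (V \ X).filter (IsClawNode V m) with hS
  obtain ⟨v, hv, hleaf⟩ := h.exists_leaf (S := S) (fun v hv => (Finset.mem_filter.1 hv).2.1)
    ⟨v, by simp [hS, hv, hv.1.1, hvX]⟩
  obtain ⟨hvX, hv⟩ := Finset.mem_filter.1 hv
  have hvX := (Finset.mem_sdiff.1 hvX).2
  have hN := (h.node_nbrs hv.1).1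
  have hXN := h.card_inter_nbrs_le_one hna h6 hess hX hmax hv.1 hvX
  have key := fun x => h.claw_of_blocker_inter hna h6 hess hX hmax hv hvX (x := x)
  by_cases hall : ∀ x ∈ nbrs V m v, x ∉ X → IsClawNode V m x
  · have h1 : nbrs V m v \ X ⊆ S ∩ nbrs V m v := fun x hx => by
      obtain ⟨hx, hxX⟩ := Finset.mem_sdiff.1 hx
      simp [hS, hx, hxX, nbrs_subset hx, hall x hx hxX]
    have h2 := Finset.card_le_card h1
    have h3 := Finset.card_sdiff_add_card_inter (nbrs V m v) X
    rw [Finset.inter_comm] at h3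
    omega
  · push Not at hall
    obtain ⟨x, hx, hxX, hxT⟩ := hall
    obtain ⟨P, hP, hvP, hxP, hNP, hsP⟩ := h.exists_claw_blocker hna hv hx
    have hdis : ¬ (X ∩ P).Nonempty := fun hi => hxT (key x hx hxX hP hvP hxP hNP hsP hi)
    have h1 : (nbrs V m v).erase x ⊆ S ∩ nbrs V m v := fun y hy => by
      obtain ⟨hyx, hyN⟩ := Finset.mem_erase.1 hy
      have hyX : y ∉ X := fun hyX => hdis ⟨y, by simp [hyX, hNP hy]⟩
      obtain ⟨Q, hQ, hvQ, hyQ, hNQ, hsQ⟩ := h.exists_claw_blocker hna hv hyN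
      have hu := h.claw_blocker_union hv.1 hx hyN hyx.symm hP hQ hvP hvQ hNP hNQ hsP.le hsQ.le
      have hyT := key y hyN hyX hQ hvQ hyQ hNQ hsQ (by
        obtain ⟨u, hu'⟩ := hX.2.1
        have huV := hX.1 hu'
        rw [← hu] at huV
        refine ⟨u, ?_⟩
        have : u ∉ P := fun hh => hdis ⟨u, by simp [*]⟩
        grind)
      simp [hS, hyT, hyX, hyN, nbrs_subset hyN]
    have h2 := Finset.card_le_card h1
    rw [Finset.card_erase_of_mem hx, hN] at h2
    omega

theorem clique_of_notMem (hv : IsNode V m v) (hvX : v ∉ X) : IsCliqueNode V m v :=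
  (h.clique_or_claw hna (by omega) hv).resolve_right
    (h.not_claw hna h6 hess hX hmax hvX)

theorem not_node_of_adj (hv : IsNode V m v) (hvX : v ∉ X) (hw : w ∈ nbrs V m v) (hwX : w ∉ X) :
    4 ≤ deg V m w := by
  by_contra! hlt
  have hwn : IsNode V m w := ⟨nbrs_subset hw, by have := h.three_le_deg (nbrs_subset hw); omega⟩
  exact (mem_nbrs.1 hw).2 (h.clique_not_adj (by omega)
    (h.clique_of_notMem hna h6 hess hX hmax hv hvX)
    (h.clique_of_notMem hna h6 hess hX hmax hwn hwX))

end anchor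
end IsThreeConnCircuit

/-! ### The charge `4 - deg` outside a largest anchor -/

namespace IsThreeConnCircuit
variable {V : Finset α} {m : α → α → ℕ} {X Y S : Finset α} {v w : α}

theorem sdiff_eq_union_sdiff {x y z : α} (hv : v ∈ V) (hy : y ∈ V) (hz : z ∈ V) (hvX : v ∉ X)
    (hx : x ∈ X) (hyX : y ∉ X) (hzX : z ∉ X) :
    V \ X = {v, y, z} ∪ (V \ (X ∪ insert v {x, y, z})) := by
  grind

/-- The vertex `y` is adjacent to `v`, `u`, `z`, `x` and `x'`, so degree at most 4 forces `x = x'`.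
Then `y` and `z` have no further neighbours and `x` is a cut vertex. -/
theorem false_of_sdiff_eq_four (h : IsThreeConnCircuit V m) (hX : X ⊆ V) (hXc : 2 ≤ X.card)
    {x x' y z u : α} (hY : V \ X = {v, y, z, u}) (hvy : v ≠ y) (hvz : v ≠ z) (hvu : v ≠ u)
    (hyz : y ≠ z) (hyu : y ≠ u) (hzu : z ≠ u) (hNv : nbrs V m v = {x, y, z})
    (hNu : nbrs V m u = {x', y, z}) (hx : x ∈ X) (hx' : x' ∈ X) (hyx : m y x ≠ 0)
    (hyx' : m y x' ≠ 0) (hzx : m z x ≠ 0) (hzx' : m z x' ≠ 0) (hyz' : m y z ≠ 0)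
    (hdy : deg V m y ≤ 4) (hdz : deg V m z ≤ 4) : False := by
  have hYV : ∀ t ∈ ({v, y, z, u} : Finset α), t ∈ V ∧ t ∉ X := fun t ht =>
    Finset.mem_sdiff.1 (hY ▸ ht)
  have hvV := hYV v (by simp)
  have hyV := hYV y (by simp)
  have hzV := hYV z (by simp)
  have huV := hYV u (by simp)
  have hy1 : y ∈ nbrs V m v := by simp [hNv]
  have hz1 : z ∈ nbrs V m v := by simp [hNv]
  have hy2 : y ∈ nbrs V m u := by simp [hNu]
  have hz2 : z ∈ nbrs V m u := by simp [hNu]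
  have xne : ∀ t, t ∉ X → t ≠ x ∧ t ≠ x' := fun t ht =>
    ⟨fun he => ht (he ▸ hx), fun he => ht (he ▸ hx')⟩
  obtain ⟨xv, xv'⟩ := xne v hvV.2
  obtain ⟨xu, xu'⟩ := xne u huV.2
  obtain ⟨xy, xy'⟩ := xne y hyV.2
  obtain ⟨xz, xz'⟩ := xne z hzV.2
  have by' : {v, u, z, x, x'} ⊆ (nbrs V m y).erase y := by
    simp only [Finset.insert_subset_iff, Finset.singleton_subset_iff, Finset.mem_erase]
    exact ⟨⟨hvy, h.mem_nbrs_comm hvV.1 hy1⟩, ⟨hyu.symm, h.mem_nbrs_comm huV.1 hy2⟩,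
      ⟨hyz.symm, mem_nbrs.2 ⟨hzV.1, hyz'⟩⟩, ⟨xy.symm, mem_nbrs.2 ⟨hX hx, hyx⟩⟩,
      ⟨xy'.symm, mem_nbrs.2 ⟨hX hx', hyx'⟩⟩⟩
  have bz' : {v, u, y, x, x'} ⊆ (nbrs V m z).erase z := by
    simp only [Finset.insert_subset_iff, Finset.singleton_subset_iff, Finset.mem_erase]
    exact ⟨⟨hvz, h.mem_nbrs_comm hvV.1 hz1⟩, ⟨hzu.symm, h.mem_nbrs_comm huV.1 hz2⟩,
      ⟨hyz, mem_nbrs.2 ⟨hyV.1, by rwa [h.symm z y]⟩⟩, ⟨xz.symm, mem_nbrs.2 ⟨hX hx, hzx⟩⟩,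
      ⟨xz'.symm, mem_nbrs.2 ⟨hX hx', hzx'⟩⟩⟩
  have cy := card_nbrs_le_deg (m := m) hyV.1
  have cz := card_nbrs_le_deg (m := m) hzV.1
  obtain rfl : x = x' := by
    by_contra hne
    have c1 := Finset.card_le_card by'
    rw [Finset.card_insert_of_notMem (by simp [*]), Finset.card_insert_of_notMem (by simp [*, hzu.symm]),
      Finset.card_insert_of_notMem (by simp [*]), Finset.card_pair hne] at c1
    omega
  rw [Finset.pair_eq_singleton] at by' bz'
  have ey := Finset.eq_of_subset_of_card_le by' (by
    rw [Finset.card_insert_of_notMem (by simp [*]), Finset.card_insert_of_notMem (by simp [*, hzu.symm]),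
      Finset.card_pair xz]
    omega)
  have ez := Finset.eq_of_subset_of_card_le bz' (by
    rw [Finset.card_insert_of_notMem (by simp [*]), Finset.card_insert_of_notMem (by simp [*, hyu.symm]),
      Finset.card_pair xy]
    omega)
  obtain ⟨a, ha, b, hb, hab⟩ := h.conn {x} (by simpa using hX hx) (by simp) (V \ X)
    (X.erase x) (by rw [hY]; simp) (by
      rw [← Finset.card_pos, Finset.card_erase_of_mem hx]
      omega)
    (Finset.sdiff_disjoint.mono_right (Finset.erase_subset _ _)) (by grind)
  have hbX := Finset.mem_of_mem_erase hb
  have hbx := Finset.ne_of_mem_erase hb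
  have hbN : b ∈ nbrs V m a := mem_nbrs.2 ⟨hX hbX, hab⟩
  rw [hY] at ha
  simp only [Finset.mem_insert, Finset.mem_singleton] at ha
  have hbne : ∀ t, t ∉ X → b ≠ t := fun t ht he => ht (he ▸ hbX)
  have b1 := hbne v hvV.2
  have b2 := hbne u huV.2
  have b3 := hbne y hyV.2
  have b4 := hbne z hzV.2
  rcases ha with rfl | rfl | rfl | rfl
  · rw [hNv] at hbN
    simp [*] at hbN
  · have : b ∈ (nbrs V m a).erase a := Finset.mem_erase.2 ⟨b3, hbN⟩
    rw [← ey] at this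
    simp only [Finset.mem_insert, Finset.mem_singleton] at this
    tauto
  · have : b ∈ (nbrs V m a).erase a := Finset.mem_erase.2 ⟨b4, hbN⟩
    rw [← ez] at this
    simp only [Finset.mem_insert, Finset.mem_singleton] at this
    tauto
  · rw [hNu] at hbN
    simp [*] at hbN

theorem symmDiff_eq_sdiff_pair {A B : Finset α} {x w : α} (h1 : V \ {x} = A ∪ B)
    (h2 : A ∩ B = {w}) : A \ B ∪ B \ A = V \ {w, x} := by
  ext a
  have h1 := Finset.ext_iff.1 h1 a
  have h2 := Finset.ext_iff.1 h2 a
  simp only [Finset.mem_sdiff, Finset.mem_union, Finset.mem_inter, Finset.mem_singleton,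
    Finset.mem_insert] at *
  tauto

section anchor
variable (h : IsThreeConnCircuit V m) (hna : NoAdmissible V m) (h6 : 6 ≤ V.card)
  (hess : ∀ S ⊆ V, 2 ≤ S.card → 2 ≤ (V \ S).card → 4 ≤ between m S (V \ S))
  (hX : IsAnchor V m X) (hmax : ∀ Z, IsAnchor V m Z → Z.card ≤ X.card)
include h hna h6 hess hX hmax

/-- No vertex outside `X` is a claw node, so any vertex outside both sets certifies that `Y` is an
anchor. -/
theorem card_le_of_slack (hY : Y ⊆ V) (hne : Y.Nonempty) (hs : slack m Y ≤ 1)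
    (hc : Y.card + 2 ≤ V.card) (hu : ∃ u ∈ V, u ∉ Y ∧ u ∉ X) : Y.card ≤ X.card := by
  obtain ⟨u, hu, huY, huX⟩ := hu
  exact hmax Y ⟨hY, hne, hs, hc, u, hu, huY, h.not_claw hna h6 hess hX hmax huX⟩

/-- The intersection has at least the slack of the closed neighbourhood, so by submodularity the
union has at most that of `X`. -/
theorem slack_union_closedNbrs (hv : IsNode V m v) (hvX : v ∉ X)
    (hi : (X ∩ nbrs V m v).Nonempty) : slack m (X ∪ closedNbrs V m v) ≤ 1 := by
  have hcl := h.clique_of_notMem hna h6 hess hX hmax hv hvX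
  have hXK : X ∩ closedNbrs V m v = X ∩ nbrs V m v := by
    rw [closedNbrs, Finset.inter_insert_of_notMem hvX]
  have h1 := (h.slack_closedNbrs_le (by omega) hcl
    (Finset.inter_subset_right (s₁ := X)) (by rwa [hXK])).1
  have h2 := slack_union_add_inter h.symm X (closedNbrs V m v)
  have h3 := between_nonneg (m := m) (X \ closedNbrs V m v) (closedNbrs V m v \ X)
  have := hX.2.2.1
  omega

theorem card_sdiff_le_one (hv : IsNode V m v) (hvX : v ∉ X)
    (hi : (X ∩ nbrs V m v).Nonempty) : (V \ (X ∪ closedNbrs V m v)).card ≤ 1 := by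
  by_contra! hgt
  have hsub := Finset.union_subset hX.1 (closedNbrs_subset (V := V) (m := m) hv.1)
  have hc := Finset.card_sdiff_add_card_eq_card hsub
  obtain ⟨u, hu⟩ := Finset.card_pos.1 (show 0 < (V \ (X ∪ closedNbrs V m v)).card by omega)
  simp only [Finset.mem_sdiff, Finset.mem_union, not_or] at hu
  have hle := h.card_le_of_slack hna h6 hess hX hmax hsub
    (hX.2.1.mono Finset.subset_union_left)
    (h.slack_union_closedNbrs hna h6 hess hX hmax hv hvX hi) (by omega)
    ⟨u, hu.1, by simp [hu.2], hu.2.1⟩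
  have he := Finset.eq_of_subset_of_card_le Finset.subset_union_left hle
  exact hvX (he ▸ by simp [closedNbrs])

/-- Otherwise `X` and the closed neighbourhood of `v` miss at most one vertex, so `V \ X` has at
most four vertices. Since the cut has at least four edges, `4 - deg` sums to at least 2 over `V \
X`, while neighbours of `v` there have degree at least four. -/
theorem nbrs_disjoint (hv : IsNode V m v) (hvX : v ∉ X) : Disjoint X (nbrs V m v) := by
  rw [Finset.disjoint_iff_inter_eq_empty, ← Finset.not_nonempty_iff_eq_empty]
  intro hi
  have hXV := hX.1
  have hW := h.card_sdiff_le_one hna h6 hess hX hmax hv hvX hi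
  have hs := h.slack_union_closedNbrs hna h6 hess hX hmax hv hvX hi
  have hle := fun {w : α} => h.card_inter_nbrs_le_one hna h6 hess hX hmax (v := w)
  have hcl := h.clique_of_notMem hna h6 hess hX hmax hv hvX
  have hdeg := fun {v w : α} => h.not_node_of_adj hna h6 hess hX hmax (v := v) (w := w)
  obtain ⟨hN, hvN, -⟩ := h.node_nbrs hv
  obtain ⟨x, hx⟩ := Finset.card_eq_one.1 (le_antisymm (hle hv hvX) (Finset.card_pos.2 hi))
  have hxX : x ∈ X ∧ x ∈ nbrs V m v := Finset.mem_inter.1 (hx ▸ Finset.mem_singleton_self x)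
  obtain ⟨y, z, hyz, hyze⟩ := Finset.card_eq_two.1 (show (nbrs V m v \ X).card = 2 by
    have := Finset.card_sdiff_add_card_inter (nbrs V m v) X
    rw [Finset.inter_comm, hx, Finset.card_singleton] at this
    omega)
  have hNe : nbrs V m v = {x, y, z} := by
    rw [← Finset.sdiff_union_inter (nbrs V m v) X, hyze, Finset.inter_comm, hx, Finset.union_comm]
    rfl
  have hy : y ∈ nbrs V m v ∧ y ∉ X := Finset.mem_sdiff.1 (by simp [hyze])
  have hz : z ∈ nbrs V m v ∧ z ∉ X := Finset.mem_sdiff.1 (by simp [hyze])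
  have hyV := nbrs_subset hy.1
  have hzV := nbrs_subset hz.1
  have hvy : v ≠ y := fun he => hvN (he ▸ hy.1)
  have hvz : v ≠ z := fun he => hvN (he ▸ hz.1)
  have hvV := hv.1
  have hYe : V \ X = {v, y, z} ∪ (V \ (X ∪ closedNbrs V m v)) := by
    rw [closedNbrs, hNe]
    exact sdiff_eq_union_sdiff hvV hyV hzV hvX hxX.1 hy.2 hz.2
  have hYc : (V \ X).card ≤ 4 := by
    rw [hYe]
    exact (Finset.card_union_le _ _).trans (by
      have := Finset.card_le_three (a := v) (b := y) (c := z)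
      omega)
  have hXc := Finset.card_sdiff_add_card_eq_card hXV
  have hX2 := hX.2.2.2.1
  have hsum := h.sum_four_sub_deg_sdiff hXV
  have hbet := h.between_sdiff hXV
  have h4 := hess X hXV (by omega) (by omega)
  have hX1 := hX.2.2.1
  have dy := hdeg hv hvX hy.1 hy.2
  have dz := hdeg hv hvX hz.1 hz.2
  rcases (V \ (X ∪ closedNbrs V m v)).eq_empty_or_nonempty with hWe | hWne
  · rw [hYe, hWe, Finset.union_empty, Finset.sum_insert (by simp [*]), Finset.sum_pair hyz,
      hv.2] at hsum
    rw [hYe, hWe, Finset.union_empty] at hbet h4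
    omega
  -- The missed vertex `u` is a second node, with exactly one neighbour in `X`. The sum is then
  -- attained only if `y` and `z` have degree four.
  · obtain ⟨u, hu⟩ := Finset.card_eq_one.1 (le_antisymm hW (Finset.card_pos.2 hWne))
    have huV : u ∈ V ∧ u ∉ X ∪ closedNbrs V m v := Finset.mem_sdiff.1 (by simp [hu])
    have hun : IsNode V m u := h.isNode_of_slack_sdiff huV.1 (by
      rwa [← hu, Finset.sdiff_sdiff_eq_self (Finset.union_subset hXV (closedNbrs_subset hv.1))])
    simp only [Finset.mem_union, closedNbrs, Finset.mem_insert, not_or] at huV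
    obtain ⟨huV, huX, huv, huN⟩ := huV
    have hYu : V \ X = {v, y, z, u} := by
      rw [hYe, hu, Finset.insert_union, Finset.insert_union, ← Finset.insert_eq]
    obtain ⟨hNu, huNu, -⟩ := h.node_nbrs hun
    have hNu2 : nbrs V m u \ X ⊆ {y, z} := fun w hw => by
      obtain ⟨hw, hwX⟩ := Finset.mem_sdiff.1 hw
      have h1 : w ∈ V \ X := by simp [hwX, nbrs_subset hw]
      rw [hYu] at h1
      have h2 : w ≠ u := fun he => huNu (he ▸ hw)
      have h3 : w ≠ v := fun he => huN (h.mem_nbrs_comm huV (he ▸ hw))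
      rw [Finset.mem_insert, Finset.mem_insert, Finset.mem_insert, Finset.mem_singleton] at h1
      rw [Finset.mem_insert, Finset.mem_singleton]
      tauto
    have hcu := Finset.card_sdiff_add_card_inter (nbrs V m u) X
    have hcu1 := hle hun huX
    rw [Finset.inter_comm] at hcu1
    have hNu3 := Finset.eq_of_subset_of_card_le hNu2 (by rw [Finset.card_pair hyz]; omega)
    obtain ⟨x', hx'⟩ := Finset.card_eq_one.1 (show (nbrs V m u ∩ X).card = 1 by
      rw [hNu3, Finset.card_pair hyz] at hcu
      omega)
    have hx'X : x' ∈ nbrs V m u ∧ x' ∈ X :=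
      Finset.mem_inter.1 (hx' ▸ Finset.mem_singleton_self x')
    have huy : y ∈ nbrs V m u := (Finset.mem_sdiff.1 (show y ∈ nbrs V m u \ X by simp [hNu3])).1
    have huz : z ∈ nbrs V m u := (Finset.mem_sdiff.1 (show z ∈ nbrs V m u \ X by simp [hNu3])).1
    have hucl := h.clique_of_notMem hna h6 hess hX hmax hun huX
    have huy' : u ≠ y := fun he => huN (he ▸ hy.1)
    have huz' : u ≠ z := fun he => huN (he ▸ hz.1)
    have hNue : nbrs V m u = {x', y, z} := by
      rw [← Finset.sdiff_union_inter (nbrs V m u) X, hNu3, hx', Finset.union_comm]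
      rfl
    have hyz' := hcl.2 y hy.1 z hz.1 hyz
    have adj : ∀ a b, a ∉ X → b ∈ X → a ≠ b := fun a b ha hb he => ha (he ▸ hb)
    rw [hYu, Finset.sum_insert (by simp [hvy, hvz, (Ne.symm huv)]),
      Finset.sum_insert (by simp [hyz, huy'.symm]), Finset.sum_pair huz'.symm, hv.2, hun.2] at hsum
    rw [hYu] at hbet h4
    exact h.false_of_sdiff_eq_four hXV (by omega) hYu hvy hvz (Ne.symm huv) hyz huy'.symm huz'.symm hNe
      hNue hxX.1 hx'X.2 (hcl.2 y hy.1 x hxX.2 (adj y x hy.2 hxX.1))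
      (hucl.2 y huy x' hx'X.1 (adj y x' hy.2 hx'X.2)) (hcl.2 z hz.1 x hxX.2 (adj z x hz.2 hxX.1))
      (hucl.2 z huz x' hx'X.1 (adj z x' hz.2 hx'X.2)) hyz' (by omega) (by omega)

theorem closedNbrs_subset_sdiff (hv : IsNode V m v) (hvX : v ∉ X) :
    closedNbrs V m v ⊆ V \ X := by
  have h1 := h.nbrs_disjoint hna h6 hess hX hmax hv hvX
  have h2 := closedNbrs_subset (m := m) hv.1
  have h3 := Finset.disjoint_left.1 h1
  intro a ha
  refine Finset.mem_sdiff.2 ⟨h2 ha, fun haX => ?_⟩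
  rcases Finset.mem_insert.1 ha with rfl | ha
  exacts [hvX haX, h3 haX ha]

/-- Otherwise `X` is a single vertex `x` and `M` with the closed neighbourhood covers the rest. If
that neighbourhood has slack 2, it meets `M` in one vertex `w`, no edge joins the two differences,
and `{w, x}` is a separator. If it is critical, it is an anchor larger than `{x}`, because `x`
carries a loop and is not a claw node. -/
theorem two_le_card_sdiff_union {M : Finset α} (hM : M ⊆ V \ X) (hMc : 4 ≤ M.card)
    (hMs : slack m M ≤ 2) (hv : IsNode V m v) (hvX : v ∉ X)
    (hi : (M ∩ closedNbrs V m v).Nonempty) (hn : ¬ closedNbrs V m v ⊆ M) :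
    2 ≤ (V \ (M ∪ closedNbrs V m v)).card := by
  have hXV := hX.1
  have hcl := h.clique_of_notMem hna h6 hess hX hmax hv hvX
  have hK := h.closedNbrs_subset_sdiff hna h6 hess hX hmax hv hvX
  have hKc := h.card_closedNbrs hv
  have hunion := Finset.union_subset hM hK
  have hXsub : X ⊆ V \ (M ∪ closedNbrs V m v) := fun a ha => by
    refine Finset.mem_sdiff.2 ⟨hXV ha, fun hh => ?_⟩
    exact (Finset.mem_sdiff.1 (hunion hh)).2 ha
  by_contra! hlt
  have hXp := hX.2.1.card_pos
  have hXe := Finset.eq_of_subset_of_card_le hXsub (by omega)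
  obtain ⟨x, rfl⟩ := Finset.card_eq_one.1 (show X.card = 1 by rw [hXe] at hXp ⊢; omega)
  have hYe : V \ {x} = M ∪ closedNbrs V m v := by
    rw [hXe, Finset.sdiff_sdiff_eq_self (hunion.trans Finset.sdiff_subset)]
  have hxV : x ∈ V := by simpa using hXV
  have hsx := hX.2.2.1
  have hbet := h.between_sdiff hXV
  have h3 := h.three_le_between (S := {x}) ⟨hXV, fun hh => by
    have := Finset.card_le_card hh; simp at this; omega⟩ (by simp)
  rw [hYe] at hbet h3
  obtain ⟨hle1, hle2⟩ := h.slack_closedNbrs_le (by omega) hcl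
    (Finset.inter_subset_right (s₁ := M)) hi
  have hu := slack_union_add_inter h.symm M (closedNbrs V m v)
  have hb := between_nonneg (m := m) (M \ closedNbrs V m v) (closedNbrs V m v \ M)
  have hKs := (h.slack_closedNbrs hcl).1
  by_cases hK2 : 2 ≤ slack m (closedNbrs V m v)
  · rcases hle2 (by omega) hK2 with h1 | h1
    · obtain ⟨w, hw⟩ := Finset.card_eq_one.1 h1
      have hwm : w ∈ M ∧ w ∈ closedNbrs V m v :=
        Finset.mem_inter.1 (hw ▸ Finset.mem_singleton_self w)
      have e1 := Finset.card_sdiff_add_card_inter M (closedNbrs V m v)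
      have e2 := Finset.card_sdiff_add_card_inter (closedNbrs V m v) M
      rw [Finset.inter_comm] at e2
      obtain ⟨a, ha, b, hb', hab⟩ := h.conn {w, x} (Finset.insert_subset
          (closedNbrs_subset (m := m) hv.1 hwm.2) hXV) Finset.card_le_two
        (M \ closedNbrs V m v) (closedNbrs V m v \ M) (by rw [← Finset.card_pos]; omega)
        (by rw [← Finset.card_pos]; omega)
        (Finset.disjoint_of_subset_right Finset.sdiff_subset Finset.sdiff_disjoint)
        (symmDiff_eq_sdiff_pair hYe hw)
      exact hab (eq_zero_of_between (by omega) ha hb')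
    · exact hn (by rw [← h1]; exact Finset.inter_subset_left)
  · have hx1 : ¬ x ∈ closedNbrs V m v := fun hh => by simpa using hK hh
    have hxn : ¬ IsClawNode V m x := fun hh => by
      have := h.node_loop x hxV hh.1.2
      rw [slack_singleton h.symm] at hsx
      omega
    have := hmax (closedNbrs V m v) ⟨closedNbrs_subset hv.1, by simp [closedNbrs], by omega,
      by omega, x, hxV, hx1, hxn⟩
    simp at this
    omega

/-- Grow the closed neighbourhood of `v` by overlapping ones; the slack never rises above 2. Two
vertices always stay outside, so the cut has at least four edges and the total charge is at most `2
* 2 - 4`. -/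
theorem exists_component {U : Finset α} (hU : ∀ w, IsNode V m w → w ∉ X →
      closedNbrs V m w ⊆ U ∨ Disjoint (closedNbrs V m w) U)
    (hv : IsNode V m v) (hvX : v ∉ X) (hvU : v ∉ U) :
    ∃ M, v ∈ M ∧ M ⊆ V \ X ∧ Disjoint M U ∧ ∑ u ∈ M, (4 - deg V m u) ≤ 0 ∧
      ∀ w, IsNode V m w → w ∉ X → closedNbrs V m w ⊆ M ∨ Disjoint (closedNbrs V m w) M := by
  classical
  have hcl := h.clique_of_notMem hna h6 hess hX hmax hv hvX
  have hdis : ∀ w, IsNode V m w → w ∉ X → ∀ M, Disjoint M U →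
      (M ∩ closedNbrs V m w).Nonempty → Disjoint (closedNbrs V m w) U := by
    rintro w hw hwX M hM ⟨a, ha⟩
    rcases hU w hw hwX with h1 | h1
    · exact absurd (h1 (Finset.mem_inter.1 ha).2) (Finset.disjoint_left.1 hM
        (Finset.mem_inter.1 ha).1)
    · exact h1
  have hK := h.closedNbrs_subset_sdiff hna h6 hess hX hmax hv hvX
  have hKV := closedNbrs_subset (m := m) hv.1
  have hKc := h.card_closedNbrs hv
  obtain ⟨M, hM, hMmax⟩ := Finset.exists_max_image (V.powerset.filter fun M =>
      closedNbrs V m v ⊆ M ∧ M ⊆ V \ X ∧ slack m M ≤ 2 ∧ 2 ≤ (V \ M).card ∧ Disjoint M U)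
    Finset.card ⟨closedNbrs V m v, by
      rw [Finset.mem_filter, Finset.mem_powerset]
      refine ⟨hKV, subset_rfl, hK, (h.slack_closedNbrs hcl).1, ?_, ?_⟩
      · rw [Finset.card_sdiff_of_subset hKV]
        omega
      · refine (hU v hv hvX).resolve_left fun hh => hvU (hh (by simp [closedNbrs]))⟩
  obtain ⟨-, hKM, hMY, hMs, hM2, hMU⟩ := Finset.mem_filter.1 hM
  have hM4 := Finset.card_le_card hKM
  refine ⟨M, hKM (by simp [closedNbrs]), hMY, hMU, ?_, fun w hw hwX => ?_⟩
  · rw [sum_four_sub_deg h.symm (hMY.trans Finset.sdiff_subset)]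
    have := hess M (hMY.trans Finset.sdiff_subset) (by omega) hM2
    omega
  · by_contra! hcon
    have hi : (M ∩ closedNbrs V m w).Nonempty := by
      rw [← Finset.not_disjoint_iff_nonempty_inter, disjoint_comm]
      exact hcon.2
    have hwcl := h.clique_of_notMem hna h6 hess hX hmax hw hwX
    have hwK := h.closedNbrs_subset_sdiff hna h6 hess hX hmax hw hwX
    have h1 := (h.slack_closedNbrs_le (by omega) hwcl
      (Finset.inter_subset_right (s₁ := M)) hi).1
    have h2 := slack_union_add_inter h.symm M (closedNbrs V m w)
    have h3 := between_nonneg (m := m) (M \ closedNbrs V m w) (closedNbrs V m w \ M)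
    have h4 := h.two_le_card_sdiff_union hna h6 hess hX hmax hMY (by omega) hMs hw hwX hi
      hcon.1
    have hle := hMmax (M ∪ closedNbrs V m w) (by
      rw [Finset.mem_filter, Finset.mem_powerset]
      refine ⟨(Finset.union_subset hMY hwK).trans Finset.sdiff_subset,
        hKM.trans Finset.subset_union_left, Finset.union_subset hMY hwK, by omega, h4, ?_⟩
      exact Finset.disjoint_union_left.2 ⟨hMU, hdis w hw hwX M hMU hi⟩)
    have he := Finset.eq_of_subset_of_card_le Finset.subset_union_left hle
    exact hcon.1 (by rw [he]; exact Finset.subset_union_right)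

theorem false_of_max_anchor : False := by
  classical
  have hXV := hX.1
  -- A largest union of merged closed neighbourhoods with non-positive charge; it absorbs every node
  -- outside `X`, and all other vertices there have degree at least four.
  obtain ⟨U, hU, hUmax⟩ := Finset.exists_max_image (V.powerset.filter fun U =>
      U ⊆ V \ X ∧ ∑ u ∈ U, (4 - deg V m u) ≤ 0 ∧ ∀ w, IsNode V m w → w ∉ X →
        closedNbrs V m w ⊆ U ∨ Disjoint (closedNbrs V m w) U)
    Finset.card ⟨∅, by simp⟩
  obtain ⟨-, hUY, hUs, hUc⟩ := Finset.mem_filter.1 hU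
  have hnode : ∀ v, IsNode V m v → v ∉ X → v ∈ U := by
    intro v hv hvX
    by_contra hvU
    obtain ⟨M, hvM, hMY, hMU, hMs, hMc⟩ := h.exists_component hna h6 hess hX hmax hUc hv hvX hvU
    have hle := hUmax (U ∪ M) (by
      rw [Finset.mem_filter, Finset.mem_powerset]
      refine ⟨(Finset.union_subset hUY hMY).trans Finset.sdiff_subset,
        Finset.union_subset hUY hMY, ?_, fun w hw hwX => ?_⟩
      · rw [Finset.sum_union hMU.symm]
        omega
      · rcases hUc w hw hwX with h1 | h1
        · exact .inl (h1.trans Finset.subset_union_left)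
        · rcases hMc w hw hwX with h2 | h2
          · exact .inl (h2.trans Finset.subset_union_right)
          · exact .inr (Finset.disjoint_union_right.2 ⟨h1, h2⟩))
    have he := Finset.eq_of_subset_of_card_le Finset.subset_union_left hle
    exact hvU (by rw [he]; simp [hvM])
  have hsum := h.sum_four_sub_deg_sdiff hXV
  have hbet := h.between_sdiff hXV
  have hX2 := hX.2.2.2.1
  have h3 := h.three_le_between (S := X) ⟨hXV, fun hh => by
    have := Finset.card_le_card hh; omega⟩ hX.2.1
  have hX1 := hX.2.2.1
  have hsplit := Finset.sum_sdiff (f := fun u => 4 - deg V m u) hUY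
  have hrest : ∑ u ∈ (V \ X) \ U, (4 - deg V m u) ≤ 0 := by
    by_contra! hpos
    obtain ⟨u, hu, hn⟩ := h.deg_of_sum_pos (Finset.sdiff_subset.trans Finset.sdiff_subset) hpos
    simp only [Finset.mem_sdiff] at hu
    exact hu.2 (hnode u hn hu.1.2)
  omega

end anchor

/-- A circuit on at least six vertices with a proper critical set has an admissible node. -/
theorem false_of_critical (h : IsThreeConnCircuit V m) (hna : NoAdmissible V m)
    (h6 : 6 ≤ V.card)
    (hess : ∀ S ⊆ V, 2 ≤ S.card → 2 ≤ (V \ S).card → 4 ≤ between m S (V \ S))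
    (hX : X ⊆ V) (hXne : X.Nonempty) (hs : slack m X ≤ 1) (hc : X.card + 2 ≤ V.card) : False := by
  obtain ⟨Z, hZ⟩ := h.exists_anchor hna (by omega) hX hXne hs hc
  obtain ⟨Z, hZ, hmax⟩ := exists_max_anchor hZ
  exact h.false_of_max_anchor hna h6 hess hZ hmax

end IsThreeConnCircuit

/-! ### Recognising base graphs by their multiplicities -/

/-- The multigraph on `V` with multiplicities `m` is isomorphic to the one listed in `B`. -/
def Realizes (V : Finset α) (m : α → α → ℕ) (B : Graph.EdgeList) : Prop :=
  ∃ φ : Fin B.1 → α, Function.Injective φ ∧ Finset.univ.image φ = V ∧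
    ∀ i j, m (φ i) (φ j) = B.2.count s(i, j)

/-- The multigraph on `V` with multiplicities `m` is one of the base graphs. -/
def IsBase (V : Finset α) (m : α → α → ℕ) : Prop :=
  ∃ B ∈ Graph.simpleBaseGraphs ++ Graph.multiBaseGraphs, Realizes V m B

section
variable {V : Finset α} {m : α → α → ℕ}

theorem injective_of_image_univ {n : ℕ} {φ : Fin n → α} (hφ : Finset.univ.image φ = V)
    (hV : V.card = n) : Function.Injective φ := by
  rw [← Set.injOn_univ, ← Finset.coe_univ, ← Finset.card_image_iff]
  simp [hφ, hV]

theorem sum_eq_of_image_univ {n : ℕ} {φ : Fin n → α} (hφ : Finset.univ.image φ = V)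
    (hV : V.card = n) (f : α → ℤ) : ∑ x ∈ V, f x = ∑ i, f (φ i) := by
  rw [← hφ, Finset.sum_image ((injective_of_image_univ hφ hV).injOn)]

theorem realizes_of_le (hm : ∀ x y, m x y = m y x) {n : ℕ} (l : List (Sym2 (Fin n)))
    (φ : Fin n → α) (hφ : Finset.univ.image φ = V) (hV : V.card = n)
    (h : ∀ i j, i ≤ j → m (φ i) (φ j) = l.count s(i, j)) : Realizes V m ⟨n, l⟩ := by
  refine ⟨φ, injective_of_image_univ hφ hV, hφ, fun i j => ?_⟩
  rcases le_total i j with hij | hij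
  · exact h i j hij
  · rw [hm, h j i hij, Sym2.eq_swap]

theorem isBase_K4_two_loops (hm : ∀ x y, m x y = m y x) {a b c d : α}
    (hV : V = {a, b, c, d}) (hc : V.card = 4)
    (h00 : m a a = 0) (h01 : m a b = 1) (h02 : m a c = 1) (h03 : m a d = 1) (h11 : m b b = 0)
    (h12 : m b c = 1) (h13 : m b d = 1) (h22 : m c c = 1) (h23 : m c d = 1) (h33 : m d d = 1) :
    IsBase V m := by
  refine ⟨Graph.multiBaseGraphs[4]'(by decide), List.mem_append_right _ (List.getElem_mem _),
    realizes_of_le (n := 4) hm _ ![a, b, c, d] (by simp [hV, Fin.univ_succ]) hc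
      fun i j hij => ?_⟩
  fin_cases i <;> fin_cases j <;> first | exact absurd hij (by decide) | assumption

theorem isBase_K4_loop_double (hm : ∀ x y, m x y = m y x) {a b c d : α}
    (hV : V = {a, b, c, d}) (hc : V.card = 4)
    (h00 : m a a = 0) (h01 : m a b = 1) (h02 : m a c = 2) (h03 : m a d = 1) (h11 : m b b = 0)
    (h12 : m b c = 1) (h13 : m b d = 1) (h22 : m c c = 0) (h23 : m c d = 1) (h33 : m d d = 1) :
    IsBase V m := by
  refine ⟨Graph.multiBaseGraphs[5]'(by decide), List.mem_append_right _ (List.getElem_mem _),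
    realizes_of_le (n := 4) hm _ ![a, b, c, d] (by simp [hV, Fin.univ_succ]) hc
      fun i j hij => ?_⟩
  fin_cases i <;> fin_cases j <;> first | exact absurd hij (by decide) | assumption

theorem isBase_K4_triple (hm : ∀ x y, m x y = m y x) {a b c d : α}
    (hV : V = {a, b, c, d}) (hc : V.card = 4)
    (h00 : m a a = 0) (h01 : m a b = 1) (h02 : m a c = 3) (h03 : m a d = 1) (h11 : m b b = 0)
    (h12 : m b c = 1) (h13 : m b d = 1) (h22 : m c c = 0) (h23 : m c d = 1) (h33 : m d d = 0) :
    IsBase V m := by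
  refine ⟨Graph.multiBaseGraphs[6]'(by decide), List.mem_append_right _ (List.getElem_mem _),
    realizes_of_le (n := 4) hm _ ![a, b, c, d] (by simp [hV, Fin.univ_succ]) hc
      fun i j hij => ?_⟩
  fin_cases i <;> fin_cases j <;> first | exact absurd hij (by decide) | assumption

theorem isBase_K4_double_path (hm : ∀ x y, m x y = m y x) {a b c d : α}
    (hV : V = {a, b, c, d}) (hc : V.card = 4)
    (h00 : m a a = 0) (h01 : m a b = 1) (h02 : m a c = 2) (h03 : m a d = 1) (h11 : m b b = 0)
    (h12 : m b c = 1) (h13 : m b d = 1) (h22 : m c c = 0) (h23 : m c d = 2) (h33 : m d d = 0) :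
    IsBase V m := by
  refine ⟨Graph.multiBaseGraphs[8]'(by decide), List.mem_append_right _ (List.getElem_mem _),
    realizes_of_le (n := 4) hm _ ![a, b, c, d] (by simp [hV, Fin.univ_succ]) hc
      fun i j hij => ?_⟩
  fin_cases i <;> fin_cases j <;> first | exact absurd hij (by decide) | assumption

theorem isBase_K5_loop_inner (hm : ∀ x y, m x y = m y x) {a b c d e : α}
    (hV : V = {a, b, c, d, e}) (hc : V.card = 5)
    (h00 : m a a = 0) (h01 : m a b = 1) (h02 : m a c = 1) (h03 : m a d = 1) (h04 : m a e = 0)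
    (h11 : m b b = 0) (h12 : m b c = 1) (h13 : m b d = 1) (h14 : m b e = 1) (h22 : m c c = 1)
    (h23 : m c d = 1) (h24 : m c e = 1) (h33 : m d d = 0) (h34 : m d e = 1) (h44 : m e e = 0) :
    IsBase V m := by
  refine ⟨Graph.multiBaseGraphs[9]'(by decide), List.mem_append_right _ (List.getElem_mem _),
    realizes_of_le (n := 5) hm _ ![a, b, c, d, e] (by simp [hV, Fin.univ_succ]) hc
      fun i j hij => ?_⟩
  fin_cases i <;> fin_cases j <;> first | exact absurd hij (by decide) | assumption

theorem isBase_K5_loop_outer (hm : ∀ x y, m x y = m y x) {a b c d e : α}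
    (hV : V = {a, b, c, d, e}) (hc : V.card = 5)
    (h00 : m a a = 1) (h01 : m a b = 1) (h02 : m a c = 1) (h03 : m a d = 1) (h04 : m a e = 0)
    (h11 : m b b = 0) (h12 : m b c = 1) (h13 : m b d = 1) (h14 : m b e = 1) (h22 : m c c = 0)
    (h23 : m c d = 1) (h24 : m c e = 1) (h33 : m d d = 0) (h34 : m d e = 1) (h44 : m e e = 0) :
    IsBase V m := by
  refine ⟨Graph.multiBaseGraphs[10]'(by decide), List.mem_append_right _ (List.getElem_mem _),
    realizes_of_le (n := 5) hm _ ![a, b, c, d, e] (by simp [hV, Fin.univ_succ]) hc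
      fun i j hij => ?_⟩
  fin_cases i <;> fin_cases j <;> first | exact absurd hij (by decide) | assumption

theorem isBase_K5_double_inner (hm : ∀ x y, m x y = m y x) {a b c d e : α}
    (hV : V = {a, b, c, d, e}) (hc : V.card = 5)
    (h00 : m a a = 0) (h01 : m a b = 1) (h02 : m a c = 1) (h03 : m a d = 1) (h04 : m a e = 0)
    (h11 : m b b = 0) (h12 : m b c = 1) (h13 : m b d = 1) (h14 : m b e = 1) (h22 : m c c = 0)
    (h23 : m c d = 2) (h24 : m c e = 1) (h33 : m d d = 0) (h34 : m d e = 1) (h44 : m e e = 0) :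
    IsBase V m := by
  refine ⟨Graph.multiBaseGraphs[11]'(by decide), List.mem_append_right _ (List.getElem_mem _),
    realizes_of_le (n := 5) hm _ ![a, b, c, d, e] (by simp [hV, Fin.univ_succ]) hc
      fun i j hij => ?_⟩
  fin_cases i <;> fin_cases j <;> first | exact absurd hij (by decide) | assumption

theorem isBase_K5_double_outer (hm : ∀ x y, m x y = m y x) {a b c d e : α}
    (hV : V = {a, b, c, d, e}) (hc : V.card = 5)
    (h00 : m a a = 0) (h01 : m a b = 1) (h02 : m a c = 1) (h03 : m a d = 1) (h04 : m a e = 0)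
    (h11 : m b b = 0) (h12 : m b c = 1) (h13 : m b d = 1) (h14 : m b e = 1) (h22 : m c c = 0)
    (h23 : m c d = 1) (h24 : m c e = 1) (h33 : m d d = 0) (h34 : m d e = 2) (h44 : m e e = 0) :
    IsBase V m := by
  refine ⟨Graph.multiBaseGraphs[12]'(by decide), List.mem_append_right _ (List.getElem_mem _),
    realizes_of_le (n := 5) hm _ ![a, b, c, d, e] (by simp [hV, Fin.univ_succ]) hc
      fun i j hij => ?_⟩
  fin_cases i <;> fin_cases j <;> first | exact absurd hij (by decide) | assumption

theorem isBase_K6_triangle (hm : ∀ x y, m x y = m y x) {a b c d e f : α}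
    (hV : V = {a, b, c, d, e, f}) (hc : V.card = 6)
    (h00 : m a a = 0) (h01 : m a b = 1) (h02 : m a c = 0) (h03 : m a d = 1) (h04 : m a e = 1)
    (h05 : m a f = 0) (h11 : m b b = 0) (h12 : m b c = 1) (h13 : m b d = 1) (h14 : m b e = 1)
    (h15 : m b f = 1) (h22 : m c c = 0) (h23 : m c d = 1) (h24 : m c e = 1) (h25 : m c f = 0)
    (h33 : m d d = 0) (h34 : m d e = 1) (h35 : m d f = 1) (h44 : m e e = 0) (h45 : m e f = 1)
    (h55 : m f f = 0) :
    IsBase V m := by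
  refine ⟨Graph.simpleBaseGraphs[1]'(by decide), List.mem_append_left _ (List.getElem_mem _),
    realizes_of_le (n := 6) hm _ ![a, b, c, d, e, f] (by simp [hV, Fin.univ_succ]) hc
      fun i j hij => ?_⟩
  fin_cases i <;> fin_cases j <;> first | exact absurd hij (by decide) | assumption

theorem isBase_K6_path (hm : ∀ x y, m x y = m y x) {a b c d e f : α}
    (hV : V = {a, b, c, d, e, f}) (hc : V.card = 6)
    (h00 : m a a = 0) (h01 : m a b = 1) (h02 : m a c = 1) (h03 : m a d = 1) (h04 : m a e = 1)
    (h05 : m a f = 0) (h11 : m b b = 0) (h12 : m b c = 1) (h13 : m b d = 1) (h14 : m b e = 0)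
    (h15 : m b f = 0) (h22 : m c c = 0) (h23 : m c d = 1) (h24 : m c e = 1) (h25 : m c f = 1)
    (h33 : m d d = 0) (h34 : m d e = 1) (h35 : m d f = 1) (h44 : m e e = 0) (h45 : m e f = 1)
    (h55 : m f f = 0) :
    IsBase V m := by
  refine ⟨Graph.simpleBaseGraphs[2]'(by decide), List.mem_append_left _ (List.getElem_mem _),
    realizes_of_le (n := 6) hm _ ![a, b, c, d, e, f] (by simp [hV, Fin.univ_succ]) hc
      fun i j hij => ?_⟩
  fin_cases i <;> fin_cases j <;> first | exact absurd hij (by decide) | assumption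

theorem isBase_two_K4 (hm : ∀ x y, m x y = m y x) {a b c d e f g : α}
    (hV : V = {a, b, c, d, e, f, g}) (hc : V.card = 7)
    (h00 : m a a = 0) (h01 : m a b = 1) (h02 : m a c = 1) (h03 : m a d = 1) (h04 : m a e = 1)
    (h05 : m a f = 0) (h06 : m a g = 0) (h11 : m b b = 0) (h12 : m b c = 1) (h13 : m b d = 1)
    (h14 : m b e = 0) (h15 : m b f = 0) (h16 : m b g = 0) (h22 : m c c = 0) (h23 : m c d = 1)
    (h24 : m c e = 1) (h25 : m c f = 1) (h26 : m c g = 1) (h33 : m d d = 0) (h34 : m d e = 0)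
    (h35 : m d f = 0) (h36 : m d g = 1) (h44 : m e e = 0) (h45 : m e f = 1) (h46 : m e g = 1)
    (h55 : m f f = 0) (h56 : m f g = 1) (h66 : m g g = 0) :
    IsBase V m := by
  refine ⟨Graph.simpleBaseGraphs[5]'(by decide), List.mem_append_left _ (List.getElem_mem _),
    realizes_of_le (n := 7) hm _ ![a, b, c, d, e, f, g] (by simp [hV, Fin.univ_succ]) hc
      fun i j hij => ?_⟩
  fin_cases i <;> fin_cases j <;> first | exact absurd hij (by decide) | assumption

end

/-! ### Circuits on four or five vertices -/

namespace IsThreeConnCircuit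
variable {V : Finset α} {m : α → α → ℕ} {X Y S : Finset α} {v w : α}

theorem nbrs_eq_one (h : IsThreeConnCircuit V m) (hv : IsNode V m v) {x : α}
    (hx : x ∈ nbrs V m v) : m v x = 1 := by
  have := h.node_multiple v hv.1 hv.2 x
  have := (mem_nbrs.1 hx).2
  omega

theorem loop_le_one (h : IsThreeConnCircuit V m) (hv : v ∈ V) : m v v ≤ 1 := by
  have h4 := h.four_le_card
  have := h.slack_pos {v} ⟨by simpa, fun hh => by
    have := Finset.card_le_card hh; simp at this; omega⟩ (by simp)
  rw [slack_singleton h.symm] at this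
  omega

set_option maxHeartbeats 1000000 in
-- Each vertex has three neighbours, so the graph is `K₄` plus two edges, neither of which touches
-- the node. Doubling two disjoint edges is therefore not among the cases.
theorem isBase_of_card_four (h : IsThreeConnCircuit V m) (hc : V.card = 4)
    (hv : IsNode V m v) : IsBase V m := by
  obtain ⟨x, y, z, hxy, hxz, hyz, hvx, hvy, hvz, hN⟩ := h.exists_nbrs_eq hv
  have hVe : V = {v, x, y, z} := by
    rw [← Finset.eq_of_subset_of_card_le (closedNbrs_subset (m := m) hv.1)
      (by rw [h.card_closedNbrs hv, hc]), closedNbrs, hN]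
  have hadj : ∀ a ∈ V, ∀ b ∈ V, a ≠ b → m a b ≠ 0 := fun a ha b hb hab => by
    have h1 : (nbrs V m a).erase a ⊆ V.erase a := Finset.erase_subset_erase _ nbrs_subset
    have h2 := Finset.eq_of_subset_of_card_le h1 (by
      rw [Finset.card_erase_of_mem ha, hc]
      exact h.three_le_card_nbrs ha)
    have h3 : b ∈ (nbrs V m a).erase a := by rw [h2]; simp [hab.symm, hb]
    exact (mem_nbrs.1 (Finset.mem_of_mem_erase h3)).2
  have hx : x ∈ V := by simp [hVe]
  have hy : y ∈ V := by simp [hVe]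
  have hz : z ∈ V := by simp [hVe]
  have hs := slack_quad h.symm hvx hvy hvz hxy hxz hyz
  rw [← hVe, h.slack_eq_zero] at hs
  have vv := h.node_loop v hv.1 hv.2
  have vx := h.nbrs_eq_one hv (x := x) (by simp [hN])
  have vy := h.nbrs_eq_one hv (x := y) (by simp [hN])
  have vz := h.nbrs_eq_one hv (x := z) (by simp [hN])
  have xv := h.symm x v
  have yv := h.symm y v
  have zv := h.symm z v
  have yx := h.symm y x
  have zx := h.symm z x
  have zy := h.symm z y
  have axy := hadj x hx y hy hxy
  have axz := hadj x hx z hz hxz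
  have ayz := hadj y hy z hz hyz
  have lx := h.loop_le_one hx
  have ly := h.loop_le_one hy
  have lz := h.loop_le_one hz
  have perm : ∀ a b c d : α, (∀ t, (t = v ∨ t = x ∨ t = y ∨ t = z) ↔
      (t = a ∨ t = b ∨ t = c ∨ t = d)) → V = {a, b, c, d} := fun a b c d ht => by
    rw [hVe]
    ext t
    simpa only [Finset.mem_insert, Finset.mem_singleton] using ht t
  have loops : ∀ a b c, (∀ t, (t = v ∨ t = x ∨ t = y ∨ t = z) ↔
      (t = v ∨ t = a ∨ t = b ∨ t = c)) → m v a = 1 → m v b = 1 → m v c = 1 → m a a = 0 →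
      m b b = 1 → m c c = 1 → m a b = 1 → m a c = 1 → m b c = 1 → IsBase V m := by
    intros a b c ht _ _ _ _ _ _ _ _ _
    exact isBase_K4_two_loops h.symm (perm _ _ _ _ ht) hc (by assumption) (by assumption)
      (by assumption) (by assumption) (by assumption) (by assumption) (by assumption)
      (by assumption) (by assumption) (by assumption)
  have double : ∀ a b c, (∀ t, (t = v ∨ t = x ∨ t = y ∨ t = z) ↔
      (t = a ∨ t = v ∨ t = b ∨ t = c)) → m a v = 1 → m v b = 1 → m v c = 1 → m a a = 0 →
      m b b = 0 → m c c ≠ 0 → m a b + m a c + m b c + m c c = 5 → m a c = m c a → m b c = m c b →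
      m c c ≤ 1 → c ∈ V → m a c ≠ 0 → m b c ≠ 0 → IsBase V m := by
    intros a b c ht _ _ _ _ _ hcc _ _ _ _ hcV _ _
    -- A loop excludes multiple edges at `c`, so the other extra edge doubles `ab`.
    have l1 := h.loop_multiple c hcV hcc a
    have l2 := h.loop_multiple c hcV hcc b
    exact isBase_K4_loop_double h.symm (perm _ _ _ _ ht) hc (by assumption) (by assumption)
      (by omega) (by omega) vv (by assumption) (by assumption)
      (by assumption) (by omega) (by omega)
  have triple : ∀ a b c, (∀ t, (t = v ∨ t = x ∨ t = y ∨ t = z) ↔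
      (t = a ∨ t = v ∨ t = b ∨ t = c)) → m a v = 1 → m v b = 1 → m v c = 1 → m a a = 0 →
      m b b = 0 → m c c = 0 → m a b = 3 → m a c = 1 → m b c = 1 → IsBase V m := by
    intros a b c ht _ _ _ _ _ _ _ _ _
    exact isBase_K4_triple h.symm (perm _ _ _ _ ht) hc (by assumption) (by assumption)
      (by assumption) (by assumption) vv (by assumption) (by assumption)
      (by assumption) (by assumption) (by assumption)
  have path : ∀ a b c, (∀ t, (t = v ∨ t = x ∨ t = y ∨ t = z) ↔
      (t = a ∨ t = v ∨ t = b ∨ t = c)) → m a v = 1 → m v b = 1 → m v c = 1 → m a a = 0 →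
      m b b = 0 → m c c = 0 → m a b = 2 → m a c = 1 → m b c = 2 → IsBase V m := by
    intros a b c ht _ _ _ _ _ _ _ _ _
    exact isBase_K4_double_path h.symm (perm _ _ _ _ ht) hc (by assumption) (by assumption)
      (by assumption) (by assumption) vv (by assumption) (by assumption)
      (by assumption) (by assumption) (by assumption)
  rcases Nat.eq_zero_or_pos (m x x) with xx | xx <;>
    rcases Nat.eq_zero_or_pos (m y y) with yy | yy <;>
    rcases Nat.eq_zero_or_pos (m z z) with zz | zz
  · have hsum : m x y + m x z + m y z = 5 := by omega
    clear hs
    rcases (show m x y = 1 ∨ m x y = 2 ∨ m x y = 3 by omega) with h1 | h1 | h1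
    · rcases (show m x z = 1 ∨ m x z = 2 ∨ m x z = 3 by omega) with h2 | h2 | h2
      · exact triple y z x (by clear * -; tauto) (by omega) vz vx yy zz xx (by omega) (by omega)
          (by omega)
      · exact path x z y (by clear * -; tauto) (by omega) vz vy xx zz yy h2 h1 (by omega)
      · exact triple x z y (by clear * -; tauto) (by omega) vz vy xx zz yy h2 h1 (by omega)
    · rcases (show m x z = 1 ∨ m x z = 2 by omega) with h2 | h2
      · exact path x y z (by clear * -; tauto) (by omega) vy vz xx yy zz h1 h2 (by omega)
      · exact path y x z (by clear * -; tauto) (by omega) vx vz yy xx zz (by omega) (by omega) h2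
    · exact triple x y z (by clear * -; tauto) (by omega) vy vz xx yy zz h1 (by omega) (by omega)
  · exact double x y z (by clear * -; tauto) (by omega) vy vz xx yy zz.ne' (by omega) (by omega) (by omega)
      lz hz axz ayz
  · exact double x z y (by clear * -; tauto) (by omega) vz vy xx zz yy.ne' (by omega) (by omega) (by omega)
      ly hy axy (by omega)
  · exact loops x y z (by clear * -; tauto) vx vy vz xx (by omega) (by omega) (by omega) (by omega) (by omega)
  · exact double y z x (by clear * -; tauto) (by omega) vz vx yy zz xx.ne' (by omega) (by omega) (by omega)
      lx hx (by omega) (by omega)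
  · exact loops y x z (by clear * -; tauto) vy vx vz yy (by omega) (by omega) (by omega) (by omega) (by omega)
  · exact loops z x y (by clear * -; tauto) vz vx vy zz (by omega) (by omega) (by omega) (by omega) (by omega)
  · omega

set_option maxHeartbeats 1000000 in
theorem isBase_of_card_five (h : IsThreeConnCircuit V m) (hna : NoAdmissible V m)
    (hc : V.card = 5) (hv : IsNode V m v) : IsBase V m := by
  have hcK := h.card_closedNbrs hv
  have hKV := closedNbrs_subset (m := m) hv.1
  obtain ⟨u, hu⟩ := Finset.card_eq_one.1 (show (V \ closedNbrs V m v).card = 1 by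
    rw [Finset.card_sdiff_of_subset hKV]; omega)
  have huV : u ∈ V ∧ u ∉ closedNbrs V m v := Finset.mem_sdiff.1 (by simp [hu])
  obtain ⟨x, y, z, hxy, hxz, hyz, hvx, hvy, hvz, hN⟩ := h.exists_nbrs_eq hv
  have hVe : V = {u, v, x, y, z} := by
    rw [← Finset.sdiff_union_of_subset hKV, hu, closedNbrs, hN]
    rfl
  rw [closedNbrs, hN] at huV
  obtain ⟨huV, hun⟩ := huV
  simp only [Finset.mem_insert, Finset.mem_singleton, not_or] at hun
  obtain ⟨huv, hux, huy, huz⟩ := hun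
  have hx : x ∈ nbrs V m v := by simp [hN]
  have hy : y ∈ nbrs V m v := by simp [hN]
  have hz : z ∈ nbrs V m v := by simp [hN]
  have vu : m v u = 0 := by
    by_contra hh
    have : u ∈ nbrs V m v := mem_nbrs.2 ⟨huV, hh⟩
    rw [hN] at this
    simp [hux, huy, huz] at this
  -- At a claw node, a neighbour could be adjacent only to `u` and `v`, contradicting
  -- 3-connectedness.
  have hclique : IsCliqueNode V m v := by
    refine (h.clique_or_claw hna (by omega) hv).resolve_right fun hcl => ?_
    have h1 := h.three_le_card_nbrs (nbrs_subset hx)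
    have h2 : (nbrs V m x).erase x ⊆ {u, v} := fun t ht => by
      obtain ⟨htx, ht⟩ := Finset.mem_erase.1 ht
      have ht' := nbrs_subset ht
      have e1 := hcl.2 x hx y hy hxy
      have e2 := hcl.2 x hx z hz hxz
      rw [hVe] at ht'
      simp only [Finset.mem_insert, Finset.mem_singleton] at ht' ⊢
      rcases ht' with rfl | rfl | rfl | rfl | rfl
      · simp
      · simp
      · exact absurd rfl htx
      · exact absurd e1 (mem_nbrs.1 ht).2
      · exact absurd e2 (mem_nbrs.1 ht).2
    have h3 := (Finset.card_le_card h2).trans Finset.card_le_two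
    omega
  have hNu : (nbrs V m u).erase u = {x, y, z} := by
    refine Finset.eq_of_subset_of_card_le (fun t ht => ?_)
      (Finset.card_le_three.trans (h.three_le_card_nbrs huV))
    obtain ⟨htu, ht⟩ := Finset.mem_erase.1 ht
    have ht' := nbrs_subset ht
    rw [hVe] at ht'
    simp only [Finset.mem_insert, Finset.mem_singleton] at ht' ⊢
    rcases ht' with rfl | rfl | ht'
    · exact absurd rfl htu
    · exact absurd (h.symm u t ▸ vu) (mem_nbrs.1 ht).2
    · exact ht'
  have uadj : ∀ t ∈ ({x, y, z} : Finset α), m u t ≠ 0 := fun t ht =>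
    (mem_nbrs.1 (Finset.mem_of_mem_erase (hNu ▸ ht))).2
  have aux := uadj x (by simp)
  have auy := uadj y (by simp)
  have auz := uadj z (by simp)
  have axy := hclique.2 x hx y hy hxy
  have axz := hclique.2 x hx z hz hxz
  have ayz := hclique.2 y hy z hz hyz
  have hs := slack_quad h.symm hvx hvy hvz hxy hxz hyz
  have hs' := h.slack_eq_zero
  rw [hVe, slack_insert h.symm (by simp [*]), hs, between_singleton_left,
    Finset.sum_insert (by simp [*]), Finset.sum_insert (by simp [*]),
    Finset.sum_pair hyz] at hs'
  have vv := h.node_loop v hv.1 hv.2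
  have vx := h.nbrs_eq_one hv hx
  have vy := h.nbrs_eq_one hv hy
  have vz := h.nbrs_eq_one hv hz
  have xv := h.symm x v
  have yv := h.symm y v
  have zv := h.symm z v
  have yx := h.symm y x
  have zx := h.symm z x
  have zy := h.symm z y
  have uv := h.symm u v
  have xu := h.symm x u
  have yu := h.symm y u
  have zu := h.symm z u
  have perm : ∀ a b c d e : α, (∀ t, (t = u ∨ t = v ∨ t = x ∨ t = y ∨ t = z) ↔
      (t = a ∨ t = b ∨ t = c ∨ t = d ∨ t = e)) → V = {a, b, c, d, e} := fun a b c d e ht => by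
    rw [hVe]
    ext t
    simpa only [Finset.mem_insert, Finset.mem_singleton] using ht t
  -- `K₅` minus `uv` has nine of the ten edges, so exactly one edge is extra.
  rcases (show m u u = 1 ∨ m x x = 1 ∨ m y y = 1 ∨ m z z = 1 ∨ m x y = 2 ∨ m x z = 2 ∨ m y z = 2 ∨
    m u x = 2 ∨ m u y = 2 ∨ m u z = 2 by omega) with e | e | e | e | e | e | e | e | e | e
  · apply isBase_K5_loop_outer h.symm (perm u x y z v (by clear * -; tauto)) hc <;> omega
  · apply isBase_K5_loop_inner h.symm (perm v y x z u (by clear * -; tauto)) hc <;> omega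
  · apply isBase_K5_loop_inner h.symm (perm v x y z u (by clear * -; tauto)) hc <;> omega
  · apply isBase_K5_loop_inner h.symm (perm v x z y u (by clear * -; tauto)) hc <;> omega
  · apply isBase_K5_double_inner h.symm (perm v z x y u (by clear * -; tauto)) hc <;> omega
  · apply isBase_K5_double_inner h.symm (perm v y x z u (by clear * -; tauto)) hc <;> omega
  · apply isBase_K5_double_inner h.symm (perm v x y z u (by clear * -; tauto)) hc <;> omega
  · apply isBase_K5_double_outer h.symm (perm v y z x u (by clear * -; tauto)) hc <;> omega
  · apply isBase_K5_double_outer h.symm (perm v x z y u (by clear * -; tauto)) hc <;> omega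
  · apply isBase_K5_double_outer h.symm (perm v x y z u (by clear * -; tauto)) hc <;> omega

end IsThreeConnCircuit

/-! ### No proper critical set: overlapping closed neighbourhoods -/

namespace IsThreeConnCircuit
variable {V : Finset α} {m : α → α → ℕ} {X Y S : Finset α} {v w : α}

section noCritical
variable (h : IsThreeConnCircuit V m) (hna : NoAdmissible V m) (h6 : 6 ≤ V.card)
  (hnc : ∀ X ⊆ V, X.Nonempty → X.card + 2 ≤ V.card → 2 ≤ slack m X)
include h hna h6 hnc

/-- A blocking set at a claw node misses the node and one neighbour, so it would be a proper
critical set. -/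
theorem clique_of_noCritical (hv : IsNode V m v) : IsCliqueNode V m v := by
  refine (h.clique_or_claw hna (by omega) hv).resolve_right fun hcl => ?_
  obtain ⟨hN, hvN, -⟩ := h.node_nbrs hv
  obtain ⟨x, hx⟩ := Finset.card_pos.1 (show 0 < (nbrs V m v).card by omega)
  obtain ⟨P, hP, hvP, hxP, hNP, hsP⟩ := h.exists_claw_blocker hna hcl hx
  have h1 : P ⊆ (V.erase x).erase v := by grind
  have h2 := Finset.card_le_card h1
  have hxv : x ≠ v := fun he => hvN (he ▸ hx)
  rw [Finset.card_erase_of_mem (by simp [hxv.symm, hv.1]),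
    Finset.card_erase_of_mem (nbrs_subset hx)] at h2
  have h3 := Finset.card_le_card hNP
  rw [Finset.card_erase_of_mem hx, hN] at h3
  have := hnc P hP (Finset.card_pos.1 (by omega)) (by omega)
  omega

theorem not_mem_nbrs_of_noCritical (hv : IsNode V m v) (hw : IsNode V m w) :
    w ∉ nbrs V m v := fun hh => (mem_nbrs.1 hh).2 (h.clique_not_adj (by omega)
  (h.clique_of_noCritical hna h6 hnc hv) (h.clique_of_noCritical hna h6 hnc hw))

theorem slack_closedNbrs_of_noCritical (hv : IsNode V m v) :
    slack m (closedNbrs V m v) = 2 ∧ ∀ a ∈ closedNbrs V m v, ∀ b ∈ closedNbrs V m v,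
      m a b = if a = b then 0 else 1 := by
  have h1 := hnc _ (closedNbrs_subset hv.1) (by simp [closedNbrs])
    (by rw [h.card_closedNbrs hv]; omega)
  obtain ⟨h2, h3⟩ := h.slack_closedNbrs (h.clique_of_noCritical hna h6 hnc hv)
  exact ⟨by omega, h3 h1⟩

theorem loop_eq_zero (hv : v ∈ V) : m v v = 0 := by
  have h1 := hnc {v} (by simpa) (by simp) (by simp; omega)
  rw [slack_singleton h.symm] at h1
  omega

theorem closedNbrs_inter (hv : IsNode V m v) (hw : IsNode V m w) (hvw : v ≠ w) :
    closedNbrs V m v ∩ closedNbrs V m w = nbrs V m v ∩ nbrs V m w := by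
  have h1 := h.not_mem_nbrs_of_noCritical hna h6 hnc hv hw
  have h2 := h.not_mem_nbrs_of_noCritical hna h6 hnc hw hv
  ext t
  simp only [closedNbrs, Finset.mem_inter, Finset.mem_insert]
  constructor
  · rintro ⟨rfl | ht, rfl | ht'⟩
    exacts [absurd rfl hvw, absurd ht' h2, absurd ht h1, ⟨ht, ht'⟩]
  · exact fun ht => ⟨.inr ht.1, .inr ht.2⟩

theorem two_slack_inter (hv : IsNode V m v) :
    2 * slack m (nbrs V m v ∩ nbrs V m w) = 5 * (nbrs V m v ∩ nbrs V m w).card -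
      (nbrs V m v ∩ nbrs V m w).card * (nbrs V m v ∩ nbrs V m w).card := by
  have h1 := (h.slack_closedNbrs_of_noCritical hna h6 hnc hv).2
  have hsub : nbrs V m v ∩ nbrs V m w ⊆ closedNbrs V m v :=
    Finset.inter_subset_left.trans (Finset.subset_insert _ _)
  exact two_slack_of_simple h.symm fun a ha b hb => h1 a (hsub ha) b (hsub hb)

theorem card_union_closedNbrs (hv : IsNode V m v) (hw : IsNode V m w) (hvw : v ≠ w) :
    (closedNbrs V m v ∪ closedNbrs V m w).card + (nbrs V m v ∩ nbrs V m w).card = 8 := by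
  rw [← h.closedNbrs_inter hna h6 hnc hv hw hvw, Finset.card_union_add_card_inter,
    h.card_closedNbrs hv, h.card_closedNbrs hw]

theorem slack_union_two (hv : IsNode V m v) (hw : IsNode V m w) (hvw : v ≠ w) :
    slack m (closedNbrs V m v ∪ closedNbrs V m w) + slack m (nbrs V m v ∩ nbrs V m w) =
      4 - between m (closedNbrs V m v \ closedNbrs V m w)
        (closedNbrs V m w \ closedNbrs V m v) := by
  rw [← h.closedNbrs_inter hna h6 hnc hv hw hvw, slack_union_add_inter h.symm,
    (h.slack_closedNbrs_of_noCritical hna h6 hnc hv).1,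
    (h.slack_closedNbrs_of_noCritical hna h6 hnc hw).1]
  norm_num

/-- If two closed neighbourhoods share at least two vertices, then at most one vertex is left. -/
theorem card_le_of_two_le_inter (hv : IsNode V m v) (hw : IsNode V m w) (hvw : v ≠ w)
    (hi : 2 ≤ (nbrs V m v ∩ nbrs V m w).card) :
    slack m (closedNbrs V m v ∪ closedNbrs V m w) ≤ 1 ∧
      V.card + (nbrs V m v ∩ nbrs V m w).card ≤ 9 := by
  have h1 := h.two_slack_inter hna h6 hnc hv (w := w)
  have h2 := h.card_union_closedNbrs hna h6 hnc hv hw hvw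
  have h3 := h.slack_union_two hna h6 hnc hv hw hvw
  have h4 := between_nonneg (m := m) (closedNbrs V m v \ closedNbrs V m w)
    (closedNbrs V m w \ closedNbrs V m v)
  have h5 := Finset.card_le_card (Finset.inter_subset_left (s₁ := nbrs V m v) (s₂ := nbrs V m w))
  rw [(h.node_nbrs hv).1] at h5
  -- `K₂` and `K₃` both have slack 3.
  have h7 : slack m (nbrs V m v ∩ nbrs V m w) = 3 := by
    generalize (nbrs V m v ∩ nbrs V m w).card = n at *
    interval_cases n <;> omega
  have h8 : slack m (closedNbrs V m v ∪ closedNbrs V m w) ≤ 1 := by omega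
  refine ⟨h8, ?_⟩
  by_contra! hgt
  have := hnc _ (Finset.union_subset (closedNbrs_subset (m := m) hv.1)
    (closedNbrs_subset (m := m) hw.1)) (by simp [closedNbrs]) (by omega)
  omega

/-- The union of the closed neighbourhoods has slack at most 1 and misses one vertex, which is thus
a node; it is not adjacent to the nodes `v` and `w`. -/
theorem exists_last_node (hv : IsNode V m v) (hw : IsNode V m w) (hvw : v ≠ w)
    (hi : 2 ≤ (nbrs V m v ∩ nbrs V m w).card)
    (hV : V.card + (nbrs V m v ∩ nbrs V m w).card = 9) :
    ∃ u, IsNode V m u ∧ V \ (closedNbrs V m v ∪ closedNbrs V m w) = {u} ∧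
      u ∉ closedNbrs V m v ∧ u ∉ closedNbrs V m w ∧
      nbrs V m u ⊆ nbrs V m v ∪ nbrs V m w := by
  have h1 := (h.card_le_of_two_le_inter hna h6 hnc hv hw hvw hi).1
  have h2 := h.card_union_closedNbrs hna h6 hnc hv hw hvw
  have hsub := Finset.union_subset (closedNbrs_subset (m := m) hv.1)
    (closedNbrs_subset (m := m) hw.1)
  obtain ⟨u, hu⟩ := Finset.card_eq_one.1
    (show (V \ (closedNbrs V m v ∪ closedNbrs V m w)).card = 1 by
      rw [Finset.card_sdiff_of_subset hsub]; omega)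
  have huV : u ∈ V ∧ u ∉ closedNbrs V m v ∪ closedNbrs V m w := Finset.mem_sdiff.1 (by simp [hu])
  have hun : IsNode V m u := h.isNode_of_slack_sdiff huV.1 (by
    rwa [← hu, Finset.sdiff_sdiff_eq_self hsub])
  have huV' := huV.2
  rw [Finset.mem_union, not_or] at huV'
  refine ⟨u, hun, hu, huV'.1, huV'.2, fun t ht => ?_⟩
  by_contra hn
  have e1 := (h.node_nbrs hun).2.1
  have e2 := h.not_mem_nbrs_of_noCritical hna h6 hnc hun hv
  have e3 := h.not_mem_nbrs_of_noCritical hna h6 hnc hun hw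
  have htu : t ≠ u := fun he => e1 (he ▸ ht)
  have htv : t ≠ v := fun he => e2 (he ▸ ht)
  have htw : t ≠ w := fun he => e3 (he ▸ ht)
  have : t ∈ V \ (closedNbrs V m v ∪ closedNbrs V m w) := by
    simp only [closedNbrs, Finset.mem_sdiff, Finset.mem_union, Finset.mem_insert] at hn ⊢
    exact ⟨nbrs_subset ht, by tauto⟩
  rw [hu] at this
  exact htu (Finset.mem_singleton.1 this)

/-- The last node has the same three neighbours, so three independent nodes are joined to a
triangle: `K₆` minus a triangle. -/
theorem isBase_of_nbrs_eq (hv : IsNode V m v) (hw : IsNode V m w) (hvw : v ≠ w)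
    (hN : nbrs V m w = nbrs V m v) : IsBase V m := by
  have hi : (nbrs V m v ∩ nbrs V m w).card = 3 := by
    rw [hN, Finset.inter_self, (h.node_nbrs hv).1]
  have hc := (h.card_le_of_two_le_inter hna h6 hnc hv hw hvw (by omega)).2
  obtain ⟨u, hu, huV, hu1, hu2, hu3⟩ :=
    h.exists_last_node hna h6 hnc hv hw hvw (by omega) (by omega)
  rw [hN, Finset.union_self] at hu3
  have hNu := Finset.eq_of_subset_of_card_le hu3 (by
    rw [(h.node_nbrs hu).1, (h.node_nbrs hv).1])
  have hVe : V = insert v (insert w (insert u (nbrs V m v))) := by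
    have e := Finset.sdiff_union_of_subset (Finset.union_subset (closedNbrs_subset (m := m) hv.1)
      (closedNbrs_subset (m := m) hw.1))
    rw [huV, closedNbrs, closedNbrs, hN] at e
    refine e.symm.trans ?_
    ext t
    simp only [Finset.mem_union, Finset.mem_insert, Finset.mem_singleton]
    clear * -
    tauto
  obtain ⟨x, y, z, hxy, hxz, hyz, -, -, -, hNe⟩ := h.exists_nbrs_eq hv
  have hadj := (h.slack_closedNbrs_of_noCritical hna h6 hnc hv).2
  have hmem : ∀ t ∈ ({x, y, z} : Finset α), t ∈ closedNbrs V m v ∧ m v t = 1 ∧ m w t = 1 ∧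
      m u t = 1 := fun t ht => by
    rw [← hNe] at ht
    exact ⟨Finset.mem_insert_of_mem ht, h.nbrs_eq_one hv ht, h.nbrs_eq_one hw (by rwa [hN]),
      h.nbrs_eq_one hu (by rwa [hNu])⟩
  obtain ⟨kx, vx, wx, ux⟩ := hmem x (by simp)
  obtain ⟨ky, vy, wy, uy⟩ := hmem y (by simp)
  obtain ⟨kz, vz, wz, uz⟩ := hmem z (by simp)
  have zero : ∀ a b, IsNode V m a → IsNode V m b → m a b = 0 := fun a b ha hb => by
    by_contra hh
    exact h.not_mem_nbrs_of_noCritical hna h6 hnc ha hb (mem_nbrs.2 ⟨hb.1, hh⟩)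
  have xx := hadj x kx x kx
  have yy := hadj y ky y ky
  have zz := hadj z kz z kz
  have xy := hadj x kx y ky
  have xz := hadj x kx z kz
  have yz := hadj y ky z kz
  simp only [if_true, if_neg hxy, if_neg hxz, if_neg hyz] at xx yy zz xy xz yz
  have xw := h.symm x w
  have yw := h.symm y w
  have zw := h.symm z w
  have xu := h.symm x u
  have yu := h.symm y u
  have zu := h.symm z u
  rw [hNe] at hVe
  exact isBase_K6_triangle h.symm (a := v) (b := x) (c := w) (d := y) (e := z) (f := u)
    (by
      refine hVe.trans ?_
      ext t
      simp only [Finset.mem_insert, Finset.mem_singleton]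
      clear * -
      tauto) (by omega) (zero v v hv hv) vx (zero v w hv hw) vy vz (zero v u hv hu) xx
    (by omega) xy xz (by omega) (zero w w hw hw) wy wz (zero w u hw hu) yy yz (by omega) zz
    (by omega) (zero u u hu hu)

/-- With private neighbours `x` of `v` and `y` of `w`, the union of the closed neighbourhoods has
slack `1 - m x y`. On six vertices `xy` is an edge and the graph is `K₆` minus the path `y, v, w,
x`. On seven, `xy` is not an edge, so the last node, being a clique node, has the same neighbours as
`v` or `w`; that forces at most six vertices. -/
theorem isBase_of_two_le_inter (hv : IsNode V m v) (hw : IsNode V m w) (hvw : v ≠ w)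
    (hi : 2 ≤ (nbrs V m v ∩ nbrs V m w).card) : IsBase V m := by
  have hNv := (h.node_nbrs hv).1
  have hNw := (h.node_nbrs hw).1
  have hle := Finset.card_le_card
    (Finset.inter_subset_left (s₁ := nbrs V m v) (s₂ := nbrs V m w))
  by_cases hi3 : (nbrs V m v ∩ nbrs V m w).card = 3
  · have e1 := Finset.eq_of_subset_of_card_le
      (Finset.inter_subset_left (s₁ := nbrs V m v) (s₂ := nbrs V m w)) (by omega)
    have e2 := Finset.eq_of_subset_of_card_le
      (Finset.inter_subset_right (s₁ := nbrs V m v) (s₂ := nbrs V m w)) (by omega)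
    exact h.isBase_of_nbrs_eq hna h6 hnc hv hw hvw (e2.symm.trans e1)
  have hi2 : (nbrs V m v ∩ nbrs V m w).card = 2 := by omega
  have hc := (h.card_le_of_two_le_inter hna h6 hnc hv hw hvw hi).2
  have hsu := h.slack_union_two hna h6 hnc hv hw hvw
  have hsi := h.two_slack_inter hna h6 hnc hv (w := w)
  have hcu := h.card_union_closedNbrs hna h6 hnc hv hw hvw
  rw [hi2] at hsi hcu
  obtain ⟨a, b, hab, hNab⟩ := Finset.card_eq_two.1 hi2
  have hsd := Finset.card_sdiff_add_card_inter (nbrs V m v) (nbrs V m w)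
  have hsd' := Finset.card_sdiff_add_card_inter (nbrs V m w) (nbrs V m v)
  rw [Finset.inter_comm] at hsd'
  obtain ⟨x, hx⟩ := Finset.card_eq_one.1 (show (nbrs V m v \ nbrs V m w).card = 1 by omega)
  obtain ⟨y, hy⟩ := Finset.card_eq_one.1 (show (nbrs V m w \ nbrs V m v).card = 1 by omega)
  have hxm : x ∈ nbrs V m v ∧ x ∉ nbrs V m w := Finset.mem_sdiff.1 (by simp [hx])
  have hym : y ∈ nbrs V m w ∧ y ∉ nbrs V m v := Finset.mem_sdiff.1 (by simp [hy])
  have ham : a ∈ nbrs V m v ∧ a ∈ nbrs V m w := Finset.mem_inter.1 (by simp [hNab])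
  have hbm : b ∈ nbrs V m v ∧ b ∈ nbrs V m w := Finset.mem_inter.1 (by simp [hNab])
  have eNv : nbrs V m v = {x, a, b} := by
    rw [← Finset.sdiff_union_inter (nbrs V m v) (nbrs V m w), hx, hNab]
    rfl
  have eNw : nbrs V m w = {y, a, b} := by
    rw [← Finset.sdiff_union_inter (nbrs V m w) (nbrs V m v), hy, Finset.inter_comm, hNab]
    rfl
  have hxV := nbrs_subset hxm.1
  have hyV := nbrs_subset hym.1
  have hwv := h.not_mem_nbrs_of_noCritical hna h6 hnc hv hw
  have hvw' := h.not_mem_nbrs_of_noCritical hna h6 hnc hw hv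
  have hvN := (h.node_nbrs hv).2.1
  have hwN := (h.node_nbrs hw).2.1
  have hxw : x ≠ w := fun he => hwv (he ▸ hxm.1)
  have hyv : y ≠ v := fun he => hvw' (he ▸ hym.1)
  have hvx : v ≠ x := fun he => hvN (he ▸ hxm.1)
  have hwy : w ≠ y := fun he => hwN (he ▸ hym.1)
  have d1 : closedNbrs V m v \ closedNbrs V m w = {v, x} := by
    ext t
    simp only [closedNbrs, Finset.mem_sdiff, Finset.mem_insert, Finset.mem_singleton]
    constructor
    · rintro ⟨rfl | ht, hn⟩
      · exact .inl rfl
      · right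
        have : t ∈ nbrs V m v \ nbrs V m w := Finset.mem_sdiff.2 ⟨ht, fun hh => hn (.inr hh)⟩
        rw [hx] at this
        exact Finset.mem_singleton.1 this
    · rintro (rfl | rfl)
      · exact ⟨.inl rfl, by tauto⟩
      · exact ⟨.inr hxm.1, by tauto⟩
  have d2 : closedNbrs V m w \ closedNbrs V m v = {w, y} := by
    ext t
    simp only [closedNbrs, Finset.mem_sdiff, Finset.mem_insert, Finset.mem_singleton]
    constructor
    · rintro ⟨rfl | ht, hn⟩
      · exact .inl rfl
      · right
        have : t ∈ nbrs V m w \ nbrs V m v := Finset.mem_sdiff.2 ⟨ht, fun hh => hn (.inr hh)⟩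
        rw [hy] at this
        exact Finset.mem_singleton.1 this
    · rintro (rfl | rfl)
      · exact ⟨.inl rfl, fun hh => by rcases hh with hh | hh; exacts [hvw hh.symm, hwv hh]⟩
      · exact ⟨.inr hym.1, by tauto⟩
  have zero : ∀ {p q}, q ∈ V → q ∉ nbrs V m p → m p q = 0 := fun {p q} hq hn => by
    by_contra hh
    exact hn (mem_nbrs.2 ⟨hq, hh⟩)
  have vw := zero hw.1 hwv
  have vy := zero hyV hym.2
  have wx := zero hxV hxm.2
  have xw := h.symm x w
  have hb : between m {v, x} {w, y} = m x y := by
    rw [between_insert_left (by simpa using hvx), between_insert_right (by simpa using hwy),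
      between_insert_right (by simpa using hwy)]
    simp only [between_singleton]
    omega
  rw [d1, d2, hb] at hsu
  rcases (show V.card = 6 ∨ V.card = 7 by omega) with hc6 | hc7
  · have hVe : closedNbrs V m v ∪ closedNbrs V m w = V := Finset.eq_of_subset_of_card_le
      (Finset.union_subset (closedNbrs_subset hv.1) (closedNbrs_subset hw.1)) (by omega)
    rw [hVe, h.slack_eq_zero] at hsu
    have hVe' : V = {y, w, a, b, x, v} := by
      rw [← hVe, closedNbrs, closedNbrs, eNv, eNw]
      ext t
      simp only [Finset.mem_union, Finset.mem_insert, Finset.mem_singleton]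
      clear * -
      tauto
    have kv := (h.slack_closedNbrs_of_noCritical hna h6 hnc hv).2
    have kw := (h.slack_closedNbrs_of_noCritical hna h6 hnc hw).2
    have one : ∀ {p q}, p ∈ nbrs V m v → q ∈ nbrs V m v → p ≠ q → m p q = 1 :=
      fun {p q} hp hq hpq => by
        rw [kv p (Finset.mem_insert_of_mem hp) q (Finset.mem_insert_of_mem hq), if_neg hpq]
    have one' : ∀ {p q}, p ∈ nbrs V m w → q ∈ nbrs V m w → p ≠ q → m p q = 1 :=
      fun {p q} hp hq hpq => by
        rw [kw p (Finset.mem_insert_of_mem hp) q (Finset.mem_insert_of_mem hq), if_neg hpq]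
    have loop := fun {t} => h.loop_eq_zero hna h6 hnc (v := t)
    have hxa : x ≠ a := fun he => hxm.2 (he ▸ ham.2)
    have hxb : x ≠ b := fun he => hxm.2 (he ▸ hbm.2)
    have hya : y ≠ a := fun he => hym.2 (he ▸ ham.1)
    have hyb : y ≠ b := fun he => hym.2 (he ▸ hbm.1)
    have sym := h.symm
    have n1 := fun {t} => h.nbrs_eq_one hv (x := t)
    have n2 := fun {t} => h.nbrs_eq_one hw (x := t)
    exact isBase_K6_path h.symm hVe' hc6 (loop hyV) (by rw [sym]; exact n2 hym.1)
      (one' hym.1 ham.2 hya) (one' hym.1 hbm.2 hyb) (by rw [sym]; omega) (by rw [sym]; exact vy)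
      (loop hw.1) (n2 ham.2) (n2 hbm.2) wx (by rw [sym]; exact vw) (loop (nbrs_subset ham.1))
      (one ham.1 hbm.1 hab) (one ham.1 hxm.1 hxa.symm) (by rw [sym]; exact n1 ham.1)
      (loop (nbrs_subset hbm.1)) (one hbm.1 hxm.1 hxb.symm) (by rw [sym]; exact n1 hbm.1)
      (loop hxV) (by rw [sym]; exact n1 hxm.1) (loop hv.1)
  · exfalso
    obtain ⟨u, hu, -, hu1, hu2, hu3⟩ :=
      h.exists_last_node hna h6 hnc hv hw hvw (by omega) (by omega)
    have hcuV : closedNbrs V m v ∪ closedNbrs V m w ⊂ V :=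
      ⟨Finset.union_subset (closedNbrs_subset hv.1) (closedNbrs_subset hw.1), fun hh => by
        have := Finset.card_le_card hh; omega⟩
    have hpos := h.slack_pos _ hcuV (by simp [closedNbrs])
    have hxy0 : m x y = 0 := by omega
    have hucl := h.clique_of_noCritical hna h6 hnc hu
    have hNu := (h.node_nbrs hu).1
    have hnxy : ¬ (x ∈ nbrs V m u ∧ y ∈ nbrs V m u) := fun hh =>
      hucl.2 x hh.1 y hh.2 (fun he => hxm.2 (he ▸ hym.1)) hxy0
    have key : ∀ {p}, IsNode V m p → u ∉ closedNbrs V m p → nbrs V m u ⊆ nbrs V m p → False := by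
      intro p hp hup hsub
      have he := Finset.eq_of_subset_of_card_le hsub (by rw [hNu, (h.node_nbrs hp).1])
      have hpu : p ≠ u := fun he => hup (he ▸ by simp [closedNbrs])
      have hcc : (nbrs V m p ∩ nbrs V m u).card = 3 := by rw [he, Finset.inter_self, ← he, hNu]
      have := (h.card_le_of_two_le_inter hna h6 hnc hp hu hpu (by omega)).2
      omega
    rw [eNv, eNw] at hu3
    by_cases hxu : x ∈ nbrs V m u
    · refine key hv hu1 fun t ht => ?_
      have ht' := hu3 ht
      have hty : t ≠ y := fun he => hnxy ⟨hxu, he ▸ ht⟩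
      rw [eNv]
      simp only [Finset.mem_union, Finset.mem_insert, Finset.mem_singleton] at ht' ⊢
      clear * - ht' hty
      tauto
    · refine key hw hu2 fun t ht => ?_
      have ht' := hu3 ht
      have htx : t ≠ x := fun he => hxu (he ▸ ht)
      rw [eNw]
      simp only [Finset.mem_union, Finset.mem_insert, Finset.mem_singleton] at ht' ⊢
      clear * - ht' htx
      tauto

end noCritical
end IsThreeConnCircuit

/-! ### No proper critical set: discharging when overlaps are at most single vertices -/

instance {V : Finset α} {m : α → α → ℕ} : DecidablePred (IsNode V m) := fun v =>
  inferInstanceAs (Decidable (v ∈ V ∧ deg V m v = 3))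

namespace IsThreeConnCircuit
variable {V : Finset α} {m : α → α → ℕ} {X Y S : Finset α} {v w : α}

section noCritical
variable (h : IsThreeConnCircuit V m) (hna : NoAdmissible V m) (h6 : 6 ≤ V.card)
  (hnc : ∀ X ⊆ V, X.Nonempty → X.card + 2 ≤ V.card → 2 ≤ slack m X)
include h hna h6 hnc

section discharging
variable (hess : ∀ S ⊆ V, 2 ≤ S.card → 2 ≤ (V \ S).card → 5 ≤ between m S (V \ S))
  (hint : ∀ v w, IsNode V m v → IsNode V m w → v ≠ w → (nbrs V m v ∩ nbrs V m w).card ≤ 1)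

theorem four_le_deg_of_mem_nbrs (hv : IsNode V m v) (hw : w ∈ nbrs V m v) : 4 ≤ deg V m w := by
  have h3 := h.three_le_deg (nbrs_subset hw)
  by_contra! hlt
  exact h.not_mem_nbrs_of_noCritical hna h6 hnc hv ⟨nbrs_subset hw, by omega⟩ hw

include hess in
-- The closed neighbourhood has slack 2 and a cut of at least five edges, so its total of `4 - deg`
-- is at most `-1`, while the node itself contributes `+1`.
theorem sum_nbrs_deg_sub_four (hv : IsNode V m v) :
    2 ≤ ∑ x ∈ nbrs V m v, (deg V m x - 4) := by
  have h1 := sum_four_sub_deg h.symm (closedNbrs_subset (m := m) hv.1)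
  have hc := h.card_closedNbrs hv
  have h2 := hess _ (closedNbrs_subset (m := m) hv.1) (by omega)
    (by rw [Finset.card_sdiff_of_subset (closedNbrs_subset hv.1)]; omega)
  rw [(h.slack_closedNbrs_of_noCritical hna h6 hnc hv).1] at h1
  nth_rw 1 [closedNbrs] at h1
  rw [Finset.sum_insert (h.node_nbrs hv).2.1, hv.2] at h1
  have h3 : ∑ x ∈ nbrs V m v, (deg V m x - 4) = - ∑ x ∈ nbrs V m v, (4 - deg V m x) := by
    rw [← Finset.sum_neg_distrib]
    exact Finset.sum_congr rfl fun _ _ => by ring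
  omega

include hint in
-- Each adjacent node, with its other two neighbours, gives three neighbours of `x`, and these
-- triples are disjoint for different nodes.
theorem three_mul_card_node_nbrs_le {x : α} (hx : x ∈ V) :
    3 * (((nbrs V m x).filter (IsNode V m)).card : ℤ) ≤ deg V m x := by
  refine le_trans ?_ (card_nbrs_le_deg hx)
  have hmem : ∀ v ∈ (nbrs V m x).filter (IsNode V m), IsNode V m v ∧ x ∈ nbrs V m v :=
    fun v hv => ⟨(Finset.mem_filter.1 hv).2, h.mem_nbrs_comm hx (Finset.mem_filter.1 hv).1⟩
  have hdisj : ∀ v ∈ (nbrs V m x).filter (IsNode V m), ∀ w ∈ (nbrs V m x).filter (IsNode V m),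
      v ≠ w → Disjoint ((closedNbrs V m v).erase x) ((closedNbrs V m w).erase x) := by
    intro v hv w hw hvw
    obtain ⟨hv1, hv2⟩ := hmem v hv
    obtain ⟨hw1, hw2⟩ := hmem w hw
    rw [Finset.disjoint_left]
    intro t ht ht'
    rw [Finset.mem_erase] at ht ht'
    have h1 : t ∈ nbrs V m v ∩ nbrs V m w := by
      rw [← h.closedNbrs_inter hna h6 hnc hv1 hw1 hvw]
      exact Finset.mem_inter.2 ⟨ht.2, ht'.2⟩
    exact ht.1 (Finset.card_le_one.1 (hint v w hv1 hw1 hvw) t h1 x (Finset.mem_inter.2 ⟨hv2, hw2⟩))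
  have hcard := Finset.card_biUnion hdisj
  rw [Finset.sum_const_nat (m := 3) fun v hv => ?_] at hcard
  · have hsub : ((nbrs V m x).filter (IsNode V m)).biUnion (fun v => (closedNbrs V m v).erase x) ⊆
        (nbrs V m x).erase x := by
      intro t ht
      obtain ⟨v, hv, ht⟩ := Finset.mem_biUnion.1 ht
      obtain ⟨hv1, hv2⟩ := hmem v hv
      rw [Finset.mem_erase] at ht ⊢
      refine ⟨ht.1, mem_nbrs.2 ⟨closedNbrs_subset hv1.1 ht.2, ?_⟩⟩
      exact h.closedNbrs_adj (h.clique_of_noCritical hna h6 hnc hv1)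
        (Finset.mem_insert_of_mem hv2) ht.2 ht.1.symm
    have := Finset.card_le_card hsub
    omega
  · obtain ⟨hv1, hv2⟩ := hmem v hv
    rw [Finset.card_erase_of_mem (show x ∈ closedNbrs V m v from Finset.mem_insert_of_mem hv2),
      h.card_closedNbrs hv1]

include hess hint in
/-- Discharging: the nodes take their charge from the vertices of degree at least five. -/
theorem discharge :
    (∀ v, IsNode V m v → ((nbrs V m v).filter (fun x => 5 ≤ deg V m x)).card = 1) ∧
      ∀ x ∈ V, 5 ≤ deg V m x → (((nbrs V m x).filter (IsNode V m)).card : ℤ) = deg V m x - 4 := by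
  set T := V.filter (IsNode V m) with hT
  set B := V.filter (fun x => 5 ≤ deg V m x) with hB
  have hdeg : (T.card : ℤ) = ∑ x ∈ B, (deg V m x - 4) := by
    have h0 := sum_four_sub_deg h.symm (subset_refl V)
    rw [h.slack_eq_zero, Finset.sdiff_self, between_empty_right] at h0
    have h1 : ∀ x ∈ V, (4 - deg V m x) = (if IsNode V m x then 1 else 0) -
        (if 5 ≤ deg V m x then deg V m x - 4 else 0) := by
      intro x hx
      have := h.three_le_deg hx
      simp only [IsNode, hx, true_and]
      split_ifs <;> omega
    rw [Finset.sum_congr rfl h1, Finset.sum_sub_distrib, ← Finset.sum_filter,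
      ← Finset.sum_filter] at h0
    simp only [Finset.sum_const, nsmul_eq_mul, mul_one] at h0
    linarith
  have hcount : ∑ v ∈ T, (((nbrs V m v).filter (fun x => 5 ≤ deg V m x)).card : ℤ) =
      ∑ x ∈ B, (((nbrs V m x).filter (IsNode V m)).card : ℤ) := by
    have e1 : ∀ v ∈ T, (((nbrs V m v).filter (fun x => 5 ≤ deg V m x)).card : ℤ) =
        ∑ x ∈ B, if m v x ≠ 0 then 1 else 0 := fun v _ => by
      rw [Finset.sum_boole, nbrs, hB, Finset.filter_comm]
    have e2 : ∀ x ∈ B, (((nbrs V m x).filter (IsNode V m)).card : ℤ) =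
        ∑ v ∈ T, if m v x ≠ 0 then 1 else 0 := fun x _ => by
      simp only [h.symm _ x]
      rw [Finset.sum_boole, nbrs, hT, Finset.filter_comm]
    rw [Finset.sum_congr rfl e1, Finset.sum_congr rfl e2, Finset.sum_comm]
  have l1 : ∀ v ∈ T, (1 : ℤ) ≤ ((nbrs V m v).filter (fun x => 5 ≤ deg V m x)).card := by
    intro v hv
    have h2 := h.sum_nbrs_deg_sub_four hna h6 hnc hess (Finset.mem_filter.1 hv).2
    have : ((nbrs V m v).filter (fun x => 5 ≤ deg V m x)).Nonempty := by
      by_contra hne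
      rw [Finset.not_nonempty_iff_eq_empty, Finset.filter_eq_empty_iff] at hne
      have := Finset.sum_nonpos (s := nbrs V m v) (f := fun x => deg V m x - 4)
        fun x hx => by have := hne hx; omega
      omega
    exact_mod_cast this.card_pos
  -- For integers with `d ≥ 5`, `3 * t ≤ d` implies `t ≤ d - 4`.
  have l2 : ∀ x ∈ B, (((nbrs V m x).filter (IsNode V m)).card : ℤ) ≤ deg V m x - 4 := by
    intro x hx
    obtain ⟨hx1, hx2⟩ := Finset.mem_filter.1 hx
    have := h.three_mul_card_node_nbrs_le hna h6 hnc hint hx1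
    omega
  have s1 := Finset.sum_le_sum l1
  have s2 := Finset.sum_le_sum l2
  simp only [Finset.sum_const, nsmul_eq_mul, mul_one] at s1
  -- The edges between `T` and `B` number at least `|T|` and at most the total of `deg - 4` over
  -- `B`, which equals `|T|`; so every local bound is tight.
  have q1 := (Finset.sum_eq_sum_iff_of_le l1).1 (by
    simp only [Finset.sum_const, nsmul_eq_mul, mul_one]; omega)
  have q2 := (Finset.sum_eq_sum_iff_of_le l2).1 (by omega)
  refine ⟨fun v hv => ?_, fun x hx hx5 => q2 x (by simp [hB, hx, hx5])⟩
  exact_mod_cast (q1 v (by simp [hT, hv, hv.1])).symm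

include hess hint in
/-- Two nodes with a common neighbour of degree six, all other neighbours having degree four. -/
theorem exists_node_pair (hv : IsNode V m v) : ∃ v' w, IsNode V m v' ∧ v ≠ v' ∧
    nbrs V m v ∩ nbrs V m v' = {w} ∧ deg V m w = 6 ∧
    (∀ x ∈ nbrs V m v, x ≠ w → deg V m x = 4) ∧ ∀ x ∈ nbrs V m v', x ≠ w → deg V m x = 4 := by
  obtain ⟨d1, d2⟩ := h.discharge hna h6 hnc hess hint
  obtain ⟨w, hw⟩ := Finset.card_eq_one.1 (d1 v hv)
  have hwm : w ∈ nbrs V m v ∧ 5 ≤ deg V m w := Finset.mem_filter.1 (hw ▸ Finset.mem_singleton_self w)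
  have four : ∀ {u}, IsNode V m u → (nbrs V m u).filter (fun x => 5 ≤ deg V m x) = {w} →
      ∀ x ∈ nbrs V m u, x ≠ w → deg V m x = 4 := by
    intro u hu he x hx hxw
    have h4 := h.four_le_deg_of_mem_nbrs hna h6 hnc hu hx
    by_contra hne
    have : x ∈ (nbrs V m u).filter (fun x => 5 ≤ deg V m x) :=
      Finset.mem_filter.2 ⟨hx, by omega⟩
    rw [he] at this
    exact hxw (Finset.mem_singleton.1 this)
  have hs := h.sum_nbrs_deg_sub_four hna h6 hnc hess hv
  rw [← Finset.add_sum_erase _ _ hwm.1, Finset.sum_eq_zero (s := (nbrs V m v).erase w) fun x hx =>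
    by rw [four hv hw x (Finset.mem_of_mem_erase hx) (Finset.ne_of_mem_erase hx)]; norm_num] at hs
  have hwV := nbrs_subset hwm.1
  have hA := d2 w hwV hwm.2
  have hA' := h.three_mul_card_node_nbrs_le hna h6 hnc hint hwV
  -- The neighbours other than `w` contribute 0, so `deg w - 4 ≥ 2`; and `3 * (deg w - 4) ≤ deg w`.
  have hd6 : deg V m w = 6 := by omega
  obtain ⟨v', hv', hne⟩ := Finset.exists_mem_ne
    (s := (nbrs V m w).filter (IsNode V m)) (by omega) v
  obtain ⟨hv'w, hv'n⟩ := Finset.mem_filter.1 hv'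
  have hwv' := h.mem_nbrs_comm hwV hv'w
  obtain ⟨w', hw'⟩ := Finset.card_eq_one.1 (d1 v' hv'n)
  have : w ∈ (nbrs V m v').filter (fun x => 5 ≤ deg V m x) :=
    Finset.mem_filter.2 ⟨hwv', hwm.2⟩
  rw [hw', Finset.mem_singleton] at this
  subst this
  refine ⟨v', w, hv'n, hne.symm, ?_, hd6, four hv hw, four hv'n hw'⟩
  have hwi : w ∈ nbrs V m v ∩ nbrs V m v' := Finset.mem_inter.2 ⟨hwm.1, hwv'⟩
  exact Finset.eq_singleton_iff_unique_mem.2 ⟨hwi, fun t ht =>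
    Finset.card_le_one.1 (hint v v' hv hv'n hne.symm) t ht w hwi⟩

include hess in
/-- In the extremal configuration the two closed neighbourhoods cover the graph. -/
theorem union_closedNbrs_eq_univ {v' : α} (hv : IsNode V m v) (hv' : IsNode V m v')
    (hne : v ≠ v') (hi : nbrs V m v ∩ nbrs V m v' = {w}) (hd6 : deg V m w = 6)
    (hN : ∀ x ∈ nbrs V m v, x ≠ w → deg V m x = 4)
    (hN' : ∀ x ∈ nbrs V m v', x ≠ w → deg V m x = 4) :
    closedNbrs V m v ∪ closedNbrs V m v' = V ∧
      between m (closedNbrs V m v \ closedNbrs V m v')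
        (closedNbrs V m v' \ closedNbrs V m v) = 2 := by
  have hci := h.closedNbrs_inter hna h6 hnc hv hv' hne
  have hsu := h.slack_union_two hna h6 hnc hv hv' hne
  have hcu := h.card_union_closedNbrs hna h6 hnc hv hv' hne
  have hsub := Finset.union_subset (closedNbrs_subset (m := m) hv.1)
    (closedNbrs_subset (m := m) hv'.1)
  have hwm : w ∈ nbrs V m v ∧ w ∈ nbrs V m v' := Finset.mem_inter.1 (by rw [hi]; simp)
  have hwV := nbrs_subset hwm.1
  rw [hi] at hsu hcu hci
  rw [slack_singleton h.symm, h.loop_eq_zero hna h6 hnc hwV] at hsu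
  rw [Finset.card_singleton] at hcu
  have hb := between_nonneg (m := m) (closedNbrs V m v \ closedNbrs V m v')
    (closedNbrs V m v' \ closedNbrs V m v)
  have sum_closed : ∀ {u}, IsNode V m u → w ∈ nbrs V m u →
      (∀ x ∈ nbrs V m u, x ≠ w → deg V m x = 4) →
      ∑ x ∈ closedNbrs V m u, (4 - deg V m x) = -1 := by
    intro u hu hwu hu4
    rw [closedNbrs, Finset.sum_insert (h.node_nbrs hu).2.1, hu.2, ← Finset.add_sum_erase _ _ hwu,
      hd6, Finset.sum_eq_zero fun x hx => by
        rw [hu4 x (Finset.mem_of_mem_erase hx) (Finset.ne_of_mem_erase hx)]; norm_num]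
    norm_num
  -- Each closed neighbourhood has charge `-1` and the common vertex `-2`, so the union has charge
  -- 0: its cut has exactly `2 * slack` edges, and its slack is at most 2.
  have hsum := Finset.sum_union_inter (s₁ := closedNbrs V m v) (s₂ := closedNbrs V m v')
    (f := fun x => 4 - deg V m x)
  rw [hci, Finset.sum_singleton, hd6, sum_closed hv hwm.1 hN, sum_closed hv' hwm.2 hN',
    sum_four_sub_deg h.symm hsub] at hsum
  rcases eq_or_ne (closedNbrs V m v ∪ closedNbrs V m v') V with hV | hV
  · rw [hV, h.slack_eq_zero] at hsu
    exact ⟨hV, by push_cast at hsu; omega⟩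
  exfalso
  have hss := hsub.ssubset_of_ne hV
  have hlt := Finset.card_lt_card hss
  have hcs := Finset.card_sdiff_of_subset hsub
  by_cases h2 : 2 ≤ (V \ (closedNbrs V m v ∪ closedNbrs V m v')).card
  · have := hess _ hsub (by omega) h2
    push_cast at hsu
    omega
  obtain ⟨u, hu⟩ := Finset.card_eq_one.1
    (show (V \ (closedNbrs V m v ∪ closedNbrs V m v')).card = 1 by omega)
  have huV : u ∈ V ∧ u ∉ closedNbrs V m v ∪ closedNbrs V m v' :=
    Finset.mem_sdiff.1 (by rw [hu]; simp)
  have hbs := h.between_sdiff hsub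
  rw [hu, slack_singleton h.symm, h.loop_eq_zero hna h6 hnc huV.1] at hbs
  rw [hu] at hsum
  have hb0 : between m (closedNbrs V m v \ closedNbrs V m v')
      (closedNbrs V m v' \ closedNbrs V m v) ≤ 0 := by push_cast at hsu hbs; omega
  have hvv' : v ∉ closedNbrs V m v' := fun hh => by
    rcases Finset.mem_insert.1 hh with hh | hh
    exacts [hne hh, h.not_mem_nbrs_of_noCritical hna h6 hnc hv' hv hh]
  have hv'v : v' ∉ closedNbrs V m v := fun hh => by
    rcases Finset.mem_insert.1 hh with hh | hh
    exacts [hne hh.symm, h.not_mem_nbrs_of_noCritical hna h6 hnc hv hv' hh]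
  obtain ⟨a, ha, b, hb', hab⟩ := h.conn {w, u} (by simp [Finset.insert_subset_iff, hwV, huV.1])
    Finset.card_le_two (closedNbrs V m v \ closedNbrs V m v')
    (closedNbrs V m v' \ closedNbrs V m v) ⟨v, Finset.mem_sdiff.2 ⟨Finset.mem_insert_self _ _, hvv'⟩⟩
    ⟨v', Finset.mem_sdiff.2 ⟨Finset.mem_insert_self _ _, hv'v⟩⟩ (by
      rw [Finset.disjoint_left]
      exact fun t ht ht' => (Finset.mem_sdiff.1 ht).2 (Finset.mem_sdiff.1 ht').1) (by
      ext t
      have e1 : t ∈ closedNbrs V m v ∩ closedNbrs V m v' ↔ t ∈ ({w} : Finset α) := by rw [hci]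
      have e2 : t ∈ V \ (closedNbrs V m v ∪ closedNbrs V m v') ↔ t ∈ ({u} : Finset α) := by rw [hu]
      have e3 := @hsub t
      simp only [Finset.mem_inter, Finset.mem_sdiff, Finset.mem_union, Finset.mem_singleton,
        Finset.mem_insert] at e1 e2 e3 ⊢
      clear * - e1 e2 e3
      tauto)
  -- With a single vertex `u` left over, the slack is 2, no edge joins the two sides, and `{w, u}`
  -- separates.
  exact hab (eq_zero_of_between hb0 ha hb')

include hess hint in
theorem isBase_of_inter_le_one (hv : IsNode V m v) : IsBase V m := by
  obtain ⟨v', w, hv', hne, hi, hd6, hN, hN'⟩ := h.exists_node_pair hna h6 hnc hess hint hv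
  obtain ⟨hV, hb⟩ := h.union_closedNbrs_eq_univ hna h6 hnc hess hv hv' hne hi hd6 hN hN'
  have hcu := h.card_union_closedNbrs hna h6 hnc hv hv' hne
  rw [hV, hi, Finset.card_singleton] at hcu
  have hwm : w ∈ nbrs V m v ∧ w ∈ nbrs V m v' := Finset.mem_inter.1 (by rw [hi]; simp)
  have pair : ∀ {u}, IsNode V m u → w ∈ nbrs V m u → ∃ x y, x ≠ y ∧ x ≠ w ∧ y ≠ w ∧
      nbrs V m u = {w, x, y} := by
    intro u hu hwu
    obtain ⟨x, y, hxy, he⟩ := Finset.card_eq_two.1 (show ((nbrs V m u).erase w).card = 2 by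
      rw [Finset.card_erase_of_mem hwu, (h.node_nbrs hu).1])
    have hx : x ∈ (nbrs V m u).erase w := by simp [he]
    have hy : y ∈ (nbrs V m u).erase w := by simp [he]
    exact ⟨x, y, hxy, Finset.ne_of_mem_erase hx, Finset.ne_of_mem_erase hy, by
      rw [← he, Finset.insert_erase hwu]⟩
  obtain ⟨x, y, hxy, hxw, hyw, hNv⟩ := pair hv hwm.1
  obtain ⟨x', y', hxy', hxw', hyw', hNv'⟩ := pair hv' hwm.2
  have hVe : V = {x, v, w, y, x', v', y'} := by
    rw [← hV, closedNbrs, closedNbrs, hNv, hNv']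
    ext t
    simp only [Finset.mem_union, Finset.mem_insert, Finset.mem_singleton]
    clear * -
    tauto
  have one : ∀ {u}, IsNode V m u → ∀ {p q}, p ∈ nbrs V m u → q ∈ nbrs V m u → p ≠ q →
      m p q = 1 := fun {u} hu {p q} hp hq hpq => by
    rw [(h.slack_closedNbrs_of_noCritical hna h6 hnc hu).2 p (Finset.mem_insert_of_mem hp) q
      (Finset.mem_insert_of_mem hq), if_neg hpq]
  have loop : ∀ {t}, t ∈ V → m t t = 0 := fun {t} => h.loop_eq_zero hna h6 hnc
  have xm : x ∈ nbrs V m v := by simp [hNv]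
  have ym : y ∈ nbrs V m v := by simp [hNv]
  have xm' : x' ∈ nbrs V m v' := by simp [hNv']
  have ym' : y' ∈ nbrs V m v' := by simp [hNv']
  have notin : ∀ {t}, t ∈ nbrs V m v → t ∈ nbrs V m v' → t = w := fun {t} h1 h2 => by
    have : t ∈ nbrs V m v ∩ nbrs V m v' := Finset.mem_inter.2 ⟨h1, h2⟩
    rwa [hi, Finset.mem_singleton] at this
  have zero : ∀ {p q}, q ∈ V → q ∉ nbrs V m p → m p q = 0 := fun {p q} hq hn => by
    by_contra hh
    exact hn (mem_nbrs.2 ⟨hq, hh⟩)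
  have vx' := zero (nbrs_subset xm') fun hh => hxw' (notin hh xm')
  have vy' := zero (nbrs_subset ym') fun hh => hyw' (notin hh ym')
  have v'x := zero (nbrs_subset xm) fun hh => hxw (notin xm hh)
  have v'y := zero (nbrs_subset ym) fun hh => hyw (notin ym hh)
  have vv' := zero hv'.1 (h.not_mem_nbrs_of_noCritical hna h6 hnc hv hv')
  have vx := h.nbrs_eq_one hv xm
  have vy := h.nbrs_eq_one hv ym
  have vw := h.nbrs_eq_one hv hwm.1
  have v'x' := h.nbrs_eq_one hv' xm'
  have v'y' := h.nbrs_eq_one hv' ym'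
  have v'w := h.nbrs_eq_one hv' hwm.2
  have xw := one hv xm hwm.1 hxw
  have yw := one hv ym hwm.1 hyw
  have xy := one hv xm ym hxy
  have xw' := one hv' xm' hwm.2 hxw'
  have yw' := one hv' ym' hwm.2 hyw'
  have xy' := one hv' xm' ym' hxy'
  have xx := loop (nbrs_subset xm)
  have yy := loop (nbrs_subset ym)
  have xx' := loop (nbrs_subset xm')
  have yy' := loop (nbrs_subset ym')
  have ww := loop (nbrs_subset hwm.1)
  have hvv := loop hv.1
  have hvv' := loop hv'.1
  have sym := h.symm
  have dg : ∀ t, deg V m t = m t x + m t v + m t w + m t y + m t x' + m t v' + m t y' + m t t := by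
    intro t
    rw [deg, between_singleton_left, sum_eq_of_image_univ (n := 7)
      (φ := ![x, v, w, y, x', v', y']) (by simp [hVe, Fin.univ_succ]) (by omega)]
    simp [Fin.sum_univ_succ]
    ring
  have dx := hN x xm hxw
  have dy := hN y ym hyw
  have dx' := hN' x' xm' hxw'
  have dy' := hN' y' ym' hyw'
  rw [dg] at dx dy dx' dy'
  rw [sym x v, sym x v'] at dx
  rw [sym y x, sym y v, sym y v'] at dy
  rw [sym x' x, sym x' y, sym x' v, sym x' v'] at dx'
  rw [sym y' x, sym y' y, sym y' v, sym y' v', sym y' x'] at dy'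
  have hwx' := sym w x'
  have hwv' := sym w v'
  have hwy' := sym w y'
  have hwy := sym w y
  have hyv' := sym y v'
  have hxv' := sym x v'
  have hxv := sym x v
  have hxv2 := sym x' v'
  clear * - sym hVe hcu dx dy dx' dy' hwx' hwv' hwy' hwy hyv' hxv hxv' hxv2 vx' vy' v'x v'y vv' vx
    vy vw v'x' v'y' v'w xw yw xy xw' yw' xy' xx yy xx' yy' ww hvv hvv'
  -- Degree four leaves each of `x`, `y`, `x'`, `y'` exactly one edge to the other side: a perfect
  -- matching, unique up to swapping `x'` and `y'`.
  have hcase : m x x' = 1 ∧ m x y' = 0 ∧ m y x' = 0 ∧ m y y' = 1 ∨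
      m x x' = 0 ∧ m x y' = 1 ∧ m y x' = 1 ∧ m y y' = 0 := by omega
  rcases hcase with ⟨e1, e2, e3, e4⟩ | ⟨e1, e2, e3, e4⟩
  · exact isBase_two_K4 sym hVe (by omega) xx (by omega) xw xy e1 (by omega) e2 hvv vw vy vx' vv'
      vy' ww (by omega) (by omega) (by omega) (by omega) yy e3 (by omega) e4 xx' (by omega) xy'
      hvv' v'y' yy'
  · refine isBase_two_K4 (a := x) (b := v) (c := w) (d := y) (e := y') (f := v') (g := x') sym
      (hVe.trans ?_) (by omega) xx (by omega) xw xy e2 (by omega) e1 hvv vw vy vy' vv'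
      vx' ww (by omega) (by omega) (by omega) (by omega) yy e4 (by omega) e3 yy' ?_ ?_
      hvv' v'x' xx'
    · ext t
      simp only [Finset.mem_insert, Finset.mem_singleton]
      clear * -
      tauto
    · rw [sym]; exact v'y'
    · rw [sym]; exact xy'

include hess in
theorem isBase_of_noCritical (hv : IsNode V m v) : IsBase V m := by
  by_cases hint : ∀ v w, IsNode V m v → IsNode V m w → v ≠ w →
      (nbrs V m v ∩ nbrs V m w).card ≤ 1
  · exact h.isBase_of_inter_le_one hna h6 hnc hess hint hv
  · push Not at hint
    obtain ⟨a, b, ha, hb, hab, hi⟩ := hint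
    exact h.isBase_of_two_le_inter hna h6 hnc ha hb hab hi

end discharging
end noCritical

/-- A circuit with a node but without admissible nodes is a base graph, provided that either there
are no proper critical sets and it is essentially `5`-edge-connected, or it is essentially
`4`-edge-connected and has a proper critical set. -/
theorem isBase (h : IsThreeConnCircuit V m) (hna : NoAdmissible V m) (hv : IsNode V m v)
    (hcase : ((∀ S ⊆ V, 2 ≤ S.card → 2 ≤ (V \ S).card → 5 ≤ between m S (V \ S)) ∧
        ∀ X ⊆ V, X.Nonempty → X.card + 2 ≤ V.card → 2 ≤ slack m X) ∨
      (∀ S ⊆ V, 2 ≤ S.card → 2 ≤ (V \ S).card → 4 ≤ between m S (V \ S)) ∧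
        ∃ X ⊆ V, X.Nonempty ∧ X.card + 2 ≤ V.card ∧ slack m X ≤ 1) : IsBase V m := by
  have h4 := h.four_le_card
  rcases (show V.card = 4 ∨ V.card = 5 ∨ 6 ≤ V.card by omega) with hc | hc | h6
  · exact h.isBase_of_card_four hc hv
  · exact h.isBase_of_card_five hna hc hv
  rcases hcase with ⟨hess, hnc⟩ | ⟨hess, X, hX, hXne, hXc, hs⟩
  · exact h.isBase_of_noCritical hna h6 hnc hess hv
  · exact (h.false_of_critical hna h6 hess hX hXne hs hXc).elim

end IsThreeConnCircuit
end MultCircuit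

/-! ### From multigraphs to multiplicities -/

namespace Graph
open MultCircuit
variable {α β : Type*} [DecidableEq α] {G : Graph α β}

theorem linkCount_comm (x y : α) : G.linkCount x y = G.linkCount y x := by
  simp only [linkCount, G.isLink_comm]

theorem finite_isLink (hE : E(G).Finite) (x y : α) : {e | G.IsLink e x y}.Finite :=
  hE.subset fun _ he => he.edge_mem

theorem linkCount_ne_zero (hE : E(G).Finite) {x y : α} : G.linkCount x y ≠ 0 ↔ G.Adj x y := by
  rw [linkCount, ← Nat.pos_iff_ne_zero, Set.ncard_pos (finite_isLink hE x y)]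
  rfl

theorem finite_isLink_pairs (hE : E(G).Finite) (P : Finset (α × α)) :
    {e | ∃ p ∈ P, G.IsLink e p.1 p.2}.Finite :=
  hE.subset fun _ ⟨_, _, he⟩ => he.edge_mem

/-- The edges joining one of the pairs in `P` are counted by the sum of the multiplicities. -/
theorem ncard_isLink_pairs (hE : E(G).Finite) (P : Finset (α × α))
    (hP : ∀ p ∈ P, p.swap ∈ P → p.1 = p.2) :
    {e | ∃ p ∈ P, G.IsLink e p.1 p.2}.ncard = ∑ p ∈ P, G.linkCount p.1 p.2 := by
  induction P using Finset.induction_on with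
  | empty => simp
  | insert p P hp ih =>
    rw [Finset.sum_insert hp, ← ih fun q hq hq' => hP q (Finset.mem_insert_of_mem hq)
      (Finset.mem_insert_of_mem hq'), linkCount, ← Set.ncard_union_eq ?_ (finite_isLink hE _ _)
      (finite_isLink_pairs hE P)]
    · congr 1
      ext e
      simp
    · rw [Set.disjoint_left]
      rintro e he ⟨q, hq, hq'⟩
      rcases IsLink.eq_and_eq_or_eq_and_eq he hq' with ⟨h1, h2⟩ | ⟨h1, h2⟩
      · exact hp (by rwa [show p = q from Prod.ext h1 h2])
      · have hs : q = p.swap := Prod.ext h2.symm h1.symm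
        have := hP p (Finset.mem_insert_self _ _) (Finset.mem_insert_of_mem (hs ▸ hq))
        exact hp (by rwa [show p = q from Prod.ext (this.trans h2) (this.symm.trans h1)])

theorem slack_linkCount (hE : E(G).Finite) (X : Finset α) :
    slack G.linkCount X = 2 * X.card - G.inducedCount X := by
  induction X using Finset.induction_on with
  | empty => simp [slack_empty, inducedCount, edgeSet_induce]
  | insert v X hv ih =>
    have hd : G.inducedCount ↑(insert v X) = G.inducedCount X +
        ∑ p ∈ ({v} : Finset α) ×ˢ insert v X, G.linkCount p.1 p.2 := by
      rw [← ncard_isLink_pairs hE _ fun p hp hp' => by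
          simp only [Finset.mem_product, Finset.mem_singleton, Prod.fst_swap] at hp hp'
          rw [hp.1, hp'.1],
        inducedCount, inducedCount, ← Set.ncard_union_eq ?_
          (hE.subset (by rw [edgeSet_induce]; rintro e ⟨_, _, he, -⟩; exact he.edge_mem))
          (finite_isLink_pairs hE _)]
      · congr 1
        ext e
        simp only [edgeSet_induce, Set.mem_union, Set.mem_ofPred_eq, Finset.coe_insert,
          Set.mem_insert_iff, Finset.mem_coe, Finset.mem_product, Finset.mem_singleton,
          Prod.exists, Finset.mem_insert]
        constructor
        · rintro ⟨x, y, he, rfl | hx, rfl | hy⟩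
          · exact .inr ⟨_, _, ⟨rfl, .inl rfl⟩, he⟩
          · exact .inr ⟨_, _, ⟨rfl, .inr hy⟩, he⟩
          · exact .inr ⟨_, _, ⟨rfl, .inr hx⟩, he.symm⟩
          · exact .inl ⟨_, _, he, hx, hy⟩
        · rintro (⟨x, y, he, hx, hy⟩ | ⟨x, y, ⟨rfl, hy⟩, he⟩)
          · exact ⟨_, _, he, .inr hx, .inr hy⟩
          · exact ⟨_, _, he, .inl rfl, hy⟩
      · rw [Set.disjoint_left]
        intro e he
        rw [edgeSet_induce] at he
        obtain ⟨x, y, he, hx, hy⟩ := he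
        rintro ⟨q, hq, hq'⟩
        simp only [Finset.mem_product, Finset.mem_singleton] at hq
        rw [hq.1] at hq'
        rcases hq'.left_eq_or_eq he with rfl | rfl
        exacts [hv hx, hv hy]
    rw [Finset.sum_product, Finset.sum_singleton, Finset.sum_insert hv] at hd
    rw [slack_insert linkCount_comm hv, ih, hd, between_singleton_left,
      Finset.card_insert_of_notMem hv]
    push_cast
    ring

section
variable {V : Finset α} (hV : (V : Set α) = V(G))
include hV

theorem deg_linkCount (hE : E(G).Finite) (v : α) : deg V G.linkCount v = G.valency v := by
  have hs : {e | G.Inc e v} = {e | ∃ p ∈ ({v} : Finset α) ×ˢ V, G.IsLink e p.1 p.2} := by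
    ext e
    simp only [Set.mem_ofPred_eq, Finset.mem_product, Finset.mem_singleton, Prod.exists]
    constructor
    · rintro ⟨y, hy⟩
      exact ⟨v, y, ⟨rfl, by rw [← Finset.mem_coe, hV]; exact hy.right_mem⟩, hy⟩
    · rintro ⟨_, y, ⟨rfl, -⟩, hy⟩
      exact ⟨y, hy⟩
  rw [deg, valency, hs, ncard_isLink_pairs hE _ fun p hp hp' => by
      simp only [Finset.mem_product, Finset.mem_singleton, Prod.fst_swap] at hp hp'
      rw [hp.1, hp'.1], Finset.sum_product, Finset.sum_singleton, between_singleton_left]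
  push_cast
  rfl

/-- A walk from `A` to `B` in the graph without `S` has a step that leaves `A`. -/
theorem exists_linkCount_ne_zero (hE : E(G).Finite) (h3 : G.IsThreeConn) {S : Finset α}
    (hS : S ⊆ V) (hc : S.card ≤ 2) {A B : Finset α} (hA : A.Nonempty) (hB : B.Nonempty)
    (hAB : Disjoint A B) (hu : A ∪ B = V \ S) : ∃ a ∈ A, ∃ b ∈ B, G.linkCount a b ≠ 0 := by
  have hconn := h3.2 S (by rw [← hV]; exact_mod_cast hS) (by rwa [Set.ncard_coe_finset])
  have hVS : V(G.deleteVerts S) = ((A ∪ B : Finset α) : Set α) := by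
    rw [vertexSet_deleteVerts, ← hV, hu, Finset.coe_sdiff]
  obtain ⟨a, ha⟩ := hA
  obtain ⟨b, hb⟩ := hB
  have haV : a ∈ V(G.deleteVerts S) := by rw [hVS]; simp [ha]
  have hbV : b ∈ V(G.deleteVerts S) := by rw [hVS]; simp [hb]
  obtain ⟨p⟩ := hconn.preconnected ⟨a, haV⟩ ⟨b, hbV⟩
  obtain ⟨d, -, hd1, hd2⟩ := p.exists_boundary_dart {t | t.1 ∈ A} ha
    (fun hh => Finset.disjoint_left.1 hAB hh hb)
  have hadj := d.adj
  rw [toSimpleGraph_adj] at hadj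
  refine ⟨_, hd1, d.snd.1, ?_, (linkCount_ne_zero hE).2 (hadj.2.mono deleteVerts_le)⟩
  have := Finset.mem_coe.1 (hVS.subset d.snd.2)
  exact (Finset.mem_union.1 this).resolve_left hd2

/-- The edges leaving `S` form an edge-cutset. -/
theorem between_ne_of_isEssentiallyEdgeConn (hE : E(G).Finite)
    (h : IsThreeConnCircuit V G.linkCount) {k : ℕ} (hk : k < 7)
    (hess : G.IsEssentiallyEdgeConn k) {S : Finset α} (hS : S ⊆ V) (h1 : 2 ≤ S.card)
    (h2 : 2 ≤ (V \ S).card) : between G.linkCount S (V \ S) ≠ (k - 1 : ℕ) := by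
  intro hb
  set F := {e | ∃ p ∈ S ×ˢ (V \ S), G.IsLink e p.1 p.2} with hF
  have hFm : ∀ {e x y}, G.IsLink e x y → x ∈ S → y ∈ V → y ∉ S → e ∈ F :=
    fun {e x y} he hx hy hy' => ⟨(x, y), by simp [hx, hy, hy'], he⟩
  have hFc : F.ncard = k - 1 := by
    rw [hF, ncard_isLink_pairs hE _ fun p hp hp' => by
      simp only [Finset.mem_product, Finset.mem_sdiff, Prod.fst_swap, Prod.snd_swap] at hp hp'
      exact absurd hp.1 hp'.2.2, Finset.sum_product]
    rw [between] at hb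
    exact_mod_cast hb
  have hmem : ∀ t : V(G.deleteEdges F), t.1 ∈ V := fun t => by
    rw [← Finset.mem_coe, hV]; exact t.2
  have hside : ∀ a b : V(G.deleteEdges F), (G.deleteEdges F).toSimpleGraph.Adj a b →
      (a.1 ∈ S ↔ b.1 ∈ S) := by
    intro a b hab
    rw [toSimpleGraph_adj] at hab
    obtain ⟨-, e, he⟩ := hab
    rw [deleteEdges_isLink] at he
    by_contra hne
    by_cases ha : a.1 ∈ S
    · exact he.2 (hFm he.1 ha (hmem b) (by tauto))
    · exact he.2 (hFm he.1.symm (by tauto) (hmem a) ha)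
  have hVd : ∀ {t}, t ∈ V → t ∈ V(G.deleteEdges F) := fun {t} ht => by
    rwa [← Finset.mem_coe, hV] at ht
  have hcut : ¬ (G.deleteEdges F).IsConn := by
    intro hc
    obtain ⟨a, ha⟩ := Finset.card_pos.1 (show 0 < S.card by omega)
    obtain ⟨b, hb⟩ := Finset.card_pos.1 (show 0 < (V \ S).card by omega)
    rw [Finset.mem_sdiff] at hb
    obtain ⟨p⟩ := hc.preconnected ⟨a, hVd (hS ha)⟩ ⟨b, hVd hb.1⟩
    obtain ⟨d, -, hd1, hd2⟩ := p.exists_boundary_dart {t | t.1 ∈ S} ha hb.2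
    exact hd2 ((hside _ _ d.adj).1 hd1)
  have hFE : F ⊆ E(G) := fun e ⟨_, _, he⟩ => he.edge_mem
  obtain ⟨c, hc⟩ := hess F ⟨hFE, hE.subset hFE, hFc, hcut⟩
  obtain ⟨u, hu⟩ := Set.ncard_eq_one.1 hc
  -- Rules out triviality of the cutset: an isolated vertex `u` has no edge to the rest of its side
  -- `T`, so the cuts of at least three edges around `u` and around `T.erase u` are disjoint parts
  -- of the cut around `T`. Six edges exceed `k - 1` as `k < 7`.
  have key : ∀ T ⊆ V, u.1 ∈ T → (∀ a ∈ T, ∀ b ∈ T, ∀ e ∈ F, ¬ G.IsLink e a b) → 2 ≤ T.card →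
      2 ≤ (V \ T).card → 6 ≤ between G.linkCount T (V \ T) := by
    intro T hT huT hTF hT1 hT2
    have hz : ∀ t ∈ T, t ≠ u.1 → G.linkCount u.1 t = 0 := by
      intro t ht htu
      by_contra h0
      obtain ⟨e, he⟩ := (linkCount_ne_zero hE).1 h0
      have hadj : (G.deleteEdges F).toSimpleGraph.Adj u ⟨t, hVd (hT ht)⟩ := by
        rw [toSimpleGraph_adj]
        refine ⟨fun hh => htu (congrArg Subtype.val hh).symm, e, ?_⟩
        rw [deleteEdges_isLink]
        exact ⟨he, fun heF => hTF _ huT _ ht e heF he⟩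
      have huc : u ∈ c.supp := by rw [hu]; rfl
      have htc : (⟨t, hVd (hT ht)⟩ : V(G.deleteEdges F)) ∈ c.supp :=
        (c.mem_supp_congr_adj hadj).1 huc
      rw [hu] at htc
      exact htu (congrArg Subtype.val htc)
    have hTu : (T.erase u.1).Nonempty := by
      rw [← Finset.card_pos, Finset.card_erase_of_mem huT]; omega
    have hVT : (V \ T).Nonempty := Finset.card_pos.1 (by omega)
    obtain ⟨q, hq⟩ := hVT
    rw [Finset.mem_sdiff] at hq
    have ss : ∀ {R}, R ⊆ T → R ⊂ V := fun {R} hR => ⟨hR.trans hT, fun hh => hq.2 (hR (hh hq.1))⟩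
    have b1 := h.three_le_between (S := {u.1}) (ss (by simpa)) (by simp)
    have b2 := h.three_le_between (ss (Finset.erase_subset u.1 T)) hTu
    have e1 : V \ {u.1} = (T.erase u.1) ∪ (V \ T) := by
      ext t
      have := @hT t
      simp only [Finset.mem_sdiff, Finset.mem_union, Finset.mem_erase, Finset.mem_singleton]
      by_cases htu : t = u.1
      · subst htu; tauto
      · tauto
    have e2 : V \ T.erase u.1 = {u.1} ∪ (V \ T) := by
      ext t
      have := @hT t
      simp only [Finset.mem_sdiff, Finset.mem_union, Finset.mem_erase, Finset.mem_singleton]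
      by_cases htu : t = u.1
      · subst htu; tauto
      · tauto
    have z1 : between G.linkCount {u.1} (T.erase u.1) = 0 := between_eq_zero fun a ha b hb => by
      rw [Finset.mem_singleton.1 ha]
      exact hz b (Finset.mem_of_mem_erase hb) (Finset.ne_of_mem_erase hb)
    rw [e1, between_union_right (Finset.disjoint_sdiff.mono_left (Finset.erase_subset _ _)),
      z1] at b1
    rw [e2, between_union_right (by simpa using fun _ => huT), between_comm linkCount_comm _ {u.1},
      z1] at b2
    rw [← Finset.insert_erase huT, between_insert_left (by simp), Finset.insert_erase huT]
    omega
  have hk6 : (6 : ℤ) ≤ (k - 1 : ℕ) := by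
    rw [← hb]
    by_cases huS : u.1 ∈ S
    · refine key S hS huS ?_ h1 h2
      rintro a ha b hb' e ⟨p, hp, he⟩ he'
      simp only [Finset.mem_product, Finset.mem_sdiff] at hp
      rcases he.right_eq_or_eq he' with hh | hh <;> rw [hh] at hp <;> tauto
    · have := key (V \ S) Finset.sdiff_subset (Finset.mem_sdiff.2 ⟨hmem u, huS⟩) ?_ h2
        (by rwa [Finset.sdiff_sdiff_eq_self hS])
      · rwa [Finset.sdiff_sdiff_eq_self hS, between_comm linkCount_comm] at this
      rintro a ha b hb' e ⟨p, hp, he⟩ he'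
      simp only [Finset.mem_product, Finset.mem_sdiff] at hp ha hb'
      rcases he.left_eq_or_eq he' with hh | hh <;> rw [hh] at hp <;> tauto
  omega

/-- A `3`-connected member of `𝓜` in terms of its multiplicities. -/
theorem InClassM.isThreeConnCircuit (hG : G.InClassM) (h3 : G.IsThreeConn) :
    IsThreeConnCircuit V G.linkCount := by
  have hC : G.IsCircuit := hG.elim (·.1) (·.isCircuit)
  have hE := hC.finite_edgeSet
  have hVc : V(G).ncard = V.card := by rw [← hV, Set.ncard_coe_finset]
  have hmem : ∀ {v}, v ∈ V → v ∈ V(G) := fun {v} hv => by rwa [← Finset.mem_coe, hV] at hv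
  have hval : ∀ {v}, deg V G.linkCount v = 3 → G.valency v = 3 := fun {v} hv => by
    rw [deg_linkCount hV hE] at hv
    exact_mod_cast hv
  have hsimple : G.Simple → ∀ x y, G.linkCount x y ≤ 1 ∧ G.linkCount x x = 0 := by
    intro hs x y
    refine ⟨(Set.ncard_le_one_iff_eq (finite_isLink hE x y)).2 ?_, ?_⟩
    · rcases {e | G.IsLink e x y}.eq_empty_or_nonempty with he | ⟨e, he⟩
      · exact .inl he
      · exact .inr ⟨e, Set.eq_singleton_iff_unique_mem.2 ⟨he, fun f hf => hf.eq he⟩⟩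
    · by_contra h0
      exact G.not_adj_self x ((linkCount_ne_zero hE).1 h0)
  refine ⟨linkCount_comm, ?_, ?_, ?_, ?_, ?_, ?_, ?_⟩
  · rw [slack_linkCount hE, inducedCount, hV, induce_vertexSet, hC.edge_count, hVc]
    push_cast
    ring
  · intro X hX hne
    have := hC.sparse X (by rw [← hV]; exact_mod_cast hX) (by exact_mod_cast hne)
    rw [Set.ncard_coe_finset] at this
    rw [slack_linkCount hE]
    omega
  · rw [← hVc]; exact h3.1
  · exact fun S hS hc A B hA hB hAB hu => exists_linkCount_ne_zero hV hE h3 hS hc hA hB hAB hu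
  · intro v hv hd
    rcases hG with ⟨-, hs⟩ | hM
    · exact (hsimple hs v v).2
    · by_contra h0
      have := (hM.loop v (hmem hv) (by omega)).1
      rw [hval hd] at this
      omega
  · intro v hv hd w
    rcases hG with ⟨-, hs⟩ | hM
    · exact (hsimple hs v w).1
    · by_contra! h0
      rcases eq_or_ne w v with rfl | hwv
      · have := (hM.loop w (hmem hv) (by omega)).1
        rw [hval hd] at this
        omega
      · have := hM.multiple v (hmem hv) ⟨w, hwv, h0⟩
        rw [hval hd] at this
        omega
  · intro v hv hl w
    rcases hG with ⟨-, hs⟩ | hM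
    · exact (hsimple hs v w).1
    · by_contra! h0
      rcases eq_or_ne w v with rfl | hwv
      · have := hM.two_loops w (hmem hv) h0
        have h4 := h3.1
        rw [this, Set.ncard_singleton] at h4
        omega
      · exact (hM.loop v (hmem hv) (by omega)).2 ⟨w, hwv, h0⟩

end

end Graph

/-! ### The 1-reduction and the isomorphism with an edge list -/

namespace Graph
open MultCircuit
variable {α β : Type*} {G : Graph α β}

theorem not_isLink_deleteVerts {v : α} {e₁ : β} (he : G.Inc e₁ v) (a b : α) :
    ¬ (G.deleteVerts {v}).IsLink e₁ a b := by
  intro hl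
  rw [deleteVerts_isLink] at hl
  rcases he.eq_or_eq_of_isLink hl.1 with h | h
  exacts [hl.2.1 h.symm, hl.2.2 h.symm]

/-- The `1`-reduction that deletes `v` and reuses the edge `e₁` to join `x` and `y`. -/
def reduction (G : Graph α β) (v x y : α) (e₁ : β) (hx : x ∈ V(G) \ {v}) (hy : y ∈ V(G) \ {v})
    (he : G.Inc e₁ v) : Graph α β where
  vertexSet := V(G) \ {v}
  IsLink e a b := (G.deleteVerts {v}).IsLink e a b ∨ e = e₁ ∧ s(a, b) = s(x, y)
  isLink_symm := fun _ _ => ⟨fun _ _ h => h.imp (·.symm) fun h => ⟨h.1, Sym2.eq_swap.trans h.2⟩⟩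
  eq_or_eq_of_isLink_of_isLink := by
    rintro e a b c d (h | h) (h' | h')
    · exact h.left_eq_or_eq h'
    · exact absurd (h'.1 ▸ h) (not_isLink_deleteVerts he _ _)
    · exact absurd (h.1 ▸ h') (not_isLink_deleteVerts he _ _)
    · have h2 := h.2.trans h'.2.symm
      rw [Sym2.eq_iff] at h2
      tauto
  left_mem_of_isLink := by
    rintro e a b (h | ⟨rfl, h⟩)
    · simpa using h.left_mem
    · rw [Sym2.eq_iff] at h
      rcases h with ⟨rfl, -⟩ | ⟨rfl, -⟩ <;> assumption

section reduction
variable {v x y z : α} {e₁ : β} {hx : x ∈ V(G) \ {v}} {hy : y ∈ V(G) \ {v}} {he : G.Inc e₁ v}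

theorem reduction_deleteEdges :
    (G.reduction v x y e₁ hx hy he).deleteEdges {e₁} = G.deleteVerts {v} := by
  refine Graph.ext (by simp [reduction]) fun e a b => ?_
  rw [deleteEdges_isLink]
  constructor
  · rintro ⟨h | h, hne⟩
    exacts [h, absurd h.1 hne]
  · exact fun h => ⟨.inl h, fun hh => not_isLink_deleteVerts he a b (hh ▸ h)⟩

theorem edgeSet_reduction_subset : E(G.reduction v x y e₁ hx hy he) ⊆ E(G) := by
  intro e h
  obtain ⟨a, b, h | h⟩ := exists_isLink_of_mem_edgeSet h
  exacts [(h.mono deleteVerts_le).edge_mem, h.1 ▸ he.edge_mem]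

theorem reduction_simple (hxy : x ≠ y) (hadj : ¬ G.Adj x y) (hs : G.Simple) :
    (G.reduction v x y e₁ hx hy he).Simple := by
  have hno : ∀ {e a b}, (G.deleteVerts {v}).IsLink e a b → s(a, b) ≠ s(x, y) := by
    intro e a b h h'
    have h := h.mono deleteVerts_le
    rw [Sym2.eq_iff] at h'
    rcases h' with ⟨rfl, rfl⟩ | ⟨rfl, rfl⟩
    exacts [hadj h.adj, hadj h.adj.symm]
  refine { not_isLoopAt := ?_, eq_of_isLink := ?_ }
  · rintro e a (h | ⟨-, h⟩)
    · exact G.not_isLoopAt e a (h.mono deleteVerts_le)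
    · rw [Sym2.eq_iff] at h
      rcases h with ⟨h1, h2⟩ | ⟨h1, h2⟩
      exacts [hxy (h1.symm.trans h2), hxy (h2.symm.trans h1)]
  · rintro e a b f (h | ⟨he, h⟩) (h' | ⟨he', h'⟩)
    · exact (h.mono deleteVerts_le).eq (h'.mono deleteVerts_le)
    · exact absurd h' (hno h)
    · exact absurd h (hno h')
    · exact he.trans he'.symm

open Classical in
theorem inducedCount_reduction (hE : E(G).Finite) {Y : Set α} (hY : Y ⊆ V(G) \ {v}) :
    (G.reduction v x y e₁ hx hy he).inducedCount Y =
      G.inducedCount Y + if x ∈ Y ∧ y ∈ Y then 1 else 0 := by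
  have hset : E((G.reduction v x y e₁ hx hy he).induce Y) =
      E(G.induce Y) ∪ if x ∈ Y ∧ y ∈ Y then {e₁} else ∅ := by
    ext e
    rw [edgeSet_induce, Set.mem_union, edgeSet_induce]
    constructor
    · rintro ⟨a, b, h | ⟨rfl, h⟩, ha, hb⟩
      · exact .inl ⟨a, b, h.mono deleteVerts_le, ha, hb⟩
      · right
        rw [if_pos]
        · rfl
        rw [Sym2.eq_iff] at h
        rcases h with ⟨rfl, rfl⟩ | ⟨rfl, rfl⟩
        exacts [⟨ha, hb⟩, ⟨hb, ha⟩]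
    · rintro (⟨a, b, h, ha, hb⟩ | h)
      · refine ⟨a, b, .inl ?_, ha, hb⟩
        rw [deleteVerts_isLink]
        exact ⟨h, (hY ha).2, (hY hb).2⟩
      · split_ifs at h with hc
        · exact ⟨x, y, .inr ⟨h, rfl⟩, hc⟩
        · exact absurd h (Set.notMem_empty _)
  rw [inducedCount, hset, Set.ncard_union_eq ?_
    (hE.subset (by rw [edgeSet_induce]; rintro e ⟨_, _, he, -⟩; exact he.edge_mem))
    (by split_ifs <;> simp)]
  · rw [inducedCount]
    split_ifs <;> simp
  · split_ifs
    · rw [Set.disjoint_singleton_right, edgeSet_induce]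
      rintro ⟨a, b, h, ha, hb⟩
      exact not_isLink_deleteVerts he a b (by
        rw [deleteVerts_isLink]; exact ⟨h, (hY ha).2, (hY hb).2⟩)
    · exact Set.disjoint_empty _

end reduction

section
variable [DecidableEq α] {V : Finset α} (hV : (V : Set α) = V(G))
include hV

/-- Removing the node leaves slack 1, and the new edge brings it to 0. On proper subsets only those
containing both `x` and `y` lose slack. -/
theorem isCircuit_reduction (hE : E(G).Finite) (h : IsThreeConnCircuit V G.linkCount)
    {v x y : α} {e₁ : β} {hx : x ∈ V(G) \ {v}} {hy : y ∈ V(G) \ {v}} {he : G.Inc e₁ v}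
    (hv : MultCircuit.IsNode V G.linkCount v)
    (hfree : ∀ X ⊂ V.erase v, x ∈ X → y ∈ X → 2 ≤ slack G.linkCount X) :
    (G.reduction v x y e₁ hx hy he).IsCircuit := by
  have hVH : V(G.reduction v x y e₁ hx hy he) = ((V.erase v : Finset α) : Set α) := by
    rw [Finset.coe_erase, hV]
    rfl
  have hVH' : ((V.erase v : Finset α) : Set α) ⊆ V(G) \ {v} := by rw [Finset.coe_erase, hV]
  have hs := h.slack_insert_node hv (V.erase_subset v) (Finset.notMem_erase v V)
  have hN : V.erase v ∩ nbrs V G.linkCount v = nbrs V G.linkCount v :=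
    Finset.inter_eq_right.2 fun t ht => Finset.mem_erase.2
      ⟨fun hh => (h.node_nbrs hv).2.1 (hh ▸ ht), nbrs_subset ht⟩
  rw [Finset.insert_erase hv.1, h.slack_eq_zero, hN, (h.node_nbrs hv).1, slack_linkCount hE] at hs
  have hxV : x ∈ V.erase v := by rw [← Finset.mem_coe, ← hVH]; exact hx
  have hyV : y ∈ V.erase v := by rw [← Finset.mem_coe, ← hVH]; exact hy
  refine ⟨?_, hE.subset edgeSet_reduction_subset, ⟨x, hx⟩, ?_, ?_⟩
  · rw [hVH]; exact Finset.finite_toSet _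
  · have hcount : E(G.reduction v x y e₁ hx hy he).ncard =
        (G.reduction v x y e₁ hx hy he).inducedCount V(G.reduction v x y e₁ hx hy he) := by
      rw [inducedCount, induce_vertexSet]
    rw [hcount, hVH, inducedCount_reduction hE hVH', if_pos ⟨hxV, hyV⟩, Set.ncard_coe_finset]
    omega
  · intro X hX hne
    rw [hVH] at hX
    obtain ⟨X, rfl⟩ := ((Finset.finite_toSet _).subset hX.subset).exists_finset_coe
    have hX' : X ⊂ V.erase v := by exact_mod_cast hX
    rw [inducedCount_reduction hE (hX.subset.trans hVH'), Set.ncard_coe_finset]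
    have h1 := h.slack_pos X (hX'.trans_subset (V.erase_subset v)) (by exact_mod_cast hne)
    rw [slack_linkCount hE] at h1
    split_ifs with hc
    · have h2 := hfree X hX' hc.1 hc.2
      rw [slack_linkCount hE] at h2
      omega
    · omega

theorem noAdmissible (hE : E(G).Finite) (h : IsThreeConnCircuit V G.linkCount)
    (hna : ¬ ∃ v, G.IsAdmissibleNode v) : NoAdmissible V G.linkCount := by
  intro v hv x hx y hy hxy h0
  by_contra! hfree
  obtain ⟨hN3, hvN, -⟩ := h.node_nbrs hv
  have hadj : ¬ G.Adj x y := fun hh => (linkCount_ne_zero hE).2 hh h0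
  have memV : ∀ {t}, t ∈ nbrs V G.linkCount v → t ∈ V(G) \ {v} := fun {t} ht =>
    ⟨by rw [← hV]; exact nbrs_subset ht, fun hh => hvN (hh ▸ ht)⟩
  have hlink : ∀ t ∈ nbrs V G.linkCount v, ∃ e, {e | G.IsLink e v t} = {e} := fun t ht =>
    Set.ncard_eq_one.1 (h.nbrs_eq_one hv ht)
  obtain ⟨z, hz⟩ := Finset.card_eq_one.1
    (show (((nbrs V G.linkCount v).erase x).erase y).card = 1 by
      rw [Finset.card_erase_of_mem (Finset.mem_erase.2 ⟨hxy.symm, hy⟩),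
        Finset.card_erase_of_mem hx, hN3])
  have hzm : z ∈ ((nbrs V G.linkCount v).erase x).erase y := by rw [hz]; simp
  simp only [Finset.mem_erase] at hzm
  obtain ⟨hzy, hzx, hzN⟩ := hzm
  obtain ⟨e₁, he₁⟩ := hlink x hx
  obtain ⟨e₂, he₂⟩ := hlink y hy
  obtain ⟨e₃, he₃⟩ := hlink z hzN
  have l₁ : G.IsLink e₁ v x := he₁.symm.subset rfl
  have l₂ : G.IsLink e₂ v y := he₂.symm.subset rfl
  have l₃ : G.IsLink e₃ v z := he₃.symm.subset rfl
  refine hna ⟨v, ⟨by rw [← hV]; exact hv.1, ?_⟩,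
    G.reduction v x y e₁ (memV hx) (memV hy) l₁.inc_left, x, y, z,
    ⟨by rw [← hV]; exact hv.1, hxy, hzx.symm, hzy.symm, memV hzN, ⟨e₁, e₂, e₃, l₁, l₂, l₃, ?_⟩,
      e₁, .inr ⟨rfl, rfl⟩, reduction_deleteEdges⟩, hadj,
    isCircuit_reduction hV hE h hv fun X hX hxX hyX => hfree X hX hxX hyX,
    reduction_simple hxy hadj⟩
  · have := hv.2
    rw [deg_linkCount hV hE] at this
    exact_mod_cast this
  · rintro e ⟨t, ht⟩
    have htN : t ∈ nbrs V G.linkCount v := mem_nbrs.2 ⟨by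
      rw [← Finset.mem_coe, hV]; exact ht.right_mem, (linkCount_ne_zero hE).2 ⟨e, ht⟩⟩
    by_cases htx : t = x
    · exact .inl (he₁.subset (htx ▸ ht))
    by_cases hty : t = y
    · exact .inr (.inl (he₂.subset (hty ▸ ht)))
    have : t ∈ ((nbrs V G.linkCount v).erase x).erase y := by simp [htx, hty, htN]
    rw [hz, Finset.mem_singleton] at this
    exact .inr (.inr (he₃.subset (this ▸ ht)))

/-- Label each edge by the pair of indices of its ends. For each label the edges and the list
positions are equinumerous, and the bijections of the fibres glue together. -/
theorem isIsomorphic_ofEdgeList (hE : E(G).Finite) {n : ℕ} {l : List (Sym2 (Fin n))}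
    (hr : Realizes V G.linkCount ⟨n, l⟩) : G.IsIsomorphic (ofEdgeList l) := by
  obtain ⟨φ, hinj, himg, hcount⟩ : ∃ φ : Fin n → α, Function.Injective φ ∧
    Finset.univ.image φ = V ∧ ∀ i j, G.linkCount (φ i) (φ j) = l.count s(i, j) := hr
  have hsurj : ∀ {x}, x ∈ V(G) → ∃ i, φ i = x := by
    intro x hx
    rw [← hV, ← himg] at hx
    simpa using hx
  have hmem : ∀ i, φ i ∈ V(G) := fun i => by rw [← hV, ← himg]; simp
  have hfin : Finite E(G) := hE
  have hlab : ∀ e : E(G), ∃ c : Sym2 (Fin n), ∀ i j, G.IsLink e (φ i) (φ j) ↔ c = s(i, j) := by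
    intro e
    obtain ⟨x, y, hxy⟩ := exists_isLink_of_mem_edgeSet e.2
    obtain ⟨i, rfl⟩ := hsurj hxy.left_mem
    obtain ⟨j, rfl⟩ := hsurj hxy.right_mem
    refine ⟨s(i, j), fun i' j' => ?_⟩
    rw [hxy.isLink_iff, Sym2.eq_iff, hinj.eq_iff, hinj.eq_iff, hinj.eq_iff, hinj.eq_iff]
  choose lab hlab using hlab
  have hfib : ∀ c, Nonempty ({e : E(G) // lab e = c} ≃ {k : Fin l.length // l.get k = c}) := by
    intro c
    rw [← Finite.card_eq]
    obtain ⟨i, j⟩ := c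
    change Nat.card {e : E(G) // lab e = s(i, j)} = Nat.card {k : Fin l.length // l.get k = s(i, j)}
    have e1 : Nat.card {e : E(G) // lab e = s(i, j)} = G.linkCount (φ i) (φ j) := by
      rw [linkCount, ← Nat.card_coe_set_eq]
      exact Nat.card_congr
        { toFun := fun e => ⟨e.1.1, (hlab e.1 i j).2 e.2⟩
          invFun := fun e => ⟨⟨e.1, e.2.edge_mem⟩, (hlab ⟨e.1, e.2.edge_mem⟩ i j).1 e.2⟩
          left_inv := fun _ => rfl
          right_inv := fun _ => rfl }
    have e2 : Nat.card {k : Fin l.length // l.get k = s(i, j)} = l.count s(i, j) := by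
      rw [Nat.card_eq_fintype_card, Fintype.card_subtype, Finset.card_def]
      conv_rhs => rw [← List.map_get_finRange l, List.count_eq_countP, List.countP_map,
        List.countP_eq_length_filter]
      rfl
    rw [e1, e2, hcount]
  let ψ : E(G) ≃ Fin l.length := Equiv.ofFiberEquiv fun c => (hfib c).some
  have hψ : ∀ e, l.get (ψ e) = lab e := fun e => Equiv.ofFiberEquiv_map _ e
  have hmem' : ∀ k : Fin l.length, k ∈ E(ofEdgeList l) := by
    intro k
    rw [edgeSet_eq_setOfPred_exists_isLink]
    induction hk : l.get k with
    | _ i j => exact ⟨i, j, hk.symm⟩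
  let φ' : Fin n ≃ V(G) := Equiv.ofBijective (fun i => ⟨φ i, hmem i⟩)
    ⟨fun i j hij => hinj (congrArg Subtype.val hij),
      fun x => (hsurj x.2).imp fun i hi => Subtype.ext hi⟩
  refine ⟨φ'.symm.trans (Equiv.Set.univ (Fin n)).symm,
    ψ.trans (Equiv.subtypeUnivEquiv hmem').symm, fun e x y => ?_⟩
  obtain ⟨i, rfl⟩ := φ'.surjective x
  obtain ⟨j, rfl⟩ := φ'.surjective y
  change G.IsLink e (φ i) (φ j) ↔ s(φ'.symm (φ' i), φ'.symm (φ' j)) = l.get (ψ e)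
  rw [hlab, hψ, Equiv.symm_apply_apply, Equiv.symm_apply_apply]
  exact eq_comm

end

theorem InClassM.exists_isAdmissibleNode (hG : G.InClassM) (h3 : G.IsThreeConn)
    (hδ : G.IsMinDegree 3) (hbase : ¬ G.IsBaseGraph)
    (h : (G.IsEssentiallyEdgeConn 5 ∧ ¬ ∃ X : Set α, G.IsProperCritical X) ∨
      (G.IsEssentiallyEdgeConn 4 ∧ ∃ X : Set α, G.IsProperCritical X)) :
    ∃ v : α, G.IsAdmissibleNode v := by
  classical
  by_contra hna
  have hC : G.IsCircuit := hG.elim (·.1) (·.isCircuit)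
  have hE := hC.finite_edgeSet
  obtain ⟨V, hV⟩ := hC.finite_vertexSet.exists_finset_coe
  have hT := hG.isThreeConnCircuit hV h3
  have hVc : V(G).ncard = V.card := by rw [← hV, Set.ncard_coe_finset]
  obtain ⟨v, hvV, hv⟩ := hδ.1
  have hnode : MultCircuit.IsNode V G.linkCount v :=
    ⟨by rwa [← Finset.mem_coe, hV], by rw [deg_linkCount hV hE, hv]; rfl⟩
  have hcrit : ∀ X ⊆ V, X.Nonempty → X.card + 2 ≤ V.card →
      (G.IsProperCritical X ↔ MultCircuit.slack G.linkCount X ≤ 1) := by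
    intro X hX hne hc
    have hXV : X ⊂ V := hX.ssubset_of_ne fun he => by rw [he] at hc; omega
    have hpos := hT.slack_pos X hXV hne
    rw [slack_linkCount hE] at hpos ⊢
    rw [IsProperCritical, IsCritical, Set.ncard_coe_finset, hVc, ← hV, Finset.coe_ssubset]
    constructor
    · rintro ⟨⟨-, h1⟩, -⟩; omega
    · exact fun h1 => ⟨⟨hXV, by omega⟩, by omega⟩
  have hlt : ∀ {S}, S ⊆ V → 2 ≤ (V \ S).card → S.card + 2 ≤ V.card := fun {S} hS h2 => by
    have := Finset.card_sdiff_add_card_eq_card hS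
    omega
  obtain ⟨B, hB, hr⟩ := hT.isBase (noAdmissible hV hE hT hna) hnode (by
    rcases h with ⟨hess, hno⟩ | ⟨hess, X, hX⟩
    · have hnc : ∀ X ⊆ V, X.Nonempty → X.card + 2 ≤ V.card →
          2 ≤ MultCircuit.slack G.linkCount X := fun X hX hne hc => by
        by_contra! hlt
        exact hno ⟨X, (hcrit X hX hne hc).2 (by omega)⟩
      refine .inl ⟨fun S hS h1 h2 => ?_, hnc⟩
      -- Essential connectivity excludes only cuts of exactly four edges; smaller ones are excluded
      -- because both sides have slack at least 2.
      have hb := between_ne_of_isEssentiallyEdgeConn hV hE hT (by norm_num) hess hS h1 h2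
      have hs := hT.between_sdiff hS
      have s1 := hnc S hS (Finset.card_pos.1 (by omega)) (hlt hS h2)
      have s2 := hnc (V \ S) Finset.sdiff_subset (Finset.card_pos.1 (by omega)) (by
        have := Finset.card_sdiff_add_card_eq_card hS
        omega)
      push_cast at hb
      omega
    · refine .inr ⟨fun S hS h1 h2 => ?_, ?_⟩
      · have hb := between_ne_of_isEssentiallyEdgeConn hV hE hT (by norm_num) hess hS h1 h2
        have h3 := hT.three_le_between (hS.ssubset_of_ne fun he => by
          have := hlt hS h2
          rw [he] at this
          omega) (Finset.card_pos.1 (by omega))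
        push_cast at hb
        omega
      · obtain ⟨X, rfl⟩ := (hC.finite_vertexSet.subset hX.1.1.subset).exists_finset_coe
        have hXV : X ⊆ V := by
          rw [← Finset.coe_subset, hV]
          exact hX.1.1.subset
        have hc := hX.2
        have hd := hX.1.2
        rw [Set.ncard_coe_finset, hVc] at hc
        rw [Set.ncard_coe_finset] at hd
        have hne : X.Nonempty := Finset.card_pos.1 (by omega)
        exact ⟨X, hXV, hne, hc, (hcrit X hXV hne hc).1 hX⟩)
  exact hbase ⟨B, hB, isIsomorphic_ofEdgeList hV hE hr⟩

end Graph

theorem theorem1p3 {α β : Type*} (G : Graph α β) (hG : G.InClassM) (h3 : G.IsThreeConn)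
    (hδ : G.IsMinDegree 3) (hbase : ¬ G.IsBaseGraph)
    (h : (G.IsEssentiallyEdgeConn 5 ∧ ¬ ∃ X : Set α, G.IsProperCritical X) ∨
      (G.IsEssentiallyEdgeConn 4 ∧ ∃ X : Set α, G.IsProperCritical X)) :
    ∃ v : α, G.IsAdmissibleNode v :=
  hG.exists_isAdmissibleNode h3 hδ hbase h
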